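/- **Setting.** Let $n\ge 1$. A pure peakon configuration consists of reals $x_1<\dots<x_n$ and $m_1,\dots,m_n>0$. Put $$S_k(z)=I-z\,m_k\begin{pmatrix}e^{-x_k}\\-2\\e^{x_k}\end{pmatrix}\begin{pmatrix}e^{x_k}&1&e^{-x_k}\end{pmatrix},\qquad S_{[n,k]}=S_nS_{n-1}\cdots S_{n-k+1}=(s_{ij}),$$ and let $A(z),B(z)$ be the first two entries of the first column of $S_{[n,n]}(z)$. *Spectral data* of the configuration are reals $\lambda_1<\dots<\lambda_n$ which are zeros of $A$, and reals $b_1,\dots,b_n$ with $-\frac{B(z)}{2zA(z)}=\sum_{k=1}^n\frac{b_k}{z-\lambda_k}$. Given such data, let $\mu=\sum_{k=1}^n b_k\delta_{\lambda_k}$ and $$W(z)=\int\frac{d\mu(x)}{z-x},\quad Z(z)=\iint\frac{x\,d\mu(x)d\mu(y)}{(z-x)(x+y)},\quad \gamma_j=\int x^j\,d\mu(x),\quad I_{i,j}=\iint\frac{x^{i+1}y^j}{x+y}\,d\mu(x)d\mu(y),$$ and $\Delta_k^{01}=\det(I_{i,j+1})_{0\le i,j\le k-1}$. For $1\le k\le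 n$, the $k$-th approximation problem asks for complex polynomials $p_k,\hat p_k,q_k$ with $\deg p_k=\deg\hat p_k=k-1$, $\deg q_k=k$, $q_k(0)=2$ and, as $z\to\infty$ in $\mathbb C$, $$W-\frac{p_k}{q_k}=\mathcal O(z^{-k-1}),\qquad Z-\frac{\hat p_k}{q_k}=\mathcal O(z^{-k-1}),\qquad Z(-z)q_k(z)-zW(-z)p_k(z)-\hat p_k(z)=\mathcal O(z^{-k-1}).$$ **Theorem.** (1) Every pure peakon configuration has spectral data, and for any spectral data of it all $\lambda_k>0$ and $b_k>0$. Moreover, for $1\le k\le n$: (a) $\Delta_k^{01}\ne0$, and the $k$-th approximation problem has exactly one solution $(p_k,\hat p_k,q_k)$. It is given by $$q_k(z)=\frac{2}{\Delta_k^{01}}\begin{vmatrix}1&z&\cdots&z^k\\I_{0,0}&I_{0,1}&\cdots&I_{0,k}\\\vdots&\vdots&&\vdots\\I_{k-1,0}&I_{k-1,1}&\cdots&I_{k-1,k}\end{vmatrix},$$ and, for $z\notin\{\lambda_1,\dots,\lambda_n\}$, $$p_k(z)=\int\frac{q_k(z)-q_k(y)}{z-y}\,d\mu(y),\qquad \gamma_0p_k(z)-\hat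 p_k(z)=\iint\frac{(q_k(z)-q_k(y))\,x}{(z-y)(x+y)}\,d\mu(x)d\mu(y).$$ (b) With $q_0=2$, the $q_0,\dots,q_n$ are Cauchy biorthogonal polynomials for $d\alpha(x)=x\,d\mu(x)$, $d\beta=d\mu$: there are real polynomials $\varphi_0,\dots,\varphi_n$ with $\deg\varphi_i=\deg q_i=i$ such that $\iint\frac{\varphi_i(x)q_j(y)}{x+y}\,d\alpha(x)d\beta(y)$ vanishes for $0\le i\ne j\le n$ and is nonzero for $i=j<n$. (c) $2s_{11}(z)=q_k(z)$ and $s_{21}(z)=-z\,p_k(z)$, where $s_{ij}$ are the entries of $S_{[n,k]}$. (d) Writing $p[i]$ for the coefficient of $z^i$ in $p$, $$M_k:=\sum_{i=n-k+1}^n m_i=-\frac{q_k[1]}2=\frac1{\Delta_k^{01}}\begin{vmatrix}I_{0,0}&I_{0,2}&\cdots&I_{0,k}\\\vdots&\vdots&&\vdots\\I_{k-1,0}&I_{k-1,2}&\cdots&I_{k-1,k}\end{vmatrix},$$ $$M_k^+:=\sum_{i=n-k+1}^n m_ie^{x_i}=-\frac{p_k[0]}2=-\frac1{\Delta_k^{01}}\begin{vmatrix}0&\gamma_0&\cdots&\gamma_{k-1}\\I_{0,0}&I_{0,1}&\cdots&I_{0,k}\\\vdots&\vdots&&\vdots\\I_{k-1,0}&I_{k-1,1}&\cdots&I_{k-1,k}\end{vmatrix}.$$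 (e) Hence all $m_i,x_i$ are recovered recursively, for $k=1,\dots,n$: $$m_{n-k+1}=M_k-\sum_{i=n-k+2}^n m_i,\qquad x_{n-k+1}=\ln\frac{M_k^+-\sum_{i=n-k+2}^n m_ie^{x_i}}{m_{n-k+1}},$$ where $M_k,M_k^+$ denote the determinant expressions in (d). In particular $x_n=\ln\gamma_0$ and $m_n=I_{0,0}/I_{0,1}$. (2) Let $J\ni0$ be an open interval and let $x_j(t),m_j(t)$ satisfy on $J$ $$\dot x_j=\sum_{i=1}^n m_ie^{-|x_j-x_i|},\qquad \dot m_j=2\sum_{i=1}^n m_jm_i\,\mathrm{sgn}(x_j-x_i)\,e^{-|x_j-x_i|}\qquad(1\le j\le n),$$ with a pure peakon configuration at $t=0$. If $(\lambda_k,b_k)$ are spectral data at $t=0$, then for every $t\in J$ the configuration $(x(t),m(t))$ is again pure peakon and has spectral data $(\lambda_k,\,b_ke^{t/\lambda_k})$, so that (1) gives all $m_i(t),x_i(t)$ explicitly. -/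

import Mathlib

open MeasureTheory Polynomial Asymptotics Bornology

noncomputable section

namespace DPPeakon

/-! Peakons are numbered `1, …, n`; positions and momenta are functions on `ℕ` of which only the
values at `1, …, n` are used. The same convention holds for the spectral data. -/

/-- The pure peakon assumption: `x₁ < ⋯ < xₙ` and all `mᵢ > 0`. -/
def PurePeakon (n : ℕ) (x m : ℕ → ℝ) : Prop :=
  (∀ i j, 1 ≤ i → i < j → j ≤ n → x i < x j) ∧ ∀ i, 1 ≤ i → i ≤ n → 0 < m i

/-- The system of ordinary differential equations satisfied by the positions and momenta of an
`n`-peakon solution of the Degasperis-Procesi equation, for times in `J`. -/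
def IsPeakonFlow (n : ℕ) (J : Set ℝ) (x m : ℕ → ℝ → ℝ) : Prop :=
  ∀ t ∈ J, ∀ j, 1 ≤ j → j ≤ n →
    HasDerivAt (x j) (∑ i ∈ Finset.Icc 1 n, m i t * Real.exp (-|x j t - x i t|)) t ∧
    HasDerivAt (m j) (2 * ∑ i ∈ Finset.Icc 1 n,
      m j t * m i t * Real.sign (x j t - x i t) * Real.exp (-|x j t - x i t|)) t

/-- The matrix `S(z) = I - z m (e⁻ˣ, -2, eˣ)ᵀ (eˣ, 1, e⁻ˣ)` of one peakon, as a matrix of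
polynomials in `z`. -/
def jumpMatrix (x m : ℝ) : Matrix (Fin 3) (Fin 3) ℝ[X] :=
  1 - (X * C m) • Matrix.vecMulVec ![C (Real.exp (-x)), C (-2), C (Real.exp x)]
    ![C (Real.exp x), C 1, C (Real.exp (-x))]

/-- `S_[n,k] = Sₙ Sₙ₋₁ ⋯ Sₙ₋ₖ₊₁`. -/
def transferMatrix (n : ℕ) (x m : ℕ → ℝ) : ℕ → Matrix (Fin 3) (Fin 3) ℝ[X]
  | 0 => 1
  | k + 1 => transferMatrix n x m k * jumpMatrix (x (n - k)) (m (n - k))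

/-- The polynomial `A`, the first entry of `Sₙ ⋯ S₁ (1, 0, 0)ᵀ`. -/
def coeffA (n : ℕ) (x m : ℕ → ℝ) : ℝ[X] := transferMatrix n x m n 0 0

/-- The polynomial `B`, the second entry of `Sₙ ⋯ S₁ (1, 0, 0)ᵀ`. -/
def coeffB (n : ℕ) (x m : ℕ → ℝ) : ℝ[X] := transferMatrix n x m n 1 0

/-- `(lam, b)` are the spectral data of the peakon configuration `(x, m)`: `lam₁ < ⋯ < lamₙ` are
`n` zeros of `A` (a polynomial of degree `n`), and the `bₖ` are the residues of the Weyl function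
`W(z) = -B(z) / (2 z A(z)) = ∑ₖ bₖ / (z - lamₖ)`. -/
structure IsSpectralData (n : ℕ) (x m lam b : ℕ → ℝ) : Prop where
  strictMono : ∀ i j, 1 ≤ i → i < j → j ≤ n → lam i < lam j
  isRoot : ∀ k, 1 ≤ k → k ≤ n → (coeffA n x m).IsRoot (lam k)
  weyl : ∀ z : ℂ, z ≠ 0 → (∀ k, 1 ≤ k → k ≤ n → z ≠ (lam k : ℂ)) →
    -aeval z (coeffB n x m) / (2 * z * aeval z (coeffA n x m)) =
      ∑ k ∈ Finset.Icc 1 n, (b k : ℂ) / (z - (lam k : ℂ))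

/-- The discrete measure `μ = ∑ₖ bₖ δ_{lamₖ}`. -/
def spectralMeasure (n : ℕ) (lam b : ℕ → ℝ) : Measure ℝ :=
  ∑ k ∈ Finset.Icc 1 n, ENNReal.ofReal (b k) • Measure.dirac (lam k)

/-- `W(z) = ∫ dμ(x) / (z - x)`. -/
def weylW (μ : Measure ℝ) (z : ℂ) : ℂ := ∫ x : ℝ, 1 / (z - (x : ℂ)) ∂μ

/-- `Z(z) = ∬ x / ((z - x) (x + y)) dμ(x) dμ(y)`. -/
def weylZ (μ : Measure ℝ) (z : ℂ) : ℂ :=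
  ∫ y : ℝ, ∫ x : ℝ, (x : ℂ) / ((z - (x : ℂ)) * ((x : ℂ) + (y : ℂ))) ∂μ ∂μ

/-- The moments `γⱼ = ∫ xʲ dμ(x)`. -/
def moment (μ : Measure ℝ) (j : ℕ) : ℝ := ∫ x, x ^ j ∂μ

/-- The bimoments `I_{i,j} = ∬ xⁱ⁺¹ yʲ / (x + y) dμ(x) dμ(y)`. -/
def bimoment (μ : Measure ℝ) (i j : ℕ) : ℝ :=
  ∫ y, ∫ x, x ^ (i + 1) * y ^ j / (x + y) ∂μ ∂μ

/-- `(p, p̂, q)` solves the `k`-th approximation problem (for `k ≥ 1`). -/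
structure IsApproximant (μ : Measure ℝ) (k : ℕ) (p phat q : ℂ[X]) : Prop where
  degree_p : p.degree = ((k - 1 : ℕ) : WithBot ℕ)
  degree_phat : phat.degree = ((k - 1 : ℕ) : WithBot ℕ)
  degree_q : q.degree = (k : WithBot ℕ)
  eval_zero : q.eval 0 = 2
  approx_W : (fun z : ℂ => weylW μ z - p.eval z / q.eval z)
    =O[cobounded ℂ] fun z : ℂ => 1 / z ^ (k + 1)
  approx_Z : (fun z : ℂ => weylZ μ z - phat.eval z / q.eval z)
    =O[cobounded ℂ] fun z : ℂ => 1 / z ^ (k + 1)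
  approx_WZ : (fun z : ℂ => weylZ μ (-z) * q.eval z - z * weylW μ (-z) * p.eval z - phat.eval z)
    =O[cobounded ℂ] fun z : ℂ => 1 / z ^ (k + 1)

/-- The pairing `∬ f(x) g(y) / (x + y) dα(x) dβ(y)`. -/
def cauchyPairing (α β : Measure ℝ) (f g : ℝ[X]) : ℝ :=
  ∫ y, ∫ x, f.eval x * g.eval y / (x + y) ∂α ∂β

/-- `φ₀, …, φ_N` and `ψ₀, …, ψ_N` are Cauchy biorthogonal polynomials for `(α, β)`, where `φᵢ`, `ψᵢ`
have degree `i` and the pairing of `φᵢ` with `ψᵢ` is nonzero for `i < N`. (For measures with exactly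
`N` atoms the pairing of the polynomials of index `N` necessarily vanishes.) -/
structure IsCauchyBiorthogonal (α β : Measure ℝ) (N : ℕ) (φ ψ : ℕ → ℝ[X]) : Prop where
  degree_left : ∀ i ≤ N, (φ i).degree = (i : WithBot ℕ)
  degree_right : ∀ i ≤ N, (ψ i).degree = (i : WithBot ℕ)
  orthogonal : ∀ i ≤ N, ∀ j ≤ N, i ≠ j → cauchyPairing α β (φ i) (ψ j) = 0
  nondegenerate : ∀ i < N, cauchyPairing α β (φ i) (ψ i) ≠ 0

/-- The measure `x dμ(x)`. -/
def xMeasure (μ : Measure ℝ) : Measure ℝ := μ.withDensity fun x => ENNReal.ofReal x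

/-- `Δₖ^{ab} = det (I_{a+i, b+j})`, `0 ≤ i, j ≤ k - 1`. -/
def bimomentDet (μ : Measure ℝ) (a b k : ℕ) : ℝ :=
  (Matrix.of fun i j : Fin k => bimoment μ (a + i) (b + j)).det

/-- `qₖ(z) = (2 / Δₖ^{01}) · det` of the matrix with first row `1, z, …, zᵏ` and further rows
`I_{i,0}, …, I_{i,k}`, `0 ≤ i ≤ k - 1`. -/
def qPoly (μ : Measure ℝ) (k : ℕ) : ℝ[X] :=
  C (2 / bimomentDet μ 0 1 k) *
    (Matrix.of (Matrix.vecCons (fun j : Fin (k + 1) => (X : ℝ[X]) ^ (j : ℕ))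
      (fun (i : Fin k) (j : Fin (k + 1)) => C (bimoment μ i j)))).det

/-- `(1 / Δₖ^{01}) · det` of the `k × k` matrix with rows `I_{i,0}, I_{i,2}, …, I_{i,k}`. -/
def massFormula (μ : Measure ℝ) (k : ℕ) : ℝ :=
  1 / bimomentDet μ 0 1 k *
    (Matrix.of fun i j : Fin k => bimoment μ i (if (j : ℕ) = 0 then 0 else j + 1)).det

/-- `-(1 / Δₖ^{01}) · det` of the matrix with first row `0, γ₀, …, γₖ₋₁` and further rows
`I_{i,0}, …, I_{i,k}`, `0 ≤ i ≤ k - 1`. -/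
def expMassFormula (μ : Measure ℝ) (k : ℕ) : ℝ :=
  -(1 / bimomentDet μ 0 1 k) *
    (Matrix.of (Matrix.vecCons
      (fun j : Fin (k + 1) => if (j : ℕ) = 0 then 0 else moment μ (j - 1))
      (fun (i : Fin k) (j : Fin (k + 1)) => bimoment μ i j))).det

end DPPeakon

end

open DPPeakon

noncomputable section

namespace DPPeakon

/-! ### Transfer matrices -/

/-! Write `u` and `v` for the column and row of one jump and `F` for `flipForm`. Then `v = F u` and
`v · u = 0`, so every jump, and hence every product `S` of jumps, satisfies `S(-z)ᵀ F S(z) = F`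
(`transferMatrix_symm`). This determines the third entry `C` of the first column from `A` and `B`.
It also shows that the inverse of `S_[n,k]` has degree only `k` in `z`.

Spectrum: by induction on `n`, a peakon is added on the right. The old zeros of `A`, together with
`0` and a far point, separate the new zeros. Two facts fix the signs. The combination `B + 2 eˣ A`,
with `x` the new position, is unchanged by the jump. At its zeros the new `A` is the old `A` times a
factor at least `1`, because the Cauchy kernel `1/(x+y)` is positive definite. So all zeros and
residues are positive (`exists_isSpectrum_succ`).

Existence of approximants: factor `S_[n,n] = S_[n,k] S_[n-k,n-k]`. The remainders formed from the
first column of `S_[n,k]` become rational functions whose numerators have degree at most `n`, `n`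
and `n-k`. This gives exactly the required decay (`IsSpectrum.isApproximant`).

Uniqueness: the first two conditions make `p` and `p̂` the polynomial parts of `qW` and `qZ`. The
third remainder then has poles only at the `-λₖ`, and its decay is equivalent to the vanishing of
its first `k` moments. These are `k` linear equations for the coefficients of `q` with bimoment
coefficients (`IsSpectrum.sum_bimoment_mul_coeff`). Given `q(0) = 2`, they are solved by Cramer's
rule because `Δₖ⁰¹` is a Gram determinant of the Cauchy kernel (`bimomentDet_ne_zero`). The same
Cramer identity with other first rows gives the mass formulas.

Biorthogonality: those equations say that `qₖ` is orthogonal to `xⁱ` for `i < k`. For `k < n` the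
pairing with `xᵏ` is nonzero, since the third remainder has exact order `z^(-k-1)`.

Flow: gaps and masses obey `|f'| ≤ K|f|`, so they stay positive. The first columns of the partial
products satisfy a Lax equation (`IsPeakonFlow.hasDerivAt_column`); past the last peakon it reads
`A' = 0` and, at a zero `λ` of `A`, `B' = B/λ`. -/

theorem PurePeakon.of_le {n n' : ℕ} {x m : ℕ → ℝ} (h : PurePeakon n x m) (hn : n' ≤ n) :
    PurePeakon n' x m :=
  ⟨fun i j hi hij hj => h.1 i j hi hij (hj.trans hn), fun i hi hin => h.2 i hi (hin.trans hn)⟩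

/-- The definition extends the product on the right, towards peakon `1`. Inductions on `n` need the
factor of the new rightmost peakon on the left. -/
theorem transferMatrix_succ_left (n : ℕ) (x m : ℕ → ℝ) (k : ℕ) :
    transferMatrix (n + 1) x m (k + 1) =
      jumpMatrix (x (n + 1)) (m (n + 1)) * transferMatrix n x m k := by
  induction k with
  | zero => simp [transferMatrix]
  | succ k ih =>
    rw [transferMatrix, ih, transferMatrix, Matrix.mul_assoc, Nat.add_sub_add_right]

theorem transferMatrix_add (n : ℕ) (x m : ℕ → ℝ) (k j : ℕ) :
    transferMatrix n x m (k + j) = transferMatrix n x m k * transferMatrix (n - k) x m j := by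
  induction j with
  | zero => simp [transferMatrix]
  | succ j ih => rw [← add_assoc, transferMatrix, ih, transferMatrix, Matrix.mul_assoc, Nat.sub_sub]

/-- The column vector of the jump at position `x`. -/
def jumpCol (x : ℝ) : Fin 3 → ℝ := ![Real.exp (-x), -2, Real.exp x]

/-- The row vector of the jump at position `x`, applied to three numbers. -/
def jumpRow (x : ℝ) (c : Fin 3 → ℝ) : ℝ := Real.exp x * c 0 + c 1 + Real.exp (-x) * c 2

theorem jumpMatrix_mul_apply (x m : ℝ) (M : Matrix (Fin 3) (Fin 3) ℝ[X]) (i j : Fin 3) :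
    (jumpMatrix x m * M) i j = M i j - X * (C (m * jumpCol x i) *
      (C (Real.exp x) * M 0 j + M 1 j + C (Real.exp (-x)) * M 2 j)) := by
  rw [jumpMatrix, Matrix.sub_mul, Matrix.one_mul, Matrix.sub_apply, Matrix.mul_apply]
  fin_cases i <;> simp [Fin.sum_univ_three, jumpCol] <;> ring

theorem transferMatrix_succ_apply (n : ℕ) (x m : ℕ → ℝ) (k : ℕ) (i j : Fin 3) :
    transferMatrix (n + 1) x m (k + 1) i j =
      transferMatrix n x m k i j - X * (C (m (n + 1) * jumpCol (x (n + 1)) i) *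
        (C (Real.exp (x (n + 1))) * transferMatrix n x m k 0 j + transferMatrix n x m k 1 j
          + C (Real.exp (-x (n + 1))) * transferMatrix n x m k 2 j)) := by
  rw [transferMatrix_succ_left, jumpMatrix_mul_apply]

theorem transferMatrix_coeff_zero (n : ℕ) (x m : ℕ → ℝ) (k : ℕ) (i j : Fin 3) :
    (transferMatrix n x m k i j).coeff 0 = (1 : Matrix (Fin 3) (Fin 3) ℝ) i j := by
  induction k generalizing n i j with
  | zero => by_cases h : i = j <;> simp [transferMatrix, Matrix.one_apply, h]
  | succ k ih =>
    rw [transferMatrix, jumpMatrix, Matrix.mul_sub, Matrix.mul_one, Matrix.sub_apply, coeff_sub, ih,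
      Matrix.mul_smul, Matrix.smul_apply, smul_eq_mul, mul_assoc, coeff_X_mul_zero, sub_zero]

theorem natDegree_transferMatrix_le (n : ℕ) (x m : ℕ → ℝ) (k : ℕ) (i j : Fin 3) :
    (transferMatrix n x m k i j).natDegree ≤ k := by
  induction k generalizing n i j with
  | zero => by_cases h : i = j <;> simp [transferMatrix, Matrix.one_apply, h]
  | succ k ih =>
    rw [transferMatrix, Matrix.mul_apply]
    refine natDegree_sum_le_of_forall_le _ _ fun l _ => ?_
    refine natDegree_mul_le.trans (add_le_add (ih _ _ _) ?_)
    rw [jumpMatrix, Matrix.sub_apply, Matrix.smul_apply, Matrix.vecMulVec_apply]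
    refine (natDegree_sub_le _ _).trans (max_le ?_ ?_)
    · by_cases h : l = j <;> simp [Matrix.one_apply, h]
    · fin_cases l <;> fin_cases j <;> simp <;> compute_degree

/-- The coefficients of `zᵏ` in the first column of `S_[n,k]` are proportional to the column vector
of the last jump, with a factor of sign `(-1)ᵏ`. -/
theorem exists_coeff_transferMatrix (n : ℕ) (x m : ℕ → ℝ) (h : PurePeakon n x m) (k : ℕ)
    (hk : 1 ≤ k) (hkn : k ≤ n) :
    ∃ g : ℝ, 0 < (-1) ^ k * g ∧
      ∀ i, (transferMatrix n x m k i 0).coeff k = g * jumpCol (x n) i := by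
  induction k, hk using Nat.le_induction generalizing n with
  | base =>
    obtain ⟨n, rfl⟩ : ∃ n', n = n' + 1 := ⟨n - 1, by omega⟩
    refine ⟨-(m (n + 1) * Real.exp (x (n + 1))), ?_, fun i => ?_⟩
    · have := h.2 (n + 1) (by omega) le_rfl
      have := Real.exp_pos (x (n + 1))
      simp only [pow_one, neg_mul, mul_neg, neg_neg, one_mul]
      positivity
    · rw [show (1 : ℕ) = 0 + 1 from rfl, transferMatrix_succ_apply, coeff_sub, coeff_X_mul,
        coeff_C_mul]
      have h1 : ((1 : Matrix (Fin 3) (Fin 3) ℝ[X]) i 0).coeff (0 + 1) = 0 := by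
        by_cases hi : i = 0 <;> simp [Matrix.one_apply, hi, coeff_one]
      simp only [transferMatrix, h1]
      simp
      ring
  | succ k hk ih =>
    obtain ⟨n, rfl⟩ : ∃ n', n = n' + 1 := ⟨n - 1, by omega⟩
    obtain ⟨g, hg, hc⟩ := ih n (h.of_le (Nat.le_succ n)) (by omega)
    have hx : x n < x (n + 1) := h.1 n (n + 1) (by omega) (by omega) le_rfl
    have hm := h.2 (n + 1) (by omega) le_rfl
    refine ⟨-(m (n + 1) * jumpRow (x (n + 1)) (jumpCol (x n)) * g), ?_, fun i => ?_⟩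
    · have hr : 0 < jumpRow (x (n + 1)) (jumpCol (x n)) := by
        -- The row of one jump on the column of the previous one is a perfect square up to a
        -- positive factor; it is nonzero exactly because the positions differ.
        have h1 : jumpRow (x (n + 1)) (jumpCol (x n)) =
            Real.exp (-x (n + 1) + -x n) * (Real.exp (x (n + 1)) - Real.exp (x n)) ^ 2 := by
          simp only [jumpRow, jumpCol, Real.exp_add, Real.exp_neg]
          simp
          field_simp
          ring
        have h2 : 0 < Real.exp (x (n + 1)) - Real.exp (x n) := sub_pos.2 (Real.exp_lt_exp.2 hx)
        rw [h1]
        positivity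
      rw [pow_succ]
      have : 0 < m (n + 1) * jumpRow (x (n + 1)) (jumpCol (x n)) * ((-1) ^ k * g) := by positivity
      linarith
    · have h0 := hc 0
      have h1 := hc 1
      have h2 := hc 2
      have hd : (transferMatrix n x m k i 0).coeff (k + 1) = 0 :=
        coeff_eq_zero_of_natDegree_lt
          ((natDegree_transferMatrix_le n x m k i 0).trans_lt (Nat.lt_succ_self k))
      rw [transferMatrix_succ_apply, coeff_sub, coeff_X_mul, hd, coeff_C_mul, coeff_add, coeff_add,
        coeff_C_mul, coeff_C_mul, h0, h1, h2, jumpRow]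
      ring

theorem coeff_one_transferMatrix (n : ℕ) (x m : ℕ → ℝ) (k : ℕ) (hkn : k ≤ n) :
    (transferMatrix n x m k 0 0).coeff 1 = -∑ i ∈ Finset.Icc (n - k + 1) n, m i ∧
    (transferMatrix n x m k 1 0).coeff 1 =
      2 * ∑ i ∈ Finset.Icc (n - k + 1) n, m i * Real.exp (x i) := by
  induction k generalizing n with
  | zero => simp [transferMatrix, coeff_one]
  | succ k ih =>
    obtain ⟨n, rfl⟩ : ∃ n', n = n' + 1 := ⟨n - 1, by omega⟩
    obtain ⟨h0, h1⟩ := ih n (by omega)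
    have e : n + 1 - (k + 1) + 1 = n - k + 1 := by omega
    rw [e, Finset.sum_Icc_succ_top (by omega), Finset.sum_Icc_succ_top (by omega),
      transferMatrix_succ_apply, transferMatrix_succ_apply, coeff_sub, coeff_sub, h0, h1]
    have hX : ∀ p : ℝ[X], (X * p).coeff 1 = p.coeff 0 := fun p => coeff_X_mul p 0
    rw [hX, hX]
    simp only [coeff_C_mul, coeff_add, transferMatrix_coeff_zero]
    have := Real.exp_pos (x (n + 1))
    simp [jumpCol, Real.exp_neg]
    constructor <;> field_simp
    ring

/-- The bilinear form preserved by the transfer matrices. -/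
def flipForm : Matrix (Fin 3) (Fin 3) ℝ[X] :=
  !![0, 0, 1; 0, C (-1 / 2), 0; 1, 0, 0]

/-- A single jump is `I - z m u uᵀ F` with `uᵀ F u = 0`: the terms linear in `z` cancel against
those of the factor at `-z`, and the quadratic term vanishes. Products inherit the identity. -/
theorem transferMatrix_symm (n : ℕ) (x m : ℕ → ℝ) (k : ℕ) :
    ((transferMatrix n x m k).map fun p => p.comp (-X)).transpose * flipForm *
      transferMatrix n x m k = flipForm := by
  have hmap : ∀ M : Matrix (Fin 3) (Fin 3) ℝ[X],
      (M.map fun p => p.comp (-X)) = (compRingHom (-X : ℝ[X])).mapMatrix M := fun M => rfl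
  induction k with
  | zero => rw [transferMatrix, hmap, map_one]; simp
  | succ k ih =>
    rw [hmap] at ih ⊢
    rw [transferMatrix, map_mul, Matrix.transpose_mul,
      show ∀ a b c d e : Matrix (Fin 3) (Fin 3) ℝ[X], a * b * c * (d * e) = a * (b * c * d) * e from
        fun a b c d e => by simp only [Matrix.mul_assoc], ih]
    set y := x (n - k)
    have h : (C (Real.exp y) : ℝ[X]) * C (Real.exp (-y)) = 1 := by
      rw [← C_mul, ← Real.exp_add]; simp
    have h2 : (C (-1 / 2 : ℝ) : ℝ[X]) * 2 = -1 := by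
      rw [show (2 : ℝ[X]) = C 2 from rfl, ← C_mul]; norm_num
    have h3 : (C 2 : ℝ[X]) = 2 := rfl
    ext1 i j
    fin_cases i <;> fin_cases j <;>
    simp [jumpMatrix, flipForm, Matrix.mul_apply, Fin.sum_univ_three] <;>
    grobner

/-! ### Positive definiteness of the Cauchy kernel -/

/-- The quadratic form of the Cauchy kernel `1 / (x + y)` on the points `v i`, `i ∈ s`. -/
def cauchyForm {ι : Type*} (s : Finset ι) (v c : ι → ℝ) : ℝ :=
  ∑ i ∈ s, ∑ j ∈ s, c i * c j / (v i + v j)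

/-- One step of symmetric Gaussian elimination on the Cauchy matrix. Subtracting `2vₐ /
((vₐ+vᵢ)(vₐ+vⱼ))` from `1/(vᵢ+vⱼ)` leaves the same kernel multiplied by `(vᵢ-vₐ)/(vᵢ+vₐ)` and the
like factor in `j`, which kills row and column `a`. -/
theorem cauchyForm_insert {ι : Type*} [DecidableEq ι] (s : Finset ι) (v c : ι → ℝ) (a : ι)
    (ha : a ∉ s) (hv : ∀ i ∈ insert a s, 0 < v i) :
    cauchyForm (insert a s) v c = 2 * v a * (∑ i ∈ insert a s, c i / (v a + v i)) ^ 2 +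
      cauchyForm s v fun i => c i * ((v i - v a) / (v i + v a)) := by
  have hva := hv a (Finset.mem_insert_self a s)
  have key : cauchyForm (insert a s) v c - 2 * v a * (∑ i ∈ insert a s, c i / (v a + v i)) ^ 2 =
      ∑ i ∈ insert a s, ∑ j ∈ insert a s, (c i * ((v i - v a) / (v i + v a))) *
        (c j * ((v j - v a) / (v j + v a))) / (v i + v j) := by
    rw [cauchyForm, sq, Finset.sum_mul_sum, Finset.mul_sum, ← Finset.sum_sub_distrib]
    refine Finset.sum_congr rfl fun i hi => ?_
    rw [Finset.mul_sum, ← Finset.sum_sub_distrib]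
    refine Finset.sum_congr rfl fun j hj => ?_
    have := hv i hi
    have := hv j hj
    have : v i + v j ≠ 0 := by positivity
    have : v a + v i ≠ 0 := by positivity
    have : v a + v j ≠ 0 := by positivity
    have : v i + v a ≠ 0 := by positivity
    have : v j + v a ≠ 0 := by positivity
    field_simp
    ring
  have hz : ∀ i, (c a * ((v a - v a) / (v a + v a))) * (c i * ((v i - v a) / (v i + v a))) /
      (v a + v i) = 0 := fun i => by simp
  have hz' : ∀ i, (c i * ((v i - v a) / (v i + v a))) * (c a * ((v a - v a) / (v a + v a))) /
      (v i + v a) = 0 := fun i => by simp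
  have hs : ∑ i ∈ insert a s, ∑ j ∈ insert a s, (c i * ((v i - v a) / (v i + v a))) *
      (c j * ((v j - v a) / (v j + v a))) / (v i + v j) =
      cauchyForm s v fun i => c i * ((v i - v a) / (v i + v a)) := by
    rw [Finset.sum_insert ha, Finset.sum_eq_zero fun i _ => hz i, zero_add, cauchyForm]
    exact Finset.sum_congr rfl fun i _ => by rw [Finset.sum_insert ha, hz', zero_add]
  linarith

theorem cauchyForm_nonneg {ι : Type*} (s : Finset ι) (v c : ι → ℝ) (hv : ∀ i ∈ s, 0 < v i) :
    0 ≤ cauchyForm s v c := by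
  classical
  induction s using Finset.induction_on generalizing c with
  | empty => simp [cauchyForm]
  | insert a s ha ih =>
    rw [cauchyForm_insert s v c a ha hv]
    have := hv a (Finset.mem_insert_self a s)
    have := ih (fun i => c i * ((v i - v a) / (v i + v a)))
      fun i hi => hv i (Finset.mem_insert_of_mem hi)
    positivity

/-- Both nonnegative parts of the elimination step must vanish. Distinct nodes make the scaling
factors nonzero, so the induction hypothesis reaches the original coefficients, and the square then
disposes of the last one. -/
theorem eq_zero_of_cauchyForm_eq_zero {ι : Type*} (s : Finset ι) (v c : ι → ℝ)
    (hv : ∀ i ∈ s, 0 < v i) (hinj : Set.InjOn v s) (h : cauchyForm s v c = 0) :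
    ∀ i ∈ s, c i = 0 := by
  classical
  induction s using Finset.induction_on generalizing c with
  | empty => simp
  | insert a s ha ih =>
    have hva := hv a (Finset.mem_insert_self a s)
    have hv' : ∀ i ∈ s, 0 < v i := fun i hi => hv i (Finset.mem_insert_of_mem hi)
    rw [cauchyForm_insert s v c a ha hv] at h
    have h1 := cauchyForm_nonneg s v (fun i => c i * ((v i - v a) / (v i + v a))) hv'
    have h2 : 0 ≤ 2 * v a * (∑ i ∈ insert a s, c i / (v a + v i)) ^ 2 := by positivity
    have h3 : ∀ i ∈ s, c i = 0 := fun i hi => by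
      have := ih (fun i => c i * ((v i - v a) / (v i + v a))) hv'
        (hinj.mono (by simp)) (by linarith) i hi
      have hne : v i - v a ≠ 0 := fun h0 => ha (by
        rw [← hinj (by simp [hi]) (by simp) (sub_eq_zero.1 h0)]; exact hi)
      have : v i + v a ≠ 0 := by have := hv' i hi; positivity
      simp_all
    have h4 : (∑ i ∈ insert a s, c i / (v a + v i)) = 0 := by
      have : 2 * v a * (∑ i ∈ insert a s, c i / (v a + v i)) ^ 2 = 0 := by linarith
      simpa [hva.ne'] using this
    rw [Finset.sum_insert ha, Finset.sum_eq_zero fun i hi => by rw [h3 i hi, zero_div],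
      add_zero, div_eq_zero_iff] at h4
    intro i hi
    rcases Finset.mem_insert.1 hi with rfl | hi
    · exact h4.resolve_right (by positivity)
    · exact h3 i hi

/-! ### Partial fractions -/

theorem eq_C_mul_nodal {K ι : Type*} [Field K] (s : Finset ι) (v : ι → K) (hv : Set.InjOn v s)
    (A : K[X]) (hdeg : A.natDegree ≤ s.card) (hroot : ∀ i ∈ s, A.eval (v i) = 0) :
    A = C (A.coeff s.card) * Lagrange.nodal s v := by
  refine Polynomial.eq_of_degree_sub_lt_of_eval_index_eq s hv ?_ fun i hi => by
    rw [hroot i hi, eval_mul, Lagrange.eval_nodal_at_node hi, mul_zero]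
  rw [degree_lt_iff_coeff_zero]
  intro j hj
  rw [coeff_sub, coeff_C_mul]
  rcases hj.eq_or_lt with rfl | hj
  · have : (Lagrange.nodal s v).coeff s.card = 1 := by
      have h := (Lagrange.nodal_monic (s := s) (v := v)).coeff_natDegree
      rwa [Lagrange.natDegree_nodal] at h
    rw [this, mul_one, sub_self]
  · rw [coeff_eq_zero_of_natDegree_lt (hdeg.trans_lt hj), coeff_eq_zero_of_natDegree_lt
      (p := Lagrange.nodal s v) (by rwa [Lagrange.natDegree_nodal]), mul_zero, sub_zero]

/-- Lagrange interpolation in barycentric form: the nodal weight at `vᵢ` is the inverse of the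
derivative of the nodal polynomial there, and `A` is a multiple of that polynomial. -/
theorem eval_eq_mul_sum {K ι : Type*} [Field K] (s : Finset ι) (v : ι → K) (hv : Set.InjOn v s)
    (A P : K[X]) (hA : A.natDegree ≤ s.card) (hroot : ∀ i ∈ s, A.eval (v i) = 0)
    (hlead : A.coeff s.card ≠ 0) (hP : P.degree < s.card) (r : ι → K)
    (hr : ∀ i ∈ s, P.eval (v i) = r i * (derivative A).eval (v i)) (z : K)
    (hz : ∀ i ∈ s, z ≠ v i) : P.eval z = A.eval z * ∑ i ∈ s, r i / (z - v i) := by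
  classical
  have hA' := eq_C_mul_nodal s v hv A hA hroot
  set a := A.coeff s.card
  rw [Lagrange.eq_interpolate hv hP, Lagrange.eval_interpolate_not_at_node _ hz, hA', eval_mul,
    eval_C, mul_comm a, mul_assoc]
  congr 1
  rw [Finset.mul_sum]
  refine Finset.sum_congr rfl fun i hi => ?_
  have h0 := Lagrange.nodalWeight_ne_zero hv hi
  rw [hr i hi, hA', derivative_C_mul, eval_C_mul, ← inv_inv (eval (v i) (derivative _)),
    ← Lagrange.nodalWeight_eq_eval_derivative_nodal hi]
  field_simp

/-- Partial fraction expansion of a polynomial divisible by `X` over a product of linear factors,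
evaluated in an extension field. -/
theorem aeval_eq_mul_sum {ι : Type*} (K : Type*) [Field K] [Algebra ℝ K] (s : Finset ι) (v : ι → ℝ)
    (hv : Set.InjOn v s) (A P : ℝ[X]) (hA : A.natDegree ≤ s.card)
    (hroot : ∀ i ∈ s, A.eval (v i) = 0) (hlead : A.coeff s.card ≠ 0) (hP : P.natDegree ≤ s.card)
    (hP0 : P.coeff 0 = 0) (r : ι → ℝ) (hv0 : ∀ i ∈ s, v i ≠ 0)
    (hr : ∀ i ∈ s, P.eval (v i) = v i * r i * (derivative A).eval (v i)) (z : K)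
    (hz : ∀ i ∈ s, z ≠ algebraMap ℝ K (v i)) :
    aeval z P = z * aeval z A * ∑ i ∈ s, algebraMap ℝ K (r i) / (z - algebraMap ℝ K (v i)) := by
  have hinj := (algebraMap ℝ K).injective
  have hdec : P = X * P.divX := by
    have h := X_mul_divX_add P
    rwa [hP0, C_0, add_zero, eq_comm] at h
  have hdeg : (P.divX.map (algebraMap ℝ K)).degree < s.card := by
    rw [degree_map, degree_lt_iff_coeff_zero]
    intro j hj
    rw [coeff_divX]
    exact coeff_eq_zero_of_natDegree_lt (by omega)
  have key := eval_eq_mul_sum s (fun i => algebraMap ℝ K (v i))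
    (fun i hi j hj h => hv hi hj (hinj h)) (A.map (algebraMap ℝ K)) (P.divX.map (algebraMap ℝ K))
    (by rwa [natDegree_map]) (fun i hi => by rw [eval_map_apply, hroot i hi, map_zero])
    (by rw [coeff_map]; exact (_root_.map_ne_zero _).2 hlead) hdeg (fun i => algebraMap ℝ K (r i))
    (fun i hi => by
      rw [eval_map_apply, derivative_map, eval_map_apply, ← map_mul]
      have h := hr i hi
      rw [hdec, eval_mul, eval_X, mul_assoc] at h
      rw [mul_left_cancel₀ (hv0 i hi) h]) z hz
  rw [eval_map_algebraMap, eval_map_algebraMap] at key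
  conv_lhs => rw [hdec, map_mul, aeval_X, key]
  ring

/-! ### Spectra -/

/-- The polynomial `C`, the third entry of `Sₙ ⋯ S₁ (1, 0, 0)ᵀ`. -/
def coeffC (n : ℕ) (x m : ℕ → ℝ) : ℝ[X] := transferMatrix n x m n 2 0

/-- Positive simple zeros of `A` together with the residues of the Weyl function, expressed through
the values of `B` and `A'`. -/
structure IsSpectrum (n : ℕ) (x m lam b : ℕ → ℝ) : Prop where
  strictMono : ∀ i j, 1 ≤ i → i < j → j ≤ n → lam i < lam j
  pos : ∀ k, 1 ≤ k → k ≤ n → 0 < lam k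
  eval_coeffA : ∀ k, 1 ≤ k → k ≤ n → (coeffA n x m).eval (lam k) = 0
  eval_coeffB : ∀ k, 1 ≤ k → k ≤ n → (coeffB n x m).eval (lam k) =
    lam k * (-2 * b k) * (derivative (coeffA n x m)).eval (lam k)

theorem injOn_of_strictMono {n : ℕ} {lam : ℕ → ℝ}
    (h : ∀ i j, 1 ≤ i → i < j → j ≤ n → lam i < lam j) :
    Set.InjOn lam (Finset.Icc 1 n : Finset ℕ) := by
  intro i hi j hj hij
  simp only [Finset.coe_Icc, Set.mem_Icc] at hi hj
  rcases lt_trichotomy i j with h1 | h1 | h1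
  · exact absurd hij (h i j hi.1 h1 hj.2).ne
  · exact h1
  · exact absurd hij (h j i hj.1 h1 hi.2).ne'

theorem coeffA_coeff_ne_zero {n : ℕ} {x m : ℕ → ℝ} (h : PurePeakon n x m) :
    (coeffA n x m).coeff n ≠ 0 := by
  rcases Nat.eq_zero_or_pos n with rfl | hn
  · simp [coeffA, transferMatrix]
  · obtain ⟨g, hg, hc⟩ := exists_coeff_transferMatrix n x m h n hn le_rfl
    have : g ≠ 0 := by rintro rfl; simp at hg
    rw [coeffA, hc]
    simp [jumpCol, this]

theorem coeffA_eq_nodal {n : ℕ} {x m lam : ℕ → ℝ}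
    (hlam : ∀ i j, 1 ≤ i → i < j → j ≤ n → lam i < lam j)
    (hroot : ∀ k, 1 ≤ k → k ≤ n → (coeffA n x m).eval (lam k) = 0) :
    coeffA n x m = C ((coeffA n x m).coeff n) * Lagrange.nodal (Finset.Icc 1 n) lam := by
  have h := eq_C_mul_nodal (Finset.Icc 1 n) lam (injOn_of_strictMono hlam) (coeffA n x m)
    (by simpa [coeffA] using natDegree_transferMatrix_le n x m n 0 0)
    fun i hi => hroot i (Finset.mem_Icc.1 hi).1 (Finset.mem_Icc.1 hi).2
  simpa using h

theorem exists_eq_of_eval_coeffA_eq_zero {n : ℕ} {x m lam : ℕ → ℝ} (h : PurePeakon n x m)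
    (hlam : ∀ i j, 1 ≤ i → i < j → j ≤ n → lam i < lam j)
    (hroot : ∀ k, 1 ≤ k → k ≤ n → (coeffA n x m).eval (lam k) = 0)
    {z : ℝ} (hz : (coeffA n x m).eval z = 0) : ∃ k, 1 ≤ k ∧ k ≤ n ∧ z = lam k := by
  rw [coeffA_eq_nodal hlam hroot, eval_mul, eval_C, mul_eq_zero,
    or_iff_right (coeffA_coeff_ne_zero h), Lagrange.eval_nodal, Finset.prod_eq_zero_iff] at hz
  obtain ⟨k, hk, hk'⟩ := hz
  exact ⟨k, (Finset.mem_Icc.1 hk).1, (Finset.mem_Icc.1 hk).2, sub_eq_zero.1 hk'⟩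

theorem derivative_coeffA_ne_zero {n : ℕ} {x m lam : ℕ → ℝ} (h : PurePeakon n x m)
    (hlam : ∀ i j, 1 ≤ i → i < j → j ≤ n → lam i < lam j)
    (hroot : ∀ k, 1 ≤ k → k ≤ n → (coeffA n x m).eval (lam k) = 0) (k : ℕ) (hk : 1 ≤ k)
    (hkn : k ≤ n) : (derivative (coeffA n x m)).eval (lam k) ≠ 0 := by
  have hmem : k ∈ Finset.Icc 1 n := Finset.mem_Icc.2 ⟨hk, hkn⟩
  rw [coeffA_eq_nodal hlam hroot, derivative_C_mul, eval_C_mul,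
    Lagrange.eval_nodal_derivative_eval_node_eq hmem, Lagrange.eval_nodal]
  refine mul_ne_zero (coeffA_coeff_ne_zero h) (Finset.prod_ne_zero_iff.2 fun j hj => ?_)
  rw [Finset.mem_erase] at hj
  exact sub_ne_zero.2 fun e => hj.1 ((injOn_of_strictMono hlam) hj.2 hmem e.symm)

theorem IsSpectrum.aeval_eq {n : ℕ} {x m lam b : ℕ → ℝ} (h : IsSpectrum n x m lam b)
    (hp : PurePeakon n x m) (K : Type*) [Field K] [Algebra ℝ K] (i : Fin 3) (hi : i ≠ 0)
    (r : ℕ → ℝ) (hr : ∀ k, 1 ≤ k → k ≤ n → (transferMatrix n x m n i 0).eval (lam k) =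
      lam k * r k * (derivative (coeffA n x m)).eval (lam k)) (z : K)
    (hz : ∀ k, 1 ≤ k → k ≤ n → z ≠ algebraMap ℝ K (lam k)) :
    aeval z (transferMatrix n x m n i 0) = z * aeval z (coeffA n x m) *
      ∑ k ∈ Finset.Icc 1 n, algebraMap ℝ K (r k) / (z - algebraMap ℝ K (lam k)) := by
  have hI : ∀ {p : ℕ → Prop}, (∀ k, 1 ≤ k → k ≤ n → p k) → ∀ k ∈ Finset.Icc 1 n, p k :=
    fun hp k hk => hp k (Finset.mem_Icc.1 hk).1 (Finset.mem_Icc.1 hk).2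
  refine aeval_eq_mul_sum K (Finset.Icc 1 n) lam (injOn_of_strictMono h.strictMono) _ _
    (by simpa [coeffA] using natDegree_transferMatrix_le n x m n 0 0) (hI h.eval_coeffA)
    (by simpa using coeffA_coeff_ne_zero hp) (by simpa using natDegree_transferMatrix_le n x m n i 0)
    ?_ _ (hI fun k h1 h2 => (h.pos k h1 h2).ne') (hI hr) z (hI hz)
  rw [transferMatrix_coeff_zero, Matrix.one_apply_ne hi]

/-- `B(z) = -2 z A(z) ∑ bₖ / (z - λₖ)`. -/
theorem IsSpectrum.aeval_coeffB {n : ℕ} {x m lam b : ℕ → ℝ} (h : IsSpectrum n x m lam b)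
    (hp : PurePeakon n x m) {K : Type*} [Field K] [Algebra ℝ K] (z : K)
    (hz : ∀ k, 1 ≤ k → k ≤ n → z ≠ algebraMap ℝ K (lam k)) :
    aeval z (coeffB n x m) = -2 * z * aeval z (coeffA n x m) *
      ∑ k ∈ Finset.Icc 1 n, algebraMap ℝ K (b k) / (z - algebraMap ℝ K (lam k)) := by
  rw [coeffB, h.aeval_eq hp K 1 (by decide) _ h.eval_coeffB z hz]
  have e : ∑ k ∈ Finset.Icc 1 n, algebraMap ℝ K (-2 * b k) / (z - algebraMap ℝ K (lam k)) =
      -2 * ∑ k ∈ Finset.Icc 1 n, algebraMap ℝ K (b k) / (z - algebraMap ℝ K (lam k)) := by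
    rw [Finset.mul_sum]
    refine Finset.sum_congr rfl fun k _ => ?_
    rw [map_mul, map_neg, map_ofNat, mul_div_assoc]
  rw [e]
  ring

/-- The `(0,0)` entry of the invariance of `flipForm`. It links `C` to `A` and `B` and is the source
of the second Weyl function. -/
theorem coeff_symm (n : ℕ) (x m : ℕ → ℝ) (k : ℕ) (z : ℝ) :
    (transferMatrix n x m k 0 0).eval z * (transferMatrix n x m k 2 0).eval (-z) +
      (transferMatrix n x m k 2 0).eval z * (transferMatrix n x m k 0 0).eval (-z) =
    (transferMatrix n x m k 1 0).eval z * (transferMatrix n x m k 1 0).eval (-z) / 2 := by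
  have h := congrArg (fun M => (M 0 0).eval z) (transferMatrix_symm n x m k)
  simp [flipForm, Matrix.mul_apply, Fin.sum_univ_three, Matrix.transpose_apply] at h
  linarith

/-- At a zero of `A` the symmetry reads `C(λ) A(-λ) = B(λ) B(-λ) / 2`. Since all zeros are positive,
`A(-λ) ≠ 0` and the partial fractions of `B` apply at `-λ`. -/
theorem IsSpectrum.eval_coeffC {n : ℕ} {x m lam b : ℕ → ℝ} (h : IsSpectrum n x m lam b)
    (hp : PurePeakon n x m) (k : ℕ) (hk : 1 ≤ k) (hkn : k ≤ n) :
    (coeffC n x m).eval (lam k) = lam k * (2 * lam k * b k *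
      ∑ j ∈ Finset.Icc 1 n, b j / (lam k + lam j)) * (derivative (coeffA n x m)).eval (lam k) := by
  have hpos := h.pos k hk hkn
  have hne : ∀ j, 1 ≤ j → j ≤ n → -lam k ≠ lam j := fun j h1 h2 => by
    have := h.pos j h1 h2
    linarith
  have hA : (coeffA n x m).eval (-lam k) ≠ 0 := fun h0 => by
    obtain ⟨j, h1, h2, h3⟩ := exists_eq_of_eval_coeffA_eq_zero hp h.strictMono h.eval_coeffA h0
    exact hne j h1 h2 h3
  have hB := h.aeval_coeffB hp (K := ℝ) (-lam k) hne
  simp only [Algebra.algebraMap_self, RingHom.id_apply, coe_aeval_eq_eval] at hB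
  have hs := coeff_symm n x m n (lam k)
  change (coeffA n x m).eval _ * _ + (coeffC n x m).eval _ * (coeffA n x m).eval _ =
    (coeffB n x m).eval _ * (coeffB n x m).eval _ / 2 at hs
  have e : ∑ j ∈ Finset.Icc 1 n, b j / (-lam k - lam j) =
      -∑ j ∈ Finset.Icc 1 n, b j / (lam k + lam j) := by
    rw [← Finset.sum_neg_distrib]
    refine Finset.sum_congr rfl fun j _ => ?_
    rw [← neg_add', div_neg]
  rw [h.eval_coeffA k hk hkn, h.eval_coeffB k hk hkn, hB, e] at hs
  refine mul_right_cancel₀ hA ?_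
  linear_combination hs

/-- `C(z) = 2 z A(z) ∑ₖ ∑ⱼ λₖ bₖ bⱼ / ((λₖ + λⱼ) (z - λₖ))`. -/
theorem IsSpectrum.aeval_coeffC {n : ℕ} {x m lam b : ℕ → ℝ} (h : IsSpectrum n x m lam b)
    (hp : PurePeakon n x m) {K : Type*} [Field K] [Algebra ℝ K] (z : K)
    (hz : ∀ k, 1 ≤ k → k ≤ n → z ≠ algebraMap ℝ K (lam k)) :
    aeval z (coeffC n x m) = z * aeval z (coeffA n x m) *
      ∑ k ∈ Finset.Icc 1 n, algebraMap ℝ K (2 * lam k * b k *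
        ∑ j ∈ Finset.Icc 1 n, b j / (lam k + lam j)) / (z - algebraMap ℝ K (lam k)) :=
  h.aeval_eq hp K 2 (by decide) _ (h.eval_coeffC hp) z hz

/-- The leading coefficients of `A` and `B` are in the ratio `e^{-xₙ} : -2`, so the Weyl function
behaves like `e^{xₙ}/z` at infinity; its `1/z` coefficient is also the total residue. -/
theorem IsSpectrum.sum_eq {n : ℕ} {x m lam b : ℕ → ℝ} (h : IsSpectrum n x m lam b)
    (hp : PurePeakon n x m) (hn : 1 ≤ n) : ∑ k ∈ Finset.Icc 1 n, b k = Real.exp (x n) := by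
  obtain ⟨g, hg, hc⟩ := exists_coeff_transferMatrix n x m hp n hn le_rfl
  have hg0 : g ≠ 0 := by rintro rfl; simp at hg
  have hA : (coeffA n x m).coeff n = g * Real.exp (-x n) := hc 0
  have hB : (coeffB n x m).coeff n = g * -2 := hc 1
  have hdec : coeffB n x m = X * (coeffB n x m).divX := by
    have h := X_mul_divX_add (coeffB n x m)
    rwa [coeffB, transferMatrix_coeff_zero, Matrix.one_apply_ne (by decide), C_0, add_zero,
      eq_comm] at h
  have hcard : (Finset.Icc 1 n).card = n := by simp
  have hdeg : (coeffB n x m).divX.degree < (Finset.Icc 1 n).card := by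
    rw [degree_lt_iff_coeff_zero]
    intro j hj
    rw [coeff_divX]
    have := natDegree_transferMatrix_le n x m n 1 0
    exact coeff_eq_zero_of_natDegree_lt (by rw [coeffB]; omega)
  have hinj := injOn_of_strictMono h.strictMono
  have key := Lagrange.coeff_eq_sum hinj hdeg
  rw [hcard, coeff_divX, Nat.sub_add_cancel hn, hB, Finset.sum_congr rfl (g := fun k =>
    -2 * g * Real.exp (-x n) * b k), ← Finset.mul_sum, Real.exp_neg] at key
  · have := Real.exp_pos (x n)
    field_simp at key
    linarith
  · intro k hk
    obtain ⟨h1, h2⟩ := Finset.mem_Icc.1 hk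
    have hb := h.eval_coeffB k h1 h2
    rw [coeffA_eq_nodal h.strictMono h.eval_coeffA, derivative_C_mul, eval_C_mul,
      Lagrange.eval_nodal_derivative_eval_node_eq hk, Lagrange.eval_nodal, hA, hdec, eval_mul,
      eval_X, mul_assoc] at hb
    rw [mul_left_cancel₀ (h.pos k h1 h2).ne' hb]
    have hprod : ∏ j ∈ (Finset.Icc 1 n).erase k, (lam k - lam j) ≠ 0 :=
      Finset.prod_ne_zero_iff.2 fun j hj => by
        rw [Finset.mem_erase] at hj
        exact sub_ne_zero.2 fun e => hj.1 (hinj hj.2 hk e.symm)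
    field_simp

/-! ### Existence of spectral data -/

theorem sign_prod {n k : ℕ} (f : ℕ → ℝ) (hk : k ≤ n) (hneg : ∀ j, 1 ≤ j → j ≤ k → f j < 0)
    (hpos : ∀ j, k < j → j ≤ n → 0 < f j) : 0 < (-1) ^ k * ∏ j ∈ Finset.Icc 1 n, f j := by
  induction n generalizing k with
  | zero => obtain rfl : k = 0 := by omega
            simp
  | succ n ih =>
    rw [Finset.prod_Icc_succ_top (by omega), ← mul_assoc]
    rcases hk.eq_or_lt with rfl | hk
    · have h1 := ih le_rfl (fun j h1 h2 => hneg j h1 (by omega)) (fun j h1 h2 => by omega)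
      have h2 := hneg (n + 1) (by omega) le_rfl
      rw [pow_succ]
      nlinarith
    · exact mul_pos (ih (by omega) hneg fun j h1 h2 => hpos j h1 (by omega))
        (hpos _ hk le_rfl)

theorem coeffA_coeff_mul_prod {n : ℕ} {x m lam : ℕ → ℝ}
    (hlam : ∀ i j, 1 ≤ i → i < j → j ≤ n → lam i < lam j)
    (hroot : ∀ k, 1 ≤ k → k ≤ n → (coeffA n x m).eval (lam k) = 0) :
    (coeffA n x m).coeff n * ∏ j ∈ Finset.Icc 1 n, (0 - lam j) = 1 := by
  have h := congrArg (eval 0) (coeffA_eq_nodal hlam hroot)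
  rw [← coeff_zero_eq_eval_zero, coeffA, transferMatrix_coeff_zero, eval_mul, eval_C,
    Lagrange.eval_nodal] at h
  exact h.symm

/-- Since `A(0) = 1`, `A` is the product of the factors `1 - z/λⱼ`, and exactly `k` of them are
negative at `z`. -/
theorem sign_coeffA {n : ℕ} {x m lam : ℕ → ℝ}
    (hlam : ∀ i j, 1 ≤ i → i < j → j ≤ n → lam i < lam j)
    (hpos : ∀ k, 1 ≤ k → k ≤ n → 0 < lam k)
    (hroot : ∀ k, 1 ≤ k → k ≤ n → (coeffA n x m).eval (lam k) = 0) {k : ℕ} (hk : k ≤ n) {z : ℝ}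
    (h1 : ∀ j, 1 ≤ j → j ≤ k → lam j < z) (h2 : ∀ j, k < j → j ≤ n → z < lam j) :
    0 < (-1) ^ k * (coeffA n x m).eval z := by
  have e : (coeffA n x m).eval z = ∏ j ∈ Finset.Icc 1 n, (lam j - z) / lam j := by
    rw [coeffA_eq_nodal hlam hroot, eval_mul, eval_C, Lagrange.eval_nodal,
      ← one_mul (∏ j ∈ _, (lam j - z) / lam j), ← coeffA_coeff_mul_prod hlam hroot, mul_assoc,
      ← Finset.prod_mul_distrib]
    congr 1
    refine Finset.prod_congr rfl fun j hj => ?_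
    have := hpos j (Finset.mem_Icc.1 hj).1 (Finset.mem_Icc.1 hj).2
    field_simp
    ring
  rw [e]
  refine sign_prod _ hk (fun j hj hjk => ?_) fun j hj hjn => ?_
  · exact div_neg_of_neg_of_pos (sub_neg.2 (h1 j hj hjk)) (hpos j hj (hjk.trans hk))
  · exact div_pos (sub_pos.2 (h2 j hj hjn)) (hpos j (by omega) hjn)

/-- The same product as for `A`, with the vanishing factor replaced by its derivative `-1/λₖ`, which
supplies the `k`-th negative sign. -/
theorem sign_derivative_coeffA {n : ℕ} {x m lam : ℕ → ℝ}
    (hlam : ∀ i j, 1 ≤ i → i < j → j ≤ n → lam i < lam j)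
    (hpos : ∀ k, 1 ≤ k → k ≤ n → 0 < lam k)
    (hroot : ∀ k, 1 ≤ k → k ≤ n → (coeffA n x m).eval (lam k) = 0) {k : ℕ} (hk1 : 1 ≤ k)
    (hk : k ≤ n) : 0 < (-1) ^ k * (derivative (coeffA n x m)).eval (lam k) := by
  have hmem : k ∈ Finset.Icc 1 n := Finset.mem_Icc.2 ⟨hk1, hk⟩
  set f : ℕ → ℝ := fun j => if j = k then -(lam k)⁻¹ else (lam j - lam k) / lam j
  have e : (derivative (coeffA n x m)).eval (lam k) = ∏ j ∈ Finset.Icc 1 n, f j := by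
    have hk0 := hpos k hk1 hk
    rw [coeffA_eq_nodal hlam hroot, derivative_C_mul, eval_C_mul,
      Lagrange.eval_nodal_derivative_eval_node_eq hmem, Lagrange.eval_nodal,
      ← one_mul (∏ j ∈ _, f j), ← coeffA_coeff_mul_prod hlam hroot, mul_assoc,
      ← Finset.prod_mul_distrib, ← Finset.mul_prod_erase (Finset.Icc 1 n) _ hmem]
    congr 1
    have hone : (0 - lam k) * f k = 1 := by
      simp only [f, if_true]
      field_simp
      ring
    rw [hone, one_mul]
    refine Finset.prod_congr rfl fun j hj => ?_
    rw [Finset.mem_erase, Finset.mem_Icc] at hj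
    have := hpos j hj.2.1 hj.2.2
    simp only [f, if_neg hj.1]
    field_simp
    ring
  rw [e]
  refine sign_prod _ hk (fun j hj hjk => ?_) fun j hj hjn => ?_
  · have := hpos j hj (hjk.trans hk)
    have hk0 := hpos k hk1 hk
    by_cases hjk' : j = k
    · simp only [f, if_pos hjk']
      simpa using hk0
    · simp only [f, if_neg hjk']
      exact div_neg_of_neg_of_pos (sub_neg.2 (hlam j k hj (by omega) hk)) this
  · have := hpos j (by omega) hjn
    simp only [f, if_neg hj.ne']
    exact div_pos (sub_pos.2 (hlam k j hk1 hj hjn)) this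

/-- Beyond the last zero `c` of `d` in the interval (or beyond `a` if `d` stays positive) `d` is
positive, while `f(c) > 0 > f(b)`; the intermediate value theorem is applied on `[c, b]`. Thus the
root of `f` comes with a sign of `d`. -/
theorem exists_root_right_of_roots {f d : ℝ → ℝ} (hf : Continuous f) (hd : Continuous d) {a b : ℝ}
    (hab : a < b) (hfa : 0 < f a) (hfb : f b < 0) (hdb : 0 < d b)
    (h : ∀ z, a < z → z < b → d z = 0 → 0 < f z) : ∃ z, a < z ∧ z < b ∧ f z = 0 ∧ 0 < d z := by
  -- Adjoining `a` keeps the set nonempty when `d` has no zero in the interval.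
  set S : Set ℝ := Set.Icc a b ∩ ({a} ∪ {z | d z ≤ 0})
  have hS : IsCompact S := isCompact_Icc.inter_right
    (isClosed_singleton.union (isClosed_le hd continuous_const))
  obtain ⟨c, ⟨hc, hc'⟩, hmax⟩ := hS.exists_isGreatest ⟨a, ⟨le_rfl, hab.le⟩, Or.inl rfl⟩
  have hright : ∀ z, c < z → z ≤ b → 0 < d z := fun z hz hzb => by
    by_contra hcon
    exact absurd (hmax ⟨⟨hc.1.trans hz.le, hzb⟩, Or.inr (not_lt.1 hcon)⟩) (not_le.2 hz)
  have hcb : c < b := by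
    refine lt_of_le_of_ne hc.2 ?_
    rintro rfl
    rcases hc' with h1 | h1
    · exact hab.ne' h1
    · exact absurd hdb (not_lt.2 h1)
  have hfc : 0 < f c := by
    by_cases hca : c = a
    · rwa [hca]
    · have hac : a < c := lt_of_le_of_ne hc.1 (Ne.symm hca)
      refine h c hac hcb (le_antisymm (hc'.resolve_left hca) ?_)
      refine ge_of_tendsto (hd.continuousWithinAt (s := Set.Ioi c)) ?_
      filter_upwards [Ioo_mem_nhdsGT hcb] with z hz using (hright z hz.1 hz.2.le).le
  obtain ⟨z, hz, hz0⟩ := intermediate_value_Icc' hcb.le hf.continuousOn ⟨hfb.le, hfc.le⟩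
  have hzc : c < z := lt_of_le_of_ne hz.1 (by rintro rfl; exact hfc.ne' hz0)
  have hzb : z < b := lt_of_le_of_ne hz.2 (by rintro rfl; exact hfb.ne hz0)
  exact ⟨z, hc.1.trans_lt hzc, hzb, hz0, hright z hzc hzb.le⟩

theorem eventually_eval_pos {p : ℝ[X]} {N : ℕ} (hdeg : p.natDegree ≤ N) (hlead : 0 < p.coeff N) :
    ∀ᶠ z in Filter.atTop, 0 < p.eval z := by
  have hN : p.natDegree = N := le_antisymm hdeg (le_natDegree_of_ne_zero hlead.ne')
  rcases Nat.eq_zero_or_pos N with rfl | hN'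
  · rw [eq_C_of_natDegree_eq_zero hN]
    exact Filter.Eventually.of_forall fun _ => by simpa using hlead
  · have h := p.tendsto_atTop_of_leadingCoeff_nonneg (natDegree_pos_iff_degree_pos.1 (by omega))
      (by rw [leadingCoeff, hN]; exact hlead.le)
    exact h.eventually_gt_atTop 0

/-- Symmetrising the double sum in `k, j` replaces `2λₖ/(z-λₖ)` by `λₖ/(z-λₖ) + λⱼ/(z-λⱼ)`, whose
numerator is `z(λₖ+λⱼ) - 2λₖλⱼ`. This makes the positivity of the Cauchy kernel usable for `C`. -/
theorem sum_eq_sq_sub_cauchyForm {n : ℕ} {lam : ℕ → ℝ} (hpos : ∀ k, 1 ≤ k → k ≤ n → 0 < lam k)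
    (b : ℕ → ℝ) {z : ℝ} (hz : ∀ k, 1 ≤ k → k ≤ n → z ≠ lam k) :
    ∑ k ∈ Finset.Icc 1 n, (2 * lam k * b k * ∑ j ∈ Finset.Icc 1 n, b j / (lam k + lam j)) /
      (z - lam k) = z * (∑ k ∈ Finset.Icc 1 n, b k / (z - lam k)) ^ 2 -
        2 * cauchyForm (Finset.Icc 1 n) lam fun k => lam k * b k / (z - lam k) := by
  set s := Finset.Icc 1 n
  set F : ℕ → ℕ → ℝ := fun k j => lam k * b k * b j / ((lam k + lam j) * (z - lam k))
  have h1 : ∑ k ∈ s, (2 * lam k * b k * ∑ j ∈ s, b j / (lam k + lam j)) / (z - lam k) =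
      ∑ k ∈ s, ∑ j ∈ s, F k j + ∑ k ∈ s, ∑ j ∈ s, F k j := by
    rw [← two_mul, Finset.mul_sum]
    refine Finset.sum_congr rfl fun k hk => ?_
    rw [Finset.mul_sum, Finset.sum_div, Finset.mul_sum]
    refine Finset.sum_congr rfl fun j hj => ?_
    simp only [F]
    rw [mul_div_assoc', div_div]
    ring
  rw [h1]
  nth_rewrite 2 [Finset.sum_comm]
  rw [cauchyForm, sq, Finset.sum_mul_sum, Finset.mul_sum, Finset.mul_sum, ← Finset.sum_add_distrib,
    ← Finset.sum_sub_distrib]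
  refine Finset.sum_congr rfl fun k hk => ?_
  rw [Finset.mul_sum, Finset.mul_sum, ← Finset.sum_add_distrib, ← Finset.sum_sub_distrib]
  refine Finset.sum_congr rfl fun j hj => ?_
  simp only [s, Finset.mem_Icc] at hk hj
  have := hpos k hk.1 hk.2
  have := hpos j hj.1 hj.2
  have hk0 := sub_ne_zero.2 (hz k hk.1 hk.2)
  have hj0 := sub_ne_zero.2 (hz j hj.1 hj.2)
  have h2 : lam k + lam j ≠ 0 := by positivity
  have h3 : lam j + lam k ≠ 0 := by positivity
  simp only [F]
  field_simp
  ring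

theorem coeffA_succ_eval (n : ℕ) (x m : ℕ → ℝ) (z : ℝ) :
    (coeffA (n + 1) x m).eval z = (coeffA n x m).eval z - z * (m (n + 1) * Real.exp (-x (n + 1)) *
      (Real.exp (x (n + 1)) * (coeffA n x m).eval z + (coeffB n x m).eval z +
        Real.exp (-x (n + 1)) * (coeffC n x m).eval z)) := by
  rw [coeffA, transferMatrix_succ_apply]
  simp [coeffA, coeffB, coeffC, jumpCol]

/-- The row `(2eˣ, 1, 0)` annihilates the column of the jump at `x`. -/
theorem coeffB_succ_eval (n : ℕ) (x m : ℕ → ℝ) (z : ℝ) :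
    (coeffB (n + 1) x m).eval z + 2 * Real.exp (x (n + 1)) * (coeffA (n + 1) x m).eval z =
      (coeffB n x m).eval z + 2 * Real.exp (x (n + 1)) * (coeffA n x m).eval z := by
  rw [coeffA_succ_eval, coeffB, transferMatrix_succ_apply]
  have : Real.exp (x (n + 1)) * Real.exp (-x (n + 1)) = 1 := by rw [← Real.exp_add]; simp
  simp [coeffA, coeffB, coeffC, jumpCol]
  linear_combination (-2 * z * m (n + 1) * (Real.exp (x (n + 1)) *
    (transferMatrix n x m n 0 0).eval z + (transferMatrix n x m n 1 0).eval z +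
    Real.exp (-x (n + 1)) * (transferMatrix n x m n 2 0).eval z)) * this

/-- The value of `A` after adding a peakon, at a zero of `B + 2 eˣ A`. -/
theorem IsSpectrum.coeffA_succ_eval_of_eq_zero {n : ℕ} {x m lam b : ℕ → ℝ}
    (h : IsSpectrum n x m lam b) (hp : PurePeakon n x m) {z : ℝ}
    (hz : ∀ k, 1 ≤ k → k ≤ n → z ≠ lam k)
    (hd : (coeffB n x m).eval z + 2 * Real.exp (x (n + 1)) * (coeffA n x m).eval z = 0) :
    (coeffA (n + 1) x m).eval z = (coeffA n x m).eval z *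
      (1 + 2 * z ^ 2 * m (n + 1) * Real.exp (-x (n + 1)) ^ 2 *
        cauchyForm (Finset.Icc 1 n) lam fun k => lam k * b k / (z - lam k)) := by
  have hA : (coeffA n x m).eval z ≠ 0 := fun h0 => by
    obtain ⟨j, h1, h2, h3⟩ := exists_eq_of_eval_coeffA_eq_zero hp h.strictMono h.eval_coeffA h0
    exact hz j h1 h2 h3
  have hB := h.aeval_coeffB hp (K := ℝ) z hz
  have hC := h.aeval_coeffC hp (K := ℝ) z hz
  simp only [Algebra.algebraMap_self, RingHom.id_apply, coe_aeval_eq_eval] at hB hC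
  rw [sum_eq_sq_sub_cauchyForm h.pos b hz] at hC
  set W := ∑ k ∈ Finset.Icc 1 n, b k / (z - lam k)
  set Q := cauchyForm (Finset.Icc 1 n) lam fun k => lam k * b k / (z - lam k)
  have hw : z * W = Real.exp (x (n + 1)) := by
    rw [hB] at hd
    have : (coeffA n x m).eval z * (2 * (Real.exp (x (n + 1)) - z * W)) = 0 := by
      linear_combination hd
    have := (mul_eq_zero.1 this).resolve_left hA
    linarith
  have hexp : Real.exp (x (n + 1)) * Real.exp (-x (n + 1)) = 1 := by rw [← Real.exp_add]; simp
  rw [coeffA_succ_eval, hC, hB, ← hw]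
  rw [← hw] at hexp
  set E := Real.exp (-x (n + 1))
  linear_combination (-z * m (n + 1) * (coeffA n x m).eval z * (z * W * E)) * hexp

theorem natDegree_add_C_mul_le {n : ℕ} (x m : ℕ → ℝ) (c : ℝ) :
    (coeffB n x m + C c * coeffA n x m).natDegree ≤ n :=
  natDegree_add_le_of_degree_le (natDegree_transferMatrix_le n x m n 1 0)
    ((natDegree_C_mul_le _ _).trans (natDegree_transferMatrix_le n x m n 0 0))

theorem sign_coeff_add {n : ℕ} {x m : ℕ → ℝ} (hp : PurePeakon (n + 1) x m) :
    0 < (-1) ^ n * (coeffB n x m + C (2 * Real.exp (x (n + 1))) * coeffA n x m).coeff n := by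
  rcases Nat.eq_zero_or_pos n with rfl | hn
  · simpa [coeffA, coeffB, transferMatrix] using Real.exp_pos _
  · obtain ⟨g, hg, hc⟩ := exists_coeff_transferMatrix n x m (hp.of_le n.le_succ) n hn le_rfl
    have h0 : (coeffA n x m).coeff n = g * Real.exp (-x n) := hc 0
    have h1 : (coeffB n x m).coeff n = g * -2 := hc 1
    have hx : 0 < Real.exp (x (n + 1) - x n) - 1 :=
      sub_pos.2 (Real.one_lt_exp_iff.2 (sub_pos.2 (hp.1 n (n + 1) hn (by omega) le_rfl)))
    rw [coeff_add, coeff_C_mul, h0, h1]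
    rw [sub_eq_add_neg (x (n + 1)), Real.exp_add] at hx
    nlinarith [mul_pos hg hx]

/-- Positive simple zeros and positive residues persist when a peakon is added on the right. -/
theorem exists_isSpectrum_succ {n : ℕ} {x m lam b : ℕ → ℝ} (hp : PurePeakon (n + 1) x m)
    (h : IsSpectrum n x m lam b) (hb : ∀ k, 1 ≤ k → k ≤ n → 0 < b k) :
    ∃ lam' b', IsSpectrum (n + 1) x m lam' b' ∧ ∀ k, 1 ≤ k → k ≤ n + 1 → 0 < b' k := by
  have hp' := hp.of_le n.le_succ
  have hm := hp.2 (n + 1) (by omega) le_rfl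
  set y := x (n + 1)
  have hey := Real.exp_pos y
  have hey' := Real.exp_pos (-y)
  have hexp : Real.exp y * Real.exp (-y) = 1 := by rw [← Real.exp_add]; simp
  -- At a zero of the new `A` the new `B` equals `D`, so the sign of `D` there decides the sign of
  -- the new residue.
  set D : ℝ[X] := coeffB n x m + C (2 * Real.exp y) * coeffA n x m
  have hD : ∀ z, D.eval z = (coeffB n x m).eval z + 2 * Real.exp y * (coeffA n x m).eval z :=
    fun z => by simp [D]
  have hBD : ∀ z, (coeffA (n + 1) x m).eval z = 0 → (coeffB (n + 1) x m).eval z = D.eval z :=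
    fun z hz => by rw [hD, ← coeffB_succ_eval, hz]; ring
  -- a point to the right of all zeros
  obtain ⟨R, hR1, hR2, hR3⟩ : ∃ R, (∀ k, 1 ≤ k → k ≤ n → lam k < R) ∧
      0 < (-1) ^ n * D.eval R ∧ 0 < (-1) ^ (n + 1) * (coeffA (n + 1) x m).eval R ∧ 0 < R := by
    obtain ⟨g, hg, hc⟩ := exists_coeff_transferMatrix (n + 1) x m hp (n + 1) (by omega) le_rfl
    have hc0 : (coeffA (n + 1) x m).coeff (n + 1) = g * Real.exp (-y) := hc 0
    have e1 := eventually_eval_pos (p := C ((-1) ^ n) * D) (N := n)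
      ((natDegree_C_mul_le _ _).trans (natDegree_add_C_mul_le x m _))
      (by rw [coeff_C_mul]; exact sign_coeff_add hp)
    have e2 := eventually_eval_pos (p := C ((-1) ^ (n + 1)) * coeffA (n + 1) x m) (N := n + 1)
      ((natDegree_C_mul_le _ _).trans (natDegree_transferMatrix_le (n + 1) x m (n + 1) 0 0))
      (by rw [coeff_C_mul, hc0, ← mul_assoc]; positivity)
    have e3 : ∀ᶠ z in Filter.atTop, ∀ k ∈ Finset.Icc 1 n, lam k < z :=
      (Finset.eventually_all _).2 fun k _ => Filter.eventually_gt_atTop _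
    obtain ⟨R, h1, h2, h3, h4⟩ :=
      (e1.and (e2.and (e3.and (Filter.eventually_gt_atTop 0)))).exists
    exact ⟨R, fun k hk hkn => h3 k (Finset.mem_Icc.2 ⟨hk, hkn⟩), by simpa using h1,
      by simpa using h2, h4⟩
  -- Separating points `0 < λ₁ < ⋯ < λₙ < R`: each of the `n + 1` gaps will contain one new zero.
  set L : ℕ → ℝ := fun k => if k = 0 then 0 else if k ≤ n then lam k else R
  have hL0 : L 0 = 0 := rfl
  have hLk : ∀ k, 1 ≤ k → k ≤ n → L k = lam k := fun k h1 h2 => by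
    simp only [L, if_neg (by omega : ¬k = 0), if_pos h2]
  have hLR : L (n + 1) = R := by simp [L]
  have hLmono : ∀ i j, i < j → j ≤ n + 1 → L i < L j := fun i j hij hj => by
    rcases Nat.eq_zero_or_pos i with rfl | hi
    · rcases hj.eq_or_lt with rfl | hj
      · rw [hL0, hLR]; exact hR3.2
      · rw [hL0, hLk j (by omega) (by omega)]
        exact h.pos j (by omega) (by omega)
    · rcases hj.eq_or_lt with rfl | hj
      · rw [hLk i hi (by omega), hLR]; exact hR1 i hi (by omega)
      · rw [hLk i hi (by omega), hLk j (by omega) (by omega)]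
        exact h.strictMono i j hi hij (by omega)
  have hLmono' : ∀ i j, i ≤ j → j ≤ n + 1 → L i ≤ L j := fun i j hij hj => by
    rcases hij.eq_or_lt with rfl | hij
    · exact le_rfl
    · exact (hLmono i j hij hj).le
  have hBlam : ∀ k, 1 ≤ k → k ≤ n → 0 < (-1) ^ (k + 1) * (coeffB n x m).eval (lam k) :=
    fun k h1 h2 => by
      have hs := sign_derivative_coeffA h.strictMono h.pos h.eval_coeffA h1 h2
      have h3 := mul_pos (mul_pos (h.pos k h1 h2) (hb k h1 h2)) hs
      rw [h.eval_coeffB k h1 h2, pow_succ]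
      linarith
  have hDL : ∀ k, k ≤ n → 0 < (-1) ^ k * D.eval (L (k + 1)) := fun k hk => by
    rcases hk.eq_or_lt with rfl | hk
    · rw [hLR]; exact hR2
    · have h1 := hBlam (k + 1) (by omega) (by omega)
      rw [hLk _ (by omega) (by omega), hD, h.eval_coeffA (k + 1) (by omega) (by omega), mul_zero,
        add_zero]
      rw [pow_succ, pow_succ] at h1
      linarith
  have hAL : ∀ k, k ≤ n + 1 → 0 < (-1) ^ k * (coeffA (n + 1) x m).eval (L k) := fun k hk => by
    rcases Nat.eq_zero_or_pos k with rfl | hk0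
    · rw [hL0, ← coeff_zero_eq_eval_zero, coeffA, transferMatrix_coeff_zero]
      simp
    rcases hk.eq_or_lt with rfl | hk
    · rw [hLR]; exact hR3.1
    have hkn : k ≤ n := by omega
    rw [hLk k hk0 hkn, coeffA_succ_eval, h.eval_coeffA k hk0 hkn, h.eval_coeffC hp' k hk0 hkn,
      h.eval_coeffB k hk0 hkn]
    have hs := sign_derivative_coeffA h.strictMono h.pos h.eval_coeffA hk0 hkn
    have hlk := h.pos k hk0 hkn
    have hbk := hb k hk0 hkn
    -- The left side is at most the total residue `e^{xₙ}`, so the ordering of the last two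
    -- positions makes `1 - e^{-y} λₖ T` positive; the new `A` therefore has the sign of the old
    -- derivative at `λₖ`.
    have hsum : lam k * ∑ j ∈ Finset.Icc 1 n, b j / (lam k + lam j) < Real.exp y := by
      refine lt_of_le_of_lt (b := ∑ j ∈ Finset.Icc 1 n, b j) ?_ ?_
      · rw [Finset.mul_sum]
        refine Finset.sum_le_sum fun j hj => ?_
        rw [Finset.mem_Icc] at hj
        have h1 := h.pos j hj.1 hj.2
        have h2 := hb j hj.1 hj.2
        rw [mul_div_assoc', div_le_iff₀ (by positivity)]
        nlinarith [mul_pos h1 h2]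
      · rw [h.sum_eq hp' (by omega)]
        exact Real.exp_lt_exp.2 (hp.1 n (n + 1) (by omega) (by omega) le_rfl)
    set T := ∑ j ∈ Finset.Icc 1 n, b j / (lam k + lam j)
    have h1 : 0 < 1 - Real.exp (-y) * (lam k * T) := by
      have := mul_lt_mul_of_pos_left hsum hey'
      linarith
    have h2 := mul_pos (mul_pos (mul_pos (mul_pos hm hey') (mul_pos hlk hlk)) (mul_pos hbk hs)) h1
    rw [show x (n + 1) = y from rfl]
    linarith
  have key : ∀ k, ∃ z, k ≤ n → L k < z ∧ z < L (k + 1) ∧ (coeffA (n + 1) x m).eval z = 0 ∧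
      0 < (-1) ^ k * D.eval z := fun k => by
    by_cases hk : k ≤ n
    swap
    · exact ⟨0, fun h => absurd h hk⟩
    have hlt := hLmono k (k + 1) k.lt_succ_self (by omega)
    have h0 := hAL k (by omega)
    have h1 := hAL (k + 1) (by omega)
    obtain ⟨z, hz1, hz2, hz3, hz4⟩ := exists_root_right_of_roots
      (f := fun z => (-1) ^ k * (coeffA (n + 1) x m).eval z) (d := fun z => (-1) ^ k * D.eval z)
      (by fun_prop) (by fun_prop) hlt h0 (by rw [pow_succ] at h1; linarith) (hDL k hk)
      fun z hz1 hz2 hz => by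
        have hz0 : 0 < z := (hL0 ▸ hLmono' 0 k k.zero_le (by omega)).trans_lt hz1
        have hle : ∀ j, 1 ≤ j → j ≤ k → lam j < z := fun j hj hjk => by
          rw [← hLk j hj (by omega)]
          exact (hLmono' j k hjk (by omega)).trans_lt hz1
        have hge : ∀ j, k < j → j ≤ n → z < lam j := fun j hj hjn => by
          rw [← hLk j (by omega) hjn]
          exact hz2.trans_le (hLmono' (k + 1) j hj (by omega))
        have hs := sign_coeffA h.strictMono h.pos h.eval_coeffA hk hle hge
        have hne : ∀ j, 1 ≤ j → j ≤ n → z ≠ lam j := fun j hj hjn => by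
          rcases le_or_gt j k with hjk | hjk
          · exact (hle j hj hjk).ne'
          · exact (hge j hjk hjn).ne
        have hDz : D.eval z = 0 := by simpa using hz
        rw [hD] at hDz
        have hQ := cauchyForm_nonneg (Finset.Icc 1 n) lam (fun k => lam k * b k / (z - lam k))
          fun i hi => h.pos i (Finset.mem_Icc.1 hi).1 (Finset.mem_Icc.1 hi).2
        -- At a zero of `D` the new `A` is the old one times a factor at least `1`, so it keeps the
        -- sign of the old `A` on this gap.
        rw [h.coeffA_succ_eval_of_eq_zero hp' hne hDz, ← mul_assoc]
        positivity
    exact ⟨z, fun _ => ⟨hz1, hz2, by simpa using hz3, hz4⟩⟩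
  -- Gaps are numbered from `0`, zeros from `1`; hence the shift `k - 1` below.
  choose ν hν using key
  have hmono : ∀ i j, 1 ≤ i → i < j → j ≤ n + 1 → ν (i - 1) < ν (j - 1) := fun i j hi hij hj => by
    have h1 := (hν (i - 1) (by omega)).2.1
    have h2 := (hν (j - 1) (by omega)).1
    exact h1.trans (lt_of_le_of_lt (hLmono' (i - 1 + 1) (j - 1) (by omega) (by omega)) h2)
  have hpos : ∀ k, 1 ≤ k → k ≤ n + 1 → 0 < ν (k - 1) := fun k hk hkn =>
    (hL0 ▸ hLmono' 0 (k - 1) (Nat.zero_le _) (by omega)).trans_lt (hν (k - 1) (by omega)).1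
  have hroot : ∀ k, 1 ≤ k → k ≤ n + 1 → (coeffA (n + 1) x m).eval (ν (k - 1)) = 0 :=
    fun k hk hkn => (hν (k - 1) (by omega)).2.2.1
  refine ⟨fun k => ν (k - 1), fun k => (coeffB (n + 1) x m).eval (ν (k - 1)) /
    (-2 * ν (k - 1) * (derivative (coeffA (n + 1) x m)).eval (ν (k - 1))),
    ⟨hmono, hpos, hroot, fun k hk hkn => ?_⟩, fun k hk hkn => ?_⟩
  · have h1 := derivative_coeffA_ne_zero hp (lam := fun k => ν (k - 1)) hmono hroot k hk hkn
    have h2 := hpos k hk hkn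
    field_simp
  · have h1 := sign_derivative_coeffA (lam := fun k => ν (k - 1)) hmono hpos hroot hk hkn
    have h2 := hpos k hk hkn
    have h3 := (hν (k - 1) (by omega)).2.2.2
    beta_reduce
    rw [hBD _ (hroot k hk hkn)]
    obtain ⟨k, rfl⟩ : ∃ k', k = k' + 1 := ⟨k - 1, by omega⟩
    simp only [Nat.add_sub_cancel] at *
    rw [pow_succ] at h1
    rw [← mul_div_mul_left _ _ (pow_ne_zero k (by norm_num : (-1 : ℝ) ≠ 0))]
    refine div_pos h3 ?_
    have := mul_pos h2 h1
    linarith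

theorem exists_isSpectrum (n : ℕ) (x m : ℕ → ℝ) (hp : PurePeakon n x m) :
    ∃ lam b, IsSpectrum n x m lam b ∧ ∀ k, 1 ≤ k → k ≤ n → 0 < b k := by
  induction n with
  | zero => exact ⟨0, 0, ⟨fun i j _ _ _ => by omega, fun k _ _ => by omega, fun k _ _ => by omega,
      fun k _ _ => by omega⟩, fun k _ _ => by omega⟩
  | succ n ih =>
    obtain ⟨lam, b, h, hb⟩ := ih (hp.of_le n.le_succ)
    exact exists_isSpectrum_succ hp h hb

/-! ### Sums of simple poles at infinity -/

theorem eventually_ne_cobounded_finset (s : Finset ℕ) (v : ℕ → ℂ) :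
    ∀ᶠ z in cobounded ℂ, ∀ k ∈ s, z ≠ v k :=
  (Finset.eventually_all _).2 fun k _ => eventually_ne_cobounded (v k)

theorem tendsto_one_div_sub_cobounded (v : ℂ) :
    Filter.Tendsto (fun z : ℂ => 1 / (z - v)) (cobounded ℂ) (nhds 0) := by
  simp only [one_div]
  refine Filter.tendsto_inv₀_cobounded.comp (tendsto_norm_atTop_iff_cobounded.1 ?_)
  refine Filter.tendsto_atTop_mono (fun z => norm_sub_norm_le z v) ?_
  exact Filter.tendsto_atTop_add_const_right _ _ tendsto_norm_cobounded_atTop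

/-- From `z/(z-v) = 1 + v/(z-v)`: each factor `z` moves one power of the pole into the residue, at
the cost of a moment that vanishes. -/
theorem pow_mul_sum_poles (s : Finset ℕ) (v c : ℕ → ℂ) (N : ℕ)
    (h : ∀ i < N, ∑ k ∈ s, c k * v k ^ i = 0) {z : ℂ} (hz : ∀ k ∈ s, z ≠ v k) :
    z ^ N * ∑ k ∈ s, c k / (z - v k) = ∑ k ∈ s, c k * v k ^ N * (1 / (z - v k)) := by
  induction N with
  | zero => simp [div_eq_mul_inv]
  | succ N ih =>
    rw [pow_succ', mul_assoc, ih fun i hi => h i (by omega), ← sub_eq_zero,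
      ← h N (Nat.lt_succ_self N), Finset.mul_sum, ← Finset.sum_sub_distrib]
    refine Finset.sum_congr rfl fun k hk => ?_
    have := sub_ne_zero.2 (hz k hk)
    field_simp
    ring

/-- If the first `N` moments of the residues vanish, the moment of order `N` is the leading
coefficient of the expansion at infinity. -/
theorem tendsto_pow_mul_sum_poles (s : Finset ℕ) (v c : ℕ → ℂ) (N : ℕ)
    (h : ∀ i < N, ∑ k ∈ s, c k * v k ^ i = 0) :
    Filter.Tendsto (fun z => z ^ (N + 1) * ∑ k ∈ s, c k / (z - v k)) (cobounded ℂ)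
      (nhds (∑ k ∈ s, c k * v k ^ N)) := by
  have h1 : Filter.Tendsto (fun z => ∑ k ∈ s, (c k * v k ^ N + c k * v k ^ N * v k *
      (1 / (z - v k)))) (cobounded ℂ) (nhds (∑ k ∈ s, (c k * v k ^ N + c k * v k ^ N * v k * 0))) :=
    tendsto_finsetSum _ fun k _ => tendsto_const_nhds.add
      ((tendsto_one_div_sub_cobounded (v k)).const_mul _)
  simp only [mul_zero, add_zero] at h1
  refine h1.congr' ?_
  filter_upwards [eventually_ne_cobounded_finset s v] with z hz
  rw [pow_succ', mul_assoc, pow_mul_sum_poles s v c N h hz, Finset.mul_sum]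
  refine Finset.sum_congr rfl fun k hk => ?_
  have := sub_ne_zero.2 (hz k hk)
  field_simp
  ring

theorem tendsto_one_div_pow_cobounded {N : ℕ} (hN : N ≠ 0) :
    Filter.Tendsto (fun z : ℂ => 1 / z ^ N) (cobounded ℂ) (nhds 0) := by
  simp only [one_div, ← inv_pow]
  simpa [hN] using (Filter.tendsto_inv₀_cobounded (α := ℂ)).pow N

/-- Once the lower moments vanish, the next one is the limit of `z^(i+1)` times the sum, and that
product is `O(z^(i-N))`. -/
theorem sum_poles_moments_eq_zero (s : Finset ℕ) (v c : ℕ → ℂ) (N : ℕ)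
    (h : (fun z => ∑ k ∈ s, c k / (z - v k)) =O[cobounded ℂ] fun z : ℂ => 1 / z ^ (N + 1)) :
    ∀ i < N, ∑ k ∈ s, c k * v k ^ i = 0 := by
  intro i
  induction i using Nat.strong_induction_on with
  | _ i ih =>
    intro hi
    have h1 := tendsto_pow_mul_sum_poles s v c i fun j hj => ih j hj (hj.trans hi)
    have h2 : (fun z => z ^ (i + 1) * ∑ k ∈ s, c k / (z - v k)) =O[cobounded ℂ]
        fun z : ℂ => 1 / z ^ (N - i) := by
      refine ((isBigO_refl (fun z : ℂ => z ^ (i + 1)) _).mul h).congr' Filter.EventuallyEq.rfl ?_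
      filter_upwards [eventually_ne_cobounded (0 : ℂ)] with z hz
      have : N + 1 = (i + 1) + (N - i) := by omega
      rw [this, pow_add]
      field_simp
      ring
    exact tendsto_nhds_unique h1 (h2.trans_tendsto (tendsto_one_div_pow_cobounded (by omega)))

/-- Vandermonde nondegeneracy, obtained by testing against the Lagrange basis polynomial of each
node. -/
theorem eq_zero_of_moments_eq_zero {K : Type*} [Field K] (s : Finset ℕ) (v c : ℕ → K)
    (hv : Set.InjOn v s)
    (h : ∀ i < s.card, ∑ k ∈ s, c k * v k ^ i = 0) : ∀ k ∈ s, c k = 0 := by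
  intro k hk
  have h1 : ∀ P : K[X], P.natDegree < s.card → ∑ j ∈ s, c j * P.eval (v j) = 0 := fun P hP => by
    simp only [eval_eq_sum_range, Finset.mul_sum]
    rw [Finset.sum_comm]
    refine Finset.sum_eq_zero fun i hi => ?_
    rw [← mul_zero (P.coeff i), ← h i (by rw [Finset.mem_range] at hi; omega), Finset.mul_sum]
    exact Finset.sum_congr rfl fun j _ => by ring
  have h2 := h1 (Lagrange.basis s v k) (by
    rw [Lagrange.natDegree_basis hv hk]
    have := Finset.card_pos.2 ⟨k, hk⟩
    omega)
  rwa [Finset.sum_eq_single_of_mem k hk fun j hj hjk => by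
    rw [Lagrange.eval_basis_of_ne hjk.symm hj, mul_zero], Lagrange.eval_basis_self hv hk,
    mul_one] at h2

/-! ### Equivalence of the Weyl-function and residue descriptions of the spectral data -/

theorem aeval_coeffA_ne_zero {n : ℕ} {x m lam : ℕ → ℝ} (hp : PurePeakon n x m)
    (hlam : ∀ i j, 1 ≤ i → i < j → j ≤ n → lam i < lam j)
    (hroot : ∀ k, 1 ≤ k → k ≤ n → (coeffA n x m).eval (lam k) = 0) (z : ℂ)
    (hz : ∀ k, 1 ≤ k → k ≤ n → z ≠ lam k) : aeval z (coeffA n x m) ≠ 0 := by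
  rw [coeffA_eq_nodal hlam hroot, map_mul, aeval_C, Lagrange.nodal_eq, map_prod]
  refine mul_ne_zero ((_root_.map_ne_zero _).2 (coeffA_coeff_ne_zero hp))
    (Finset.prod_ne_zero_iff.2 fun k hk => ?_)
  rw [Finset.mem_Icc] at hk
  rw [map_sub, aeval_X, aeval_C]
  exact sub_ne_zero.2 (hz k hk.1 hk.2)

theorem IsSpectrum.isSpectralData {n : ℕ} {x m lam b : ℕ → ℝ} (h : IsSpectrum n x m lam b)
    (hp : PurePeakon n x m) : IsSpectralData n x m lam b := by
  refine ⟨h.strictMono, h.eval_coeffA, fun z hz0 hz => ?_⟩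
  have hA := aeval_coeffA_ne_zero hp h.strictMono h.eval_coeffA z hz
  have hB := h.aeval_coeffB hp z hz
  simp only [Complex.coe_algebraMap] at hB
  rw [hB, div_eq_iff (by simp [hA, hz0])]
  ring

/-- The residues computed from `B` and `A'` give the same Weyl function as `b`. The difference is a
sum of simple poles vanishing near infinity, so all its residues are zero. -/
theorem isSpectrum_of_isSpectralData {n : ℕ} {x m lam b : ℕ → ℝ} (h : IsSpectralData n x m lam b)
    (hp : PurePeakon n x m) (hpos : ∀ k, 1 ≤ k → k ≤ n → 0 < lam k) : IsSpectrum n x m lam b := by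
  set b₀ : ℕ → ℝ := fun k => (coeffB n x m).eval (lam k) /
    (-2 * lam k * (derivative (coeffA n x m)).eval (lam k))
  have h₀ : IsSpectrum n x m lam b₀ := ⟨h.strictMono, hpos, h.isRoot, fun k hk hkn => by
    have h1 := derivative_coeffA_ne_zero hp h.strictMono h.isRoot k hk hkn
    have h2 := hpos k hk hkn
    simp only [b₀]
    field_simp⟩
  have hinj := injOn_of_strictMono h.strictMono
  have hzero : (fun z : ℂ => ∑ k ∈ Finset.Icc 1 n, ((b k : ℂ) - b₀ k) / (z - (lam k : ℂ)))
      =O[cobounded ℂ] fun z : ℂ => 1 / z ^ ((Finset.Icc 1 n).card + 1) := by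
    refine (isBigO_zero _ _).congr' ?_ Filter.EventuallyEq.rfl
    filter_upwards [eventually_ne_cobounded_finset (Finset.Icc 1 n) (fun k => (lam k : ℂ)),
      eventually_ne_cobounded (0 : ℂ)] with z hz hz0
    have hz' : ∀ k, 1 ≤ k → k ≤ n → z ≠ (lam k : ℂ) :=
      fun k h1 h2 => hz k (Finset.mem_Icc.2 ⟨h1, h2⟩)
    simp only [sub_div, Finset.sum_sub_distrib]
    rw [← h.weyl z hz0 hz', ← (h₀.isSpectralData hp).weyl z hz0 hz', sub_self]
  have hc := eq_zero_of_moments_eq_zero (Finset.Icc 1 n) (fun k => (lam k : ℂ))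
    (fun k => (b k : ℂ) - b₀ k)
    (fun i hi j hj hij => hinj hi hj (Complex.ofReal_injective hij))
    (sum_poles_moments_eq_zero _ _ _ _ hzero)
  refine ⟨h.strictMono, hpos, h.isRoot, fun k hk hkn => ?_⟩
  have hb : b k = b₀ k := by
    exact_mod_cast sub_eq_zero.1 (hc k (Finset.mem_Icc.2 ⟨hk, hkn⟩))
  rw [hb]
  exact h₀.eval_coeffB k hk hkn

/-- `A` has degree `n` and `n` positive zeros by the existence result, so any zero of it is among
those. -/
theorem IsSpectralData.isSpectrum {n : ℕ} {x m lam b : ℕ → ℝ} (h : IsSpectralData n x m lam b)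
    (hp : PurePeakon n x m) : IsSpectrum n x m lam b := by
  obtain ⟨lam₀, b₀, h₀, -⟩ := exists_isSpectrum n x m hp
  refine isSpectrum_of_isSpectralData h hp fun k hk hkn => ?_
  obtain ⟨j, h1, h2, h3⟩ :=
    exists_eq_of_eval_coeffA_eq_zero hp h₀.strictMono h₀.eval_coeffA (h.isRoot k hk hkn)
  rw [h3]
  exact h₀.pos j h1 h2

theorem IsSpectrum.residue_pos {n : ℕ} {x m lam b : ℕ → ℝ} (h : IsSpectrum n x m lam b)
    (hp : PurePeakon n x m) (k : ℕ) (hk : 1 ≤ k) (hkn : k ≤ n) : 0 < b k := by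
  obtain ⟨lam₀, b₀, h₀, hb₀⟩ := exists_isSpectrum n x m hp
  obtain ⟨j, h1, h2, h3⟩ :=
    exists_eq_of_eval_coeffA_eq_zero hp h₀.strictMono h₀.eval_coeffA (h.eval_coeffA k hk hkn)
  have e := h.eval_coeffB k hk hkn
  have hA := derivative_coeffA_ne_zero hp h.strictMono h.eval_coeffA k hk hkn
  have e₀ := h₀.eval_coeffB j h1 h2
  rw [← h3, e] at e₀
  have := mul_left_cancel₀ (h.pos k hk hkn).ne' (mul_right_cancel₀ hA e₀)
  have := hb₀ j h1 h2
  linarith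

/-! ### Integrals with respect to the spectral measure -/

theorem integral_spectralMeasure {E : Type*} [NormedAddCommGroup E] [NormedSpace ℝ E]
    [CompleteSpace E] {n : ℕ} {lam b : ℕ → ℝ} (hb : ∀ k, 1 ≤ k → k ≤ n → 0 < b k) (f : ℝ → E) :
    ∫ x, f x ∂(spectralMeasure n lam b) = ∑ k ∈ Finset.Icc 1 n, b k • f (lam k) := by
  rw [spectralMeasure, integral_finsetSum_measure]
  · refine Finset.sum_congr rfl fun k hk => ?_
    rw [Finset.mem_Icc] at hk
    rw [integral_smul_measure, integral_dirac, ENNReal.toReal_ofReal (hb k hk.1 hk.2).le]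
  · intro k _
    exact (integrable_dirac enorm_lt_top).smul_measure ENNReal.ofReal_ne_top

theorem integral_xMeasure {E : Type*} [NormedAddCommGroup E] [NormedSpace ℝ E]
    [CompleteSpace E] {n : ℕ} {lam b : ℕ → ℝ} (hb : ∀ k, 1 ≤ k → k ≤ n → 0 < b k)
    (hpos : ∀ k, 1 ≤ k → k ≤ n → 0 < lam k) (f : ℝ → E) :
    ∫ x, f x ∂(xMeasure (spectralMeasure n lam b)) =
      ∑ k ∈ Finset.Icc 1 n, b k • lam k • f (lam k) := by
  rw [xMeasure, integral_withDensity_eq_integral_toReal_smul ENNReal.measurable_ofReal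
    (by simp), integral_spectralMeasure hb]
  refine Finset.sum_congr rfl fun k hk => ?_
  rw [Finset.mem_Icc] at hk
  rw [ENNReal.toReal_ofReal (hpos k hk.1 hk.2).le]

/-! ### Transforms of the spectral measure as finite sums -/

theorem weylW_spectralMeasure {n : ℕ} {lam b : ℕ → ℝ} (hb : ∀ k, 1 ≤ k → k ≤ n → 0 < b k) (z : ℂ) :
    weylW (spectralMeasure n lam b) z = ∑ k ∈ Finset.Icc 1 n, (b k : ℂ) / (z - (lam k : ℂ)) := by
  rw [weylW, integral_spectralMeasure hb]
  exact Finset.sum_congr rfl fun k _ => by rw [Complex.real_smul, mul_one_div]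

/-- The residues of the second Weyl function `Z`. -/
def residueZ (n : ℕ) (lam b : ℕ → ℝ) (k : ℕ) : ℝ :=
  lam k * b k * ∑ j ∈ Finset.Icc 1 n, b j / (lam k + lam j)

theorem weylZ_spectralMeasure {n : ℕ} {lam b : ℕ → ℝ} (hb : ∀ k, 1 ≤ k → k ≤ n → 0 < b k) (z : ℂ) :
    weylZ (spectralMeasure n lam b) z =
      ∑ k ∈ Finset.Icc 1 n, (residueZ n lam b k : ℂ) / (z - (lam k : ℂ)) := by
  rw [weylZ, integral_spectralMeasure hb]
  simp only [integral_spectralMeasure hb, Complex.real_smul, Finset.mul_sum]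
  rw [Finset.sum_comm]
  refine Finset.sum_congr rfl fun k _ => ?_
  rw [residueZ, Complex.ofReal_mul, Complex.ofReal_sum, Finset.mul_sum, Finset.sum_div]
  refine Finset.sum_congr rfl fun j _ => ?_
  rw [div_mul_eq_div_div_swap]
  push_cast
  ring

theorem moment_spectralMeasure {n : ℕ} {lam b : ℕ → ℝ} (hb : ∀ k, 1 ≤ k → k ≤ n → 0 < b k) (j : ℕ) :
    moment (spectralMeasure n lam b) j = ∑ k ∈ Finset.Icc 1 n, b k * lam k ^ j := by
  rw [moment, integral_spectralMeasure hb]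
  rfl

theorem bimoment_spectralMeasure {n : ℕ} {lam b : ℕ → ℝ} (hb : ∀ k, 1 ≤ k → k ≤ n → 0 < b k)
    (i j : ℕ) : bimoment (spectralMeasure n lam b) i j = ∑ l ∈ Finset.Icc 1 n,
      ∑ k ∈ Finset.Icc 1 n, b l * b k * (lam k ^ (i + 1) * lam l ^ j / (lam k + lam l)) := by
  rw [bimoment, integral_spectralMeasure hb]
  simp only [integral_spectralMeasure hb, smul_eq_mul, Finset.mul_sum, mul_assoc]

/-! ### Consequences of the approximation conditions -/

theorem eq_zero_of_tendsto_zero {P : ℂ[X]}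
    (h : Filter.Tendsto (fun z => P.eval z) (cobounded ℂ) (nhds 0)) : P = 0 := by
  by_contra hP
  have h1 : (fun z => eval z (1 : ℂ[X])) =O[cobounded ℂ] fun z => P.eval z :=
    isBigO_cobounded_of_degree_le (by rw [degree_one]; exact zero_le_degree_iff.2 hP)
  have h2 := h1.trans_tendsto h
  simp only [eval_one] at h2
  exact one_ne_zero (tendsto_nhds_unique tendsto_const_nhds h2)

theorem isBigO_pow_of_degree_le {P : ℂ[X]} {k : ℕ} (h : P.degree ≤ k) :
    (fun z => P.eval z) =O[cobounded ℂ] fun z : ℂ => z ^ k := by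
  simpa using isBigO_cobounded_of_degree_le (P := P) (Q := (X : ℂ[X]) ^ k) (by rwa [degree_X_pow])

/-- The numerator of a rational approximation at infinity of a sum of simple poles is the polynomial
part of the product with the denominator. -/
theorem eval_eq_sum_of_isBigO (s : Finset ℕ) (v c : ℕ → ℂ) (p q : ℂ[X]) (k : ℕ)
    (hq : q.degree = k) (h : (fun z => ∑ i ∈ s, c i / (z - v i) - p.eval z / q.eval z)
      =O[cobounded ℂ] fun z : ℂ => 1 / z ^ (k + 1)) (z : ℂ) (hz : ∀ i ∈ s, z ≠ v i) :
    p.eval z = ∑ i ∈ s, c i * ((q.eval z - q.eval (v i)) / (z - v i)) := by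
  set R : ℂ[X] := ∑ i ∈ s, C (c i) * ((q - C (q.eval (v i))) /ₘ (X - C (v i)))
  have hR : ∀ z, (∀ i ∈ s, z ≠ v i) →
      R.eval z = ∑ i ∈ s, c i * ((q.eval z - q.eval (v i)) / (z - v i)) := fun z hz => by
    simp only [R, eval_finsetSum, eval_mul, eval_C]
    refine Finset.sum_congr rfl fun i hi => ?_
    have h1 := congrArg (eval z)
      ((mul_divByMonic_eq_iff_isRoot (p := q - C (q.eval (v i))) (a := v i)).2 (by simp))
    simp only [eval_mul, eval_sub, eval_X, eval_C] at h1
    rw [← h1, mul_div_cancel_left₀ _ (sub_ne_zero.2 (hz i hi))]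
  -- `R - p` equals `q` times the approximation error minus the polar remainder `∑ cᵢ q(vᵢ)/(z-vᵢ)`;
  -- both tend to zero, and only the zero polynomial does so.
  have hzero : R - p = 0 := by
    refine eq_zero_of_tendsto_zero ?_
    have h1 : Filter.Tendsto (fun z => q.eval z * (∑ i ∈ s, c i / (z - v i) - p.eval z / q.eval z))
        (cobounded ℂ) (nhds 0) := by
      have h2 : (fun z => q.eval z * (∑ i ∈ s, c i / (z - v i) - p.eval z / q.eval z))
          =O[cobounded ℂ] fun z : ℂ => 1 / z ^ 1 := by
        refine ((isBigO_pow_of_degree_le hq.le).mul h).congr' Filter.EventuallyEq.rfl ?_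
        filter_upwards [eventually_ne_cobounded (0 : ℂ)] with z hz
        field_simp
        ring
      exact h2.trans_tendsto (tendsto_one_div_pow_cobounded one_ne_zero)
    have h3 : Filter.Tendsto (fun z => ∑ i ∈ s, c i * q.eval (v i) * (1 / (z - v i)))
        (cobounded ℂ) (nhds (∑ i ∈ s, c i * q.eval (v i) * 0)) :=
      tendsto_finsetSum _ fun i _ => (tendsto_one_div_sub_cobounded (v i)).const_mul _
    have h4 := h1.sub h3
    simp only [mul_zero, Finset.sum_const_zero, sub_zero] at h4
    refine h4.congr' ?_
    have hq0 : ∀ᶠ z in cobounded ℂ, q.eval z ≠ 0 := by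
      have hqne : q ≠ 0 := fun h0 => by simp [h0] at hq
      have := eventually_cofinite_not_isRoot hqne
      exact le_cofinite ℂ this
    filter_upwards [eventually_ne_cobounded_finset s v, hq0] with z hz hqz
    rw [eval_sub, hR z hz, mul_sub, mul_div_cancel₀ _ hqz, sub_right_comm]
    congr 1
    rw [Finset.mul_sum, ← Finset.sum_sub_distrib]
    refine Finset.sum_congr rfl fun i _ => ?_
    ring
  rw [← sub_eq_zero.1 hzero, hR z hz]

/-- The residues of the third remainder. -/
def residueThird (n : ℕ) (lam b : ℕ → ℝ) (q : ℂ[X]) (k : ℕ) : ℂ :=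
  -(lam k * b k * ∑ j ∈ Finset.Icc 1 n, b j * q.eval (lam j : ℂ) / (lam k + lam j))

/-- The coefficient of `q(z)` is `Z(-z) - z W(-z) W(z) - Z(z)`, which vanishes identically. In the
remaining terms the poles at `λⱼ` cancel, leaving only those at `-λₖ`. -/
theorem third_remainder_eq {n : ℕ} {lam b : ℕ → ℝ} (hpos : ∀ k, 1 ≤ k → k ≤ n → 0 < lam k)
    (hb : ∀ k, 1 ≤ k → k ≤ n → 0 < b k) (p phat q : ℂ[X]) (z : ℂ)
    (hz : ∀ k ∈ Finset.Icc 1 n, z ≠ lam k) (hz' : ∀ k ∈ Finset.Icc 1 n, z ≠ -lam k)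
    (hp : p.eval z = ∑ k ∈ Finset.Icc 1 n,
      (b k : ℂ) * ((q.eval z - q.eval (lam k : ℂ)) / (z - lam k)))
    (hphat : phat.eval z = ∑ k ∈ Finset.Icc 1 n,
      (residueZ n lam b k : ℂ) * ((q.eval z - q.eval (lam k : ℂ)) / (z - lam k))) :
    weylZ (spectralMeasure n lam b) (-z) * q.eval z -
      z * weylW (spectralMeasure n lam b) (-z) * p.eval z - phat.eval z =
      ∑ k ∈ Finset.Icc 1 n, residueThird n lam b q k / (z - -(lam k : ℂ)) := by
  rw [weylW_spectralMeasure hb, weylZ_spectralMeasure hb, hp, hphat]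
  set s := Finset.Icc 1 n
  have e1 : (∑ k ∈ s, (residueZ n lam b k : ℂ) / (-z - lam k)) * q.eval z =
      ∑ k ∈ s, ∑ j ∈ s, (lam k * b k * b j / (lam k + lam j) / (-z - lam k) * q.eval z : ℂ) := by
    rw [Finset.sum_mul]
    refine Finset.sum_congr rfl fun k _ => ?_
    simp only [residueZ]
    push_cast
    rw [Finset.mul_sum, Finset.sum_div, Finset.sum_mul]
    exact Finset.sum_congr rfl fun j _ => by ring
  have e2 : z * (∑ k ∈ s, (b k : ℂ) / (-z - lam k)) *
      (∑ k ∈ s, (b k : ℂ) * ((q.eval z - q.eval (lam k : ℂ)) / (z - lam k))) =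
      ∑ k ∈ s, ∑ j ∈ s, z * ((b k : ℂ) / (-z - lam k) *
        (b j * ((q.eval z - q.eval (lam j : ℂ)) / (z - lam j)))) := by
    rw [mul_assoc, Finset.sum_mul_sum, Finset.mul_sum]
    exact Finset.sum_congr rfl fun k _ => Finset.mul_sum _ _ _
  have e3 : ∑ k ∈ s, (residueZ n lam b k : ℂ) * ((q.eval z - q.eval (lam k : ℂ)) / (z - lam k)) =
      ∑ k ∈ s, ∑ j ∈ s, (lam j * b j * b k / (lam j + lam k) *
        ((q.eval z - q.eval (lam j : ℂ)) / (z - lam j)) : ℂ) := by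
    rw [Finset.sum_comm]
    refine Finset.sum_congr rfl fun k _ => ?_
    simp only [residueZ]
    push_cast
    rw [Finset.mul_sum, Finset.sum_mul]
    exact Finset.sum_congr rfl fun j _ => by ring
  rw [e1, e2, e3, ← Finset.sum_sub_distrib, ← Finset.sum_sub_distrib]
  refine Finset.sum_congr rfl fun k hk => ?_
  rw [← Finset.sum_sub_distrib, ← Finset.sum_sub_distrib, residueThird, Finset.mul_sum,
    ← Finset.sum_neg_distrib, Finset.sum_div]
  refine Finset.sum_congr rfl fun j hj => ?_
  have h1 : (lam k : ℂ) + lam j ≠ 0 := by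
    have h1 := hpos k (Finset.mem_Icc.1 hk).1 (Finset.mem_Icc.1 hk).2
    have h2 := hpos j (Finset.mem_Icc.1 hj).1 (Finset.mem_Icc.1 hj).2
    exact_mod_cast (add_pos h1 h2).ne'
  have h2 := sub_ne_zero.2 (hz j hj)
  have h3 : -z - (lam k : ℂ) ≠ 0 := fun h => hz' k hk (by linear_combination -h)
  have h4 : z - -(lam k : ℂ) ≠ 0 := fun h => hz' k hk (by linear_combination h)
  have h5 : (lam j : ℂ) + lam k ≠ 0 := by rwa [add_comm]
  rw [show -z - (lam k : ℂ) = -(z - -(lam k : ℂ)) by ring, add_comm (lam j : ℂ)]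
  rw [show z - -(lam k : ℂ) = z + lam k by ring] at h4 ⊢
  field_simp
  ring

/-! ### Approximants from the transfer matrix -/

theorem natDegree_matrix_mul_le {M N : Matrix (Fin 3) (Fin 3) ℝ[X]} {a b : ℕ}
    (hM : ∀ i j, (M i j).natDegree ≤ a) (hN : ∀ i j, (N i j).natDegree ≤ b) (i j : Fin 3) :
    ((M * N) i j).natDegree ≤ a + b := by
  rw [Matrix.mul_apply]
  exact natDegree_sum_le_of_forall_le _ _ fun l _ =>
    natDegree_mul_le.trans (add_le_add (hM i l) (hN l j))

theorem det_transferMatrix (n : ℕ) (x m : ℕ → ℝ) (k : ℕ) : (transferMatrix n x m k).det = 1 := by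
  induction k with
  | zero => simp [transferMatrix]
  | succ k ih =>
    rw [transferMatrix, Matrix.det_mul, ih, one_mul, Matrix.det_fin_three]
    set y := x (n - k)
    have h : (C (Real.exp y) : ℝ[X]) * C (Real.exp (-y)) = 1 := by
      rw [← C_mul, ← Real.exp_add]; simp
    have h3 : (C 2 : ℝ[X]) = 2 := rfl
    simp [jumpMatrix]
    grobner

/-- With determinant `1` the adjugate is the inverse, which by the invariance of `F` is `F⁻¹ S(-z)ᵀ
F`. Expanding `2 × 2` minors directly would only give the bound `2k`. -/
theorem natDegree_adjugate_transferMatrix_le (n : ℕ) (x m : ℕ → ℝ) (k : ℕ) (i j : Fin 3) :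
    ((transferMatrix n x m k).adjugate i j).natDegree ≤ k := by
  set T := transferMatrix n x m k
  set G : Matrix (Fin 3) (Fin 3) ℝ[X] := !![0, 0, 1; 0, C (-2), 0; 1, 0, 0]
  set N := (T.map fun p => p.comp (-X)).transpose
  have hGF : G * flipForm = 1 := by
    have : (C (-2) : ℝ[X]) * C (-1 / 2) = 1 := by rw [← C_mul]; norm_num
    ext1 i j
    fin_cases i <;> fin_cases j <;>
      simp [G, flipForm, Matrix.mul_apply, Fin.sum_univ_three, -map_neg, -map_div₀, this]
  have hinv : G * N * flipForm * T = 1 := by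
    rw [Matrix.mul_assoc G, Matrix.mul_assoc G, transferMatrix_symm, hGF]
  have hadj : T.adjugate = G * N * flipForm := by
    rw [← Matrix.mul_one T.adjugate, ← mul_eq_one_comm.1 hinv, ← Matrix.mul_assoc,
      Matrix.adjugate_mul, det_transferMatrix, one_smul, Matrix.one_mul]
  rw [hadj]
  have hG : ∀ i j, (G i j).natDegree ≤ 0 := fun i j => by
    fin_cases i <;> fin_cases j <;> simp [G]
  have hF : ∀ i j, (flipForm i j).natDegree ≤ 0 := fun i j => by
    fin_cases i <;> fin_cases j <;> simp [flipForm, -map_neg, -map_div₀]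
  have hN : ∀ i j, (N i j).natDegree ≤ k := fun i j => by
    simp only [N, Matrix.transpose_apply, Matrix.map_apply, natDegree_comp, natDegree_neg,
      natDegree_X, mul_one]
    exact natDegree_transferMatrix_le n x m k j i
  have h := natDegree_matrix_mul_le (natDegree_matrix_mul_le hG hN) hF i j
  simpa using h

theorem transferMatrix_eq_mul (n : ℕ) (x m : ℕ → ℝ) {k : ℕ} (hk : k ≤ n) (i : Fin 3) :
    transferMatrix n x m n i 0 = transferMatrix n x m k i 0 * coeffA (n - k) x m +
      transferMatrix n x m k i 1 * coeffB (n - k) x m +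
      transferMatrix n x m k i 2 * coeffC (n - k) x m := by
  have h := congrArg (fun M => M i 0) (transferMatrix_add n x m k (n - k))
  rw [Nat.add_sub_cancel' hk] at h
  simpa [Matrix.mul_apply, Fin.sum_univ_three, coeffA, coeffB, coeffC] using h

/-- Inserting `S_[n,n] = S_[n,k] S_[n-k,n-k]` cancels the contribution of `A` of the remaining
peakons. What is left is adjugate entries of degree at most `k` times `B` and `C` of the first `n -
k` peakons. -/
theorem natDegree_minor_one_le (n : ℕ) (x m : ℕ → ℝ) {k : ℕ} (hk : k ≤ n) :
    (coeffB n x m * transferMatrix n x m k 0 0 -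
      coeffA n x m * transferMatrix n x m k 1 0).natDegree ≤ n := by
  have h1 := natDegree_adjugate_transferMatrix_le n x m k 2 2
  have h2 := natDegree_adjugate_transferMatrix_le n x m k 1 2
  have hB := natDegree_transferMatrix_le (n - k) x m (n - k) 1 0
  have hC := natDegree_transferMatrix_le (n - k) x m (n - k) 2 0
  have e : coeffB n x m * transferMatrix n x m k 0 0 - coeffA n x m * transferMatrix n x m k 1 0 =
      (transferMatrix n x m k).adjugate 2 2 * coeffB (n - k) x m -
      (transferMatrix n x m k).adjugate 1 2 * coeffC (n - k) x m := by
    rw [coeffA, coeffB, transferMatrix_eq_mul n x m hk, transferMatrix_eq_mul n x m hk,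
      Matrix.adjugate_fin_three]
    simp
    ring
  rw [e]
  refine (natDegree_sub_le _ _).trans (max_le ?_ ?_)
  · exact natDegree_mul_le.trans ((add_le_add h1 hB).trans (by omega))
  · exact natDegree_mul_le.trans ((add_le_add h2 hC).trans (by omega))

theorem natDegree_minor_two_le (n : ℕ) (x m : ℕ → ℝ) {k : ℕ} (hk : k ≤ n) :
    (coeffC n x m * transferMatrix n x m k 0 0 -
      coeffA n x m * transferMatrix n x m k 2 0).natDegree ≤ n := by
  have h1 := natDegree_adjugate_transferMatrix_le n x m k 2 1
  have h2 := natDegree_adjugate_transferMatrix_le n x m k 1 1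
  have hB := natDegree_transferMatrix_le (n - k) x m (n - k) 1 0
  have hC := natDegree_transferMatrix_le (n - k) x m (n - k) 2 0
  have e : coeffC n x m * transferMatrix n x m k 0 0 - coeffA n x m * transferMatrix n x m k 2 0 =
      -(transferMatrix n x m k).adjugate 2 1 * coeffB (n - k) x m +
      (transferMatrix n x m k).adjugate 1 1 * coeffC (n - k) x m := by
    rw [coeffA, coeffC, transferMatrix_eq_mul n x m hk, transferMatrix_eq_mul n x m hk,
      Matrix.adjugate_fin_three]
    simp
    ring
  rw [e]
  refine (natDegree_add_le _ _).trans (max_le ?_ ?_)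
  · exact natDegree_mul_le.trans ((add_le_add ((natDegree_neg _).trans_le h1) hB).trans (by omega))
  · exact natDegree_mul_le.trans ((add_le_add h2 hC).trans (by omega))

/-- The first row of `S(-z)ᵀ F S(z) = F` applied to the column of the first `n - k` peakons. The low
degree of the right side is what makes the third approximation condition hold. -/
theorem coeffC_sub_eq (n : ℕ) (x m : ℕ → ℝ) {k : ℕ} (hk : k ≤ n) :
    (transferMatrix n x m k 0 0).comp (-X) * coeffC n x m -
      C (1 / 2) * (transferMatrix n x m k 1 0).comp (-X) * coeffB n x m +
      (transferMatrix n x m k 2 0).comp (-X) * coeffA n x m = coeffC (n - k) x m := by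
  have h := transferMatrix_symm n x m k
  have h0 := congrArg (fun M => M 0 0) h
  have h1 := congrArg (fun M => M 0 1) h
  have h2 := congrArg (fun M => M 0 2) h
  have hc : (C (-1 / 2) : ℝ[X]) = -C (1 / 2) := by rw [← C_neg]; norm_num
  simp only [flipForm, hc, Matrix.mul_apply, Fin.sum_univ_three, Matrix.transpose_apply,
    Matrix.map_apply] at h0 h1 h2
  simp [-map_div₀, -map_inv₀] at h0 h1 h2
  rw [coeffC, coeffB, coeffA, transferMatrix_eq_mul n x m hk, transferMatrix_eq_mul n x m hk,
    transferMatrix_eq_mul n x m hk, one_div]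
  linear_combination coeffA (n - k) x m * h0 + coeffB (n - k) x m * h1 +
    coeffC (n - k) x m * h2

theorem isBigO_div_of_natDegree_le {P Q : ℂ[X]} {N : ℕ} (hQ : Q ≠ 0)
    (h : P.natDegree + N ≤ Q.natDegree) :
    (fun z => P.eval z / Q.eval z) =O[cobounded ℂ] fun z : ℂ => 1 / z ^ N := by
  have h1 : (fun z => (P * X ^ N).eval z) =O[cobounded ℂ] fun z => Q.eval z :=
    isBigO_cobounded_of_degree_le (degree_le_of_natDegree_le (by
      exact natDegree_mul_le.trans (by simpa using h)) |>.trans (degree_eq_natDegree hQ).ge)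
  have hQ0 : ∀ᶠ z in cobounded ℂ, Q.eval z ≠ 0 :=
    le_cofinite ℂ (eventually_cofinite_not_isRoot hQ)
  refine (h1.mul (isBigO_refl (fun z => 1 / (z ^ N * Q.eval z)) _)).congr' ?_ ?_
  · filter_upwards [hQ0, eventually_ne_cobounded (0 : ℂ)] with z hz hz0
    simp only [eval_mul, eval_pow, eval_X]
    field_simp
  · filter_upwards [hQ0, eventually_ne_cobounded (0 : ℂ)] with z hz hz0
    field_simp

/-! ### The approximants read off from the first column of the transfer matrix -/

/-- The polynomial `2 s₁₁` built from the entries of `S_[n,k]`. -/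
def transferQ (n : ℕ) (x m : ℕ → ℝ) (k : ℕ) : ℝ[X] := C 2 * transferMatrix n x m k 0 0

/-- The polynomial `-s₂₁ / z` built from the entries of `S_[n,k]`. -/
def transferP (n : ℕ) (x m : ℕ → ℝ) (k : ℕ) : ℝ[X] := -(transferMatrix n x m k 1 0).divX

/-- The polynomial `s₃₁ / z` built from the entries of `S_[n,k]`. -/
def transferPhat (n : ℕ) (x m : ℕ → ℝ) (k : ℕ) : ℝ[X] := (transferMatrix n x m k 2 0).divX

theorem transferMatrix_one_zero (n : ℕ) (x m : ℕ → ℝ) (k : ℕ) :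
    transferMatrix n x m k 1 0 = -X * transferP n x m k := by
  have h := X_mul_divX_add (transferMatrix n x m k 1 0)
  rw [transferMatrix_coeff_zero, Matrix.one_apply_ne (by decide), C_0, add_zero] at h
  rw [transferP, neg_mul_neg, h]

theorem transferMatrix_two_zero (n : ℕ) (x m : ℕ → ℝ) (k : ℕ) :
    transferMatrix n x m k 2 0 = X * transferPhat n x m k := by
  have h := X_mul_divX_add (transferMatrix n x m k 2 0)
  rw [transferMatrix_coeff_zero, Matrix.one_apply_ne (by decide), C_0, add_zero] at h
  exact h.symm

theorem degree_transferMatrix_col {n : ℕ} {x m : ℕ → ℝ} (hp : PurePeakon n x m) {k : ℕ}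
    (hk : 1 ≤ k) (hkn : k ≤ n) (i : Fin 3) : (transferMatrix n x m k i 0).degree = k := by
  obtain ⟨g, hg, hc⟩ := exists_coeff_transferMatrix n x m hp k hk hkn
  have hg0 : g ≠ 0 := by rintro rfl; simp at hg
  refine degree_eq_of_le_of_coeff_ne_zero
    (degree_le_of_natDegree_le (natDegree_transferMatrix_le n x m k i 0)) ?_
  rw [hc]
  fin_cases i <;> simp [jumpCol, hg0]

theorem degree_transferQ {n : ℕ} {x m : ℕ → ℝ} (hp : PurePeakon n x m) {k : ℕ} (hkn : k ≤ n) :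
    (transferQ n x m k).degree = k := by
  rw [transferQ, degree_C_mul (by norm_num)]
  rcases Nat.eq_zero_or_pos k with rfl | hk
  · simp [transferMatrix]
  · exact degree_transferMatrix_col hp hk hkn 0

theorem degree_divX_of_degree_eq {p : ℝ[X]} {k : ℕ} (hk : 1 ≤ k) (hp : p.degree = k) :
    p.divX.degree = ((k - 1 : ℕ) : WithBot ℕ) := by
  have h1 : p.natDegree = k := natDegree_eq_of_degree_eq_some hp
  have h2 : p.divX ≠ 0 := fun h => by
    rw [divX_eq_zero_iff] at h
    rw [h, natDegree_C] at h1
    omega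
  rw [degree_eq_natDegree h2, natDegree_divX_eq_natDegree_tsub_one, h1]

theorem coeffA_ne_zero (n : ℕ) (x m : ℕ → ℝ) : coeffA n x m ≠ 0 := fun h => by
  have := transferMatrix_coeff_zero n x m n 0 0
  rw [← coeffA, h] at this
  simp at this

theorem natDegree_coeffA {n : ℕ} {x m : ℕ → ℝ} (hp : PurePeakon n x m) :
    (coeffA n x m).natDegree = n :=
  le_antisymm (natDegree_transferMatrix_le n x m n 0 0)
    (le_natDegree_of_ne_zero (coeffA_coeff_ne_zero hp))

/-- The remainder of the third approximation condition for the polynomials built from the transfer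
matrix. -/
theorem IsSpectrum.third_remainder_transfer {n : ℕ} {x m lam b : ℕ → ℝ}
    (h : IsSpectrum n x m lam b) (hp : PurePeakon n x m) {k : ℕ} (hkn : k ≤ n) {z : ℂ} (hz0 : z ≠ 0)
    (hz : ∀ k ∈ Finset.Icc 1 n, z ≠ -(lam k : ℂ)) :
    weylZ (spectralMeasure n lam b) (-z) * aeval z (transferQ n x m k) -
      z * weylW (spectralMeasure n lam b) (-z) * aeval z (transferP n x m k) -
      aeval z (transferPhat n x m k) =
    -aeval (-z) (coeffC (n - k) x m) / (z * aeval (-z) (coeffA n x m)) := by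
  have hb := fun k hk hkn => h.residue_pos hp k hk hkn
  have hz' : ∀ k, 1 ≤ k → k ≤ n → -z ≠ (lam k : ℂ) := fun k h1 h2 e =>
    hz k (Finset.mem_Icc.2 ⟨h1, h2⟩) (by rw [← e, neg_neg])
  have hA := aeval_coeffA_ne_zero hp h.strictMono h.eval_coeffA (-z) hz'
  have hB := h.aeval_coeffB hp (-z) hz'
  have hC := h.aeval_coeffC hp (-z) hz'
  have e := congrArg (aeval (-z)) (coeffC_sub_eq n x m hkn)
  simp only [map_add, map_sub, map_mul, aeval_comp, map_neg, aeval_X, neg_neg, aeval_C] at e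
  rw [weylW_spectralMeasure hb, weylZ_spectralMeasure hb]
  have e2 : ∑ k ∈ Finset.Icc 1 n, algebraMap ℝ ℂ (2 * lam k * b k *
      ∑ j ∈ Finset.Icc 1 n, b j / (lam k + lam j)) / (-z - algebraMap ℝ ℂ (lam k)) =
      2 * ∑ k ∈ Finset.Icc 1 n, (residueZ n lam b k : ℂ) / (-z - (lam k : ℂ)) := by
    rw [Finset.mul_sum]
    refine Finset.sum_congr rfl fun k _ => ?_
    rw [residueZ, Complex.coe_algebraMap]
    push_cast
    ring
  rw [e2] at hC
  simp only [Complex.coe_algebraMap] at hB e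
  set W := ∑ k ∈ Finset.Icc 1 n, (b k : ℂ) / (-z - (lam k : ℂ))
  set Z := ∑ k ∈ Finset.Icc 1 n, (residueZ n lam b k : ℂ) / (-z - (lam k : ℂ))
  rw [transferMatrix_one_zero, transferMatrix_two_zero, hB, hC] at e
  simp only [map_mul, map_neg, aeval_X] at e
  push_cast at e
  rw [← e, transferQ, map_mul, aeval_C, eq_div_iff (mul_ne_zero hz0 hA), Complex.coe_algebraMap]
  push_cast
  ring

/-- Each condition is a degree count: the first two remainders are minors of degree at most `n` over
`2 z A s₁₁`, of degree `n + k + 1`; the third is a polynomial of degree at most `n - k` over one of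
degree `n + 1`. -/
theorem IsSpectrum.isApproximant {n : ℕ} {x m lam b : ℕ → ℝ}
    (h : IsSpectrum n x m lam b) (hp : PurePeakon n x m) {k : ℕ} (hk : 1 ≤ k) (hkn : k ≤ n) :
    IsApproximant (spectralMeasure n lam b) k ((transferP n x m k).map (algebraMap ℝ ℂ))
      ((transferPhat n x m k).map (algebraMap ℝ ℂ)) ((transferQ n x m k).map (algebraMap ℝ ℂ)) := by
  have hb := fun k hk hkn => h.residue_pos hp k hk hkn
  have hcol := degree_transferMatrix_col hp hk hkn
  have hs1 : transferMatrix n x m k 0 0 ≠ 0 := fun h0 => by simpa [h0] using hcol 0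
  set Qd : ℝ[X] := C 2 * X * coeffA n x m * transferMatrix n x m k 0 0
  have hQd : Qd ≠ 0 := by simp [Qd, coeffA_ne_zero, hs1]
  have hQdeg : Qd.natDegree = n + (k + 1) := by
    have e1 : (transferMatrix n x m k 0 0).natDegree = k :=
      natDegree_eq_of_degree_eq_some (hcol 0)
    simp only [Qd]
    rw [natDegree_mul (by simp [coeffA_ne_zero]) hs1, natDegree_mul (by simp) (coeffA_ne_zero n x m),
      natDegree_C_mul_X _ (by norm_num), natDegree_coeffA hp, e1]
    ring
  have hO : ∀ N : ℝ[X], N.natDegree ≤ n → (fun z : ℂ => aeval z N / aeval z Qd) =O[cobounded ℂ]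
      fun z : ℂ => 1 / z ^ (k + 1) := fun N hN => by
    have := isBigO_div_of_natDegree_le (P := N.map (algebraMap ℝ ℂ)) (Q := Qd.map (algebraMap ℝ ℂ))
      (N := k + 1) ((Polynomial.map_ne_zero_iff (algebraMap ℝ ℂ).injective).2 hQd)
      (by rw [natDegree_map, natDegree_map, hQdeg]; omega)
    simpa only [eval_map_algebraMap] using this
  have hev : ∀ᶠ z in cobounded ℂ, z ≠ 0 ∧ (∀ k, 1 ≤ k → k ≤ n → z ≠ (lam k : ℂ)) ∧
      aeval z (transferMatrix n x m k 0 0) ≠ 0 := by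
    have h1 : ∀ᶠ z in cobounded ℂ,
        ((transferMatrix n x m k 0 0).map (algebraMap ℝ ℂ)).eval z ≠ 0 :=
      le_cofinite ℂ (eventually_cofinite_not_isRoot
        ((Polynomial.map_ne_zero_iff (algebraMap ℝ ℂ).injective).2 hs1))
    filter_upwards [eventually_ne_cobounded (0 : ℂ), h1,
      eventually_ne_cobounded_finset (Finset.Icc 1 n) (fun k => (lam k : ℂ))] with z h2 h3 h4
    exact ⟨h2, fun k h1 h2 => h4 k (Finset.mem_Icc.2 ⟨h1, h2⟩), by rwa [eval_map_algebraMap] at h3⟩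
  refine ⟨?_, ?_, ?_, ?_, ?_, ?_, ?_⟩
  · rw [degree_map, transferP, degree_neg, degree_divX_of_degree_eq hk (hcol 1)]
  · rw [degree_map, transferPhat, degree_divX_of_degree_eq hk (hcol 2)]
  · rw [degree_map, degree_transferQ hp hkn]
  · rw [← coeff_zero_eq_eval_zero, coeff_map, transferQ, coeff_C_mul, transferMatrix_coeff_zero]
    simp
  · refine (hO (-(coeffB n x m * transferMatrix n x m k 0 0 -
      coeffA n x m * transferMatrix n x m k 1 0))
      (by rw [natDegree_neg]; exact natDegree_minor_one_le n x m hkn)).congr' ?_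
      Filter.EventuallyEq.rfl
    filter_upwards [hev] with z ⟨hz0, hz, hsz⟩
    have hA := aeval_coeffA_ne_zero hp h.strictMono h.eval_coeffA z hz
    have hB := h.aeval_coeffB hp z hz
    rw [eval_map_algebraMap, eval_map_algebraMap, weylW_spectralMeasure hb,
      transferMatrix_one_zero, transferQ]
    simp only [Qd, map_sub, map_neg, map_mul, aeval_X, aeval_C, Complex.coe_algebraMap] at hB ⊢
    rw [hB]
    push_cast
    field_simp
    ring
  · refine (hO (coeffC n x m * transferMatrix n x m k 0 0 -
      coeffA n x m * transferMatrix n x m k 2 0) (natDegree_minor_two_le n x m hkn)).congr' ?_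
      Filter.EventuallyEq.rfl
    filter_upwards [hev] with z ⟨hz0, hz, hsz⟩
    have hA := aeval_coeffA_ne_zero hp h.strictMono h.eval_coeffA z hz
    have hC := h.aeval_coeffC hp z hz
    have e2 : ∑ k ∈ Finset.Icc 1 n, algebraMap ℝ ℂ (2 * lam k * b k *
        ∑ j ∈ Finset.Icc 1 n, b j / (lam k + lam j)) / (z - algebraMap ℝ ℂ (lam k)) =
        2 * ∑ k ∈ Finset.Icc 1 n, (residueZ n lam b k : ℂ) / (z - (lam k : ℂ)) := by
      rw [Finset.mul_sum]
      refine Finset.sum_congr rfl fun k _ => ?_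
      rw [residueZ, Complex.coe_algebraMap]
      push_cast
      ring
    rw [e2] at hC
    rw [eval_map_algebraMap, eval_map_algebraMap, weylZ_spectralMeasure hb,
      transferMatrix_two_zero, transferQ]
    simp only [Qd, map_sub, map_mul, aeval_X, aeval_C, Complex.coe_algebraMap, hC]
    push_cast
    field_simp
  · have hden : ((X * (coeffA n x m).comp (-X)).map (algebraMap ℝ ℂ)).natDegree = n + 1 := by
      rw [natDegree_map, natDegree_X_mul, natDegree_comp, natDegree_coeffA hp]
      · simp
      · rw [← leadingCoeff_ne_zero, leadingCoeff_comp (by simp)]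
        simp [coeffA_ne_zero]
    have hO3 := isBigO_div_of_natDegree_le
      (P := (-(coeffC (n - k) x m).comp (-X)).map (algebraMap ℝ ℂ))
      (Q := (X * (coeffA n x m).comp (-X)).map (algebraMap ℝ ℂ)) (N := k + 1)
      (fun h0 => by rw [h0] at hden; simp at hden) (by
        rw [hden, natDegree_map, natDegree_neg, natDegree_comp, natDegree_neg, natDegree_X, mul_one]
        have := natDegree_transferMatrix_le (n - k) x m (n - k) 2 0
        rw [coeffC]
        omega)
    refine hO3.congr' ?_ Filter.EventuallyEq.rfl
    filter_upwards [eventually_ne_cobounded (0 : ℂ),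
      eventually_ne_cobounded_finset (Finset.Icc 1 n) (fun k => -(lam k : ℂ))] with z hz0 hz
    simp only [eval_map_algebraMap]
    rw [h.third_remainder_transfer hp hkn hz0 hz]
    simp [aeval_comp]

/-! ### Bordered determinants -/

/-- Cramer's rule for a homogeneous system of `k` equations in `k + 1` unknowns. -/
theorem mul_det_vecCons {R : Type*} [CommRing R] {k : ℕ} (r : Fin (k + 1) → R)
    (M : Fin k → Fin (k + 1) → R) (q : Fin (k + 1) → R) (h : ∀ i, ∑ j, M i j * q j = 0) :
    q 0 * (Matrix.of (Matrix.vecCons r M)).det =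
      (∑ j, r j * q j) * (Matrix.of fun i j : Fin k => M i j.succ).det := by
  set N : Matrix (Fin (k + 1)) (Fin (k + 1)) R := Matrix.of (Matrix.vecCons r M)
  have h1 : N.mulVec q = Pi.single 0 (∑ j, r j * q j) := by
    ext i
    refine Fin.cases ?_ (fun i => ?_) i
    · simp [N, Matrix.mulVec, dotProduct]
    · simp [N, Matrix.mulVec, dotProduct, h i]
  have h2 : N.cramer (N.mulVec q) 0 = N.det * q 0 := by
    rw [Matrix.cramer_eq_adjugate_mulVec, Matrix.mulVec_mulVec, Matrix.adjugate_mul,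
      Matrix.smul_mulVec, Matrix.one_mulVec, Pi.smul_apply, smul_eq_mul]
  rw [mul_comm, ← h2, h1, Matrix.cramer_apply, Matrix.det_succ_column_zero,
    Finset.sum_eq_single_of_mem 0 (Finset.mem_univ _)]
  · rw [Matrix.updateCol_self]
    have hs : (N.updateCol 0 (Pi.single 0 (∑ j, r j * q j))).submatrix (Fin.succAbove 0) Fin.succ =
        Matrix.of fun i j : Fin k => M i j.succ := by
      ext i j
      simp [N]
    rw [hs]
    simp
  · intro i _ hi
    rw [Matrix.updateCol_self, Pi.single_eq_of_ne hi]
    simp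

/-- Cramer's rule with first row `1, z, …, zᵏ`: paired with the coefficient vector, this row returns
`q` itself. -/
theorem map_qPoly_eq {μ : Measure ℝ} {k : ℕ} (hdet : bimomentDet μ 0 1 k ≠ 0) {q : ℂ[X]}
    (hdeg : q.natDegree ≤ k) (hq0 : q.coeff 0 = 2)
    (h : ∀ i < k, ∑ j ∈ Finset.range (k + 1), (bimoment μ i j : ℂ) * q.coeff j = 0) :
    (qPoly μ k).map (algebraMap ℝ ℂ) = q := by
  have key := mul_det_vecCons (fun j : Fin (k + 1) => (X : ℂ[X]) ^ (j : ℕ))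
    (fun (i : Fin k) (j : Fin (k + 1)) => C (bimoment μ i j : ℂ)) (fun j => C (q.coeff j))
    fun i => by
      rw [Fin.sum_univ_eq_sum_range (fun j => (C (bimoment μ i j : ℂ) * C (q.coeff j) : ℂ[X])),
        ← C_0, ← h i i.2, map_sum]
      simp only [C_mul]
  have hX : ∑ j : Fin (k + 1), (X : ℂ[X]) ^ (j : ℕ) * C (q.coeff j) = q := by
    rw [Fin.sum_univ_eq_sum_range (fun j => ((X : ℂ[X]) ^ j * C (q.coeff j)))]
    conv_rhs => rw [q.as_sum_range_C_mul_X_pow' (Nat.lt_succ_of_le hdeg)]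
    exact Finset.sum_congr rfl fun _ _ => mul_comm _ _
  have hD : (Matrix.of fun i j : Fin k => (C (bimoment μ i (j.succ : Fin (k + 1)) : ℂ) : ℂ[X])).det =
      C ((bimomentDet μ 0 1 k : ℝ) : ℂ) := by
    have := RingHom.map_det ((C : ℂ →+* ℂ[X]).comp (algebraMap ℝ ℂ))
      (Matrix.of fun i j : Fin k => bimoment μ (0 + i) (1 + j))
    rw [RingHom.comp_apply, Complex.coe_algebraMap] at this
    rw [bimomentDet, this]
    congr 1
    ext1 i j
    simp [add_comm]
  have hdet' : ((bimomentDet μ 0 1 k : ℝ) : ℂ) ≠ 0 := by exact_mod_cast hdet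
  rw [hX, hD] at key
  simp only [Fin.val_zero, hq0] at key
  rw [qPoly, Polynomial.map_mul, map_C, ← coe_mapRingHom, RingHom.map_det]
  have hM : (mapRingHom (algebraMap ℝ ℂ)).mapMatrix (Matrix.of (Matrix.vecCons
      (fun j : Fin (k + 1) => (X : ℝ[X]) ^ (j : ℕ))
      (fun (i : Fin k) (j : Fin (k + 1)) => C (bimoment μ i j)))) =
      Matrix.of (Matrix.vecCons (fun j : Fin (k + 1) => (X : ℂ[X]) ^ (j : ℕ))
        (fun (i : Fin k) (j : Fin (k + 1)) => C (bimoment μ i j : ℂ))) := by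
    ext1 i j
    refine Fin.cases ?_ (fun i => ?_) i <;> simp
  rw [hM, Complex.coe_algebraMap, Complex.ofReal_div, div_eq_inv_mul, C_mul, mul_assoc,
    Complex.ofReal_ofNat, key, mul_comm q, ← mul_assoc, ← C_mul, inv_mul_cancel₀ hdet', C_1,
    one_mul]

/-- Cramer's rule with the unit row at index `1`: pairing gives the linear coefficient, and
expansion deletes column `1` with a minus sign. -/
theorem massFormula_eq {μ : Measure ℝ} {k : ℕ} (hk : 1 ≤ k) (hdet : bimomentDet μ 0 1 k ≠ 0)
    {q : ℕ → ℝ} (hq0 : q 0 = 2)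
    (h : ∀ i < k, ∑ j ∈ Finset.range (k + 1), bimoment μ i j * q j = 0) :
    massFormula μ k = -q 1 / 2 := by
  obtain ⟨k, rfl⟩ : ∃ k', k = k' + 1 := ⟨k - 1, by omega⟩
  have key := mul_det_vecCons (Pi.single 1 1) (fun (i : Fin (k + 1)) (j : Fin (k + 2)) =>
    bimoment μ i j) (fun j => q j) fun i => by
      rw [Fin.sum_univ_eq_sum_range (fun j => bimoment μ i j * q j)]
      exact h i i.2
  have hD : (Matrix.of fun i j : Fin (k + 1) => bimoment μ i (j.succ : Fin (k + 2))).det =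
      bimomentDet μ 0 1 (k + 1) := by
    rw [bimomentDet]
    congr 1
    ext1 i j
    simp [add_comm]
  have hs : ∑ j : Fin (k + 2), (Pi.single 1 1 : Fin (k + 2) → ℝ) j * q j = q 1 := by
    rw [Finset.sum_eq_single_of_mem 1 (Finset.mem_univ _) fun j _ hj => by
      rw [Pi.single_eq_of_ne hj, zero_mul], Pi.single_eq_same, one_mul]
    rfl
  rw [hs, hD, Matrix.det_succ_row_zero, Finset.sum_eq_single_of_mem 1 (Finset.mem_univ _)
    fun j _ hj => by simp [Pi.single_eq_of_ne hj]] at key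
  have hM : ((Matrix.of (Matrix.vecCons (Pi.single 1 1 : Fin (k + 2) → ℝ)
      fun (i : Fin (k + 1)) (j : Fin (k + 2)) => bimoment μ i j)).submatrix Fin.succ
      (Fin.succAbove 1)) = Matrix.of fun i j : Fin (k + 1) =>
        bimoment μ i (if (j : ℕ) = 0 then 0 else j + 1) := by
    ext i j
    refine Fin.cases ?_ (fun j => ?_) j
    · simp
    · simp [Fin.succAbove, Fin.lt_def]
  rw [hM] at key
  simp only [Fin.val_zero, hq0, Fin.val_one, pow_one, Matrix.of_apply, Matrix.cons_val_zero,
    Pi.single_eq_same] at key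
  rw [massFormula]
  field_simp
  linarith

theorem expMassFormula_eq {μ : Measure ℝ} {k : ℕ} (hdet : bimomentDet μ 0 1 k ≠ 0)
    {q : ℕ → ℝ} (hq0 : q 0 = 2)
    (h : ∀ i < k, ∑ j ∈ Finset.range (k + 1), bimoment μ i j * q j = 0) :
    expMassFormula μ k = -(∑ j ∈ Finset.range k, moment μ j * q (j + 1)) / 2 := by
  have key := mul_det_vecCons (fun j : Fin (k + 1) => if (j : ℕ) = 0 then 0 else moment μ (j - 1))
    (fun (i : Fin k) (j : Fin (k + 1)) => bimoment μ i j) (fun j => q j) fun i => by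
      rw [Fin.sum_univ_eq_sum_range (fun j => bimoment μ i j * q j)]
      exact h i i.2
  have hD : (Matrix.of fun i j : Fin k => bimoment μ i (j.succ : Fin (k + 1))).det =
      bimomentDet μ 0 1 k := by
    rw [bimomentDet]
    congr 1
    ext1 i j
    simp [add_comm]
  rw [hD, Fin.sum_univ_succ] at key
  simp only [Fin.val_zero, if_true, zero_mul, zero_add, hq0, Fin.val_succ, Nat.add_sub_cancel,
    Nat.succ_ne_zero, if_false] at key
  rw [Fin.sum_univ_eq_sum_range (fun j => moment μ j * q (j + 1))] at key
  rw [expMassFormula]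
  field_simp
  linarith

/-! ### The bimoments of the spectral measure -/

/-- The shift `01` makes the integrand `x^(i+1) y^(j+1) / (x+y)` symmetric, hence a Gram matrix of
the Cauchy kernel. A null vector is a polynomial of degree below `k ≤ n` vanishing at all `n` nodes.
-/
theorem bimomentDet_ne_zero {n : ℕ} {lam b : ℕ → ℝ}
    (hlam : ∀ i j, 1 ≤ i → i < j → j ≤ n → lam i < lam j)
    (hpos : ∀ k, 1 ≤ k → k ≤ n → 0 < lam k) (hb : ∀ k, 1 ≤ k → k ≤ n → 0 < b k)
    {k : ℕ} (hkn : k ≤ n) : bimomentDet (spectralMeasure n lam b) 0 1 k ≠ 0 := by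
  intro hdet
  obtain ⟨v, hv0, hv⟩ := Matrix.exists_mulVec_eq_zero_iff.2 hdet
  set s := Finset.Icc 1 n
  have hI : ∀ {p : ℕ → Prop}, (∀ k, 1 ≤ k → k ≤ n → p k) → ∀ k ∈ s, p k :=
    fun hp k hk => hp k (Finset.mem_Icc.1 hk).1 (Finset.mem_Icc.1 hk).2
  set P : ℝ[X] := ∑ i : Fin k, C (v i) * X ^ (i : ℕ)
  have hP : ∀ z, P.eval z = ∑ i : Fin k, v i * z ^ (i : ℕ) := fun z => by
    simp [P, eval_finsetSum]
  have hform : cauchyForm s lam (fun l => b l * (lam l * P.eval (lam l))) = 0 := by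
    have h1 : ∑ i : Fin k, v i * ((Matrix.of fun i j : Fin k =>
        bimoment (spectralMeasure n lam b) (0 + i) (1 + j)).mulVec v) i = 0 := by
      rw [hv]; simp
    rw [← h1, cauchyForm]
    simp only [Matrix.mulVec, dotProduct, Matrix.of_apply, bimoment_spectralMeasure hb, hP,
      Finset.mul_sum, Finset.sum_mul, Finset.sum_div]
    rw [Finset.sum_comm]
    simp only [Finset.sum_comm (s := s) (t := Finset.univ)]
    rw [Finset.sum_comm]
    refine Finset.sum_congr rfl fun i _ => Finset.sum_congr rfl fun j _ =>
      Finset.sum_congr rfl fun l _ => Finset.sum_congr rfl fun l' _ => ?_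
    ring
  have hzero := eq_zero_of_cauchyForm_eq_zero s lam _ (hI hpos) (injOn_of_strictMono hlam) hform
  have hP0 : P = 0 := by
    refine Polynomial.eq_zero_of_degree_lt_of_eval_index_eq_zero s
      (injOn_of_strictMono hlam) ?_ fun l hl => ?_
    · refine lt_of_lt_of_le (b := ((k : ℕ) : WithBot ℕ)) ?_ (by simpa [s] using hkn)
      rw [degree_lt_iff_coeff_zero]
      intro j hj
      simp only [P, finsetSum_coeff, coeff_C_mul_X_pow]
      exact Finset.sum_eq_zero fun i _ => if_neg (by omega)
    · have := hzero l hl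
      have h1 := hI hb l hl
      have h2 := hI hpos l hl
      simpa [h1.ne', h2.ne'] using this
  refine hv0 (funext fun i => ?_)
  have := congrArg (fun p => p.coeff (i : ℕ)) hP0
  simp only [P, finsetSum_coeff, coeff_C_mul_X_pow, coeff_zero] at this
  rw [Finset.sum_eq_single_of_mem i (Finset.mem_univ _) fun j _ hj =>
    if_neg fun e => hj (Fin.ext e.symm)] at this
  simpa using this

/-- Translates the decay of the third remainder into linear equations for the coefficients of `q`;
the sign comes from the poles sitting at `-λₖ`. -/
theorem sum_residueThird {n : ℕ} {lam b : ℕ → ℝ} (hb : ∀ k, 1 ≤ k → k ≤ n → 0 < b k) {q : ℂ[X]}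
    {N : ℕ} (hq : q.natDegree ≤ N) (i : ℕ) :
    ∑ k ∈ Finset.Icc 1 n, residueThird n lam b q k * (-(lam k : ℂ)) ^ i =
      -(-1) ^ i * ∑ j ∈ Finset.range (N + 1),
        (bimoment (spectralMeasure n lam b) i j : ℂ) * q.coeff j := by
  simp only [residueThird, bimoment_spectralMeasure hb, Complex.ofReal_sum, Finset.sum_mul,
    eval_eq_sum_range' (Nat.lt_succ_of_le hq), Finset.mul_sum, Finset.sum_div,
    ← Finset.sum_neg_distrib]
  simp only [Finset.sum_comm (t := Finset.range (N + 1))]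
  refine Finset.sum_congr rfl fun j _ => ?_
  rw [Finset.sum_comm]
  refine Finset.sum_congr rfl fun l _ => Finset.sum_congr rfl fun k _ => ?_
  push_cast
  rw [neg_pow]
  ring

/-! ### Uniqueness of the approximants -/

section Approximant

variable {n : ℕ} {x m lam b : ℕ → ℝ} {k : ℕ} {p phat q : ℂ[X]}

theorem IsSpectrum.eval_p (h : IsSpectrum n x m lam b) (hp : PurePeakon n x m)
    (ha : IsApproximant (spectralMeasure n lam b) k p phat q) (z : ℂ)
    (hz : ∀ i ∈ Finset.Icc 1 n, z ≠ lam i) : p.eval z = ∑ i ∈ Finset.Icc 1 n,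
      (b i : ℂ) * ((q.eval z - q.eval (lam i : ℂ)) / (z - lam i)) := by
  have h1 := ha.approx_W
  simp only [weylW_spectralMeasure fun k hk hkn => h.residue_pos hp k hk hkn] at h1
  exact eval_eq_sum_of_isBigO _ _ _ p q k ha.degree_q h1 z hz

theorem IsSpectrum.eval_phat (h : IsSpectrum n x m lam b) (hp : PurePeakon n x m)
    (ha : IsApproximant (spectralMeasure n lam b) k p phat q) (z : ℂ)
    (hz : ∀ i ∈ Finset.Icc 1 n, z ≠ lam i) : phat.eval z = ∑ i ∈ Finset.Icc 1 n,
      (residueZ n lam b i : ℂ) * ((q.eval z - q.eval (lam i : ℂ)) / (z - lam i)) := by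
  have h1 := ha.approx_Z
  simp only [weylZ_spectralMeasure fun k hk hkn => h.residue_pos hp k hk hkn] at h1
  exact eval_eq_sum_of_isBigO _ _ _ phat q k ha.degree_q h1 z hz

theorem IsSpectrum.sum_bimoment_mul_coeff (h : IsSpectrum n x m lam b) (hp : PurePeakon n x m)
    (ha : IsApproximant (spectralMeasure n lam b) k p phat q) (i : ℕ) (hi : i < k) :
    ∑ j ∈ Finset.range (k + 1), (bimoment (spectralMeasure n lam b) i j : ℂ) * q.coeff j = 0 := by
  have hb := fun k hk hkn => h.residue_pos hp k hk hkn
  have h1 : (fun z : ℂ => ∑ j ∈ Finset.Icc 1 n, residueThird n lam b q j / (z - -(lam j : ℂ)))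
      =O[cobounded ℂ] fun z : ℂ => 1 / z ^ (k + 1) := by
    refine ha.approx_WZ.congr' ?_ Filter.EventuallyEq.rfl
    filter_upwards [eventually_ne_cobounded_finset (Finset.Icc 1 n) (fun k => (lam k : ℂ)),
      eventually_ne_cobounded_finset (Finset.Icc 1 n) (fun k => -(lam k : ℂ))] with z hz hz'
    exact third_remainder_eq h.pos hb p phat q z hz hz' (h.eval_p hp ha z hz)
      (h.eval_phat hp ha z hz)
  have h2 := sum_poles_moments_eq_zero _ _ _ _ h1 i hi
  rw [sum_residueThird hb (natDegree_le_of_degree_le ha.degree_q.le)] at h2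
  exact (mul_eq_zero.1 h2).resolve_left (neg_ne_zero.2 (pow_ne_zero _ (by norm_num)))

theorem IsSpectrum.q_eq (h : IsSpectrum n x m lam b) (hp : PurePeakon n x m)
    (hkn : k ≤ n) (ha : IsApproximant (spectralMeasure n lam b) k p phat q) :
    q = (qPoly (spectralMeasure n lam b) k).map (algebraMap ℝ ℂ) :=
  (map_qPoly_eq (bimomentDet_ne_zero h.strictMono h.pos (fun k hk hkn => h.residue_pos hp k hk hkn)
    hkn) (natDegree_le_of_degree_le ha.degree_q.le)
    (by rw [coeff_zero_eq_eval_zero, ha.eval_zero])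
    (h.sum_bimoment_mul_coeff hp ha)).symm

theorem IsSpectrum.qPoly_eq (h : IsSpectrum n x m lam b) (hp : PurePeakon n x m) (hkn : k ≤ n) :
    qPoly (spectralMeasure n lam b) k = transferQ n x m k := by
  rcases Nat.eq_zero_or_pos k with rfl | hk
  · simp [qPoly, bimomentDet, transferQ, transferMatrix]
  · exact (map_injective _ (algebraMap ℝ ℂ).injective (h.q_eq hp hkn (h.isApproximant hp hk hkn))).symm

theorem IsSpectrum.p_eq (h : IsSpectrum n x m lam b) (hp : PurePeakon n x m) (hk : 1 ≤ k)
    (hkn : k ≤ n) (ha : IsApproximant (spectralMeasure n lam b) k p phat q) :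
    p = (transferP n x m k).map (algebraMap ℝ ℂ) := by
  have ha' := h.isApproximant hp hk hkn
  have hqq : q = (transferQ n x m k).map (algebraMap ℝ ℂ) := by
    rw [h.q_eq hp hkn ha, h.qPoly_eq hp hkn]
  refine eq_of_infinite_eval_eq _ _ (Set.Infinite.mono (s := {z | ∀ i ∈ Finset.Icc 1 n,
    z ≠ (lam i : ℂ)}) (fun z hz => ?_) ?_)
  · change p.eval z = _
    rw [h.eval_p hp ha z hz, h.eval_p hp ha' z hz, hqq]
  · refine Set.Infinite.mono (s := (((Finset.Icc 1 n).image fun i => (lam i : ℂ) : Finset ℂ) :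
      Set ℂ)ᶜ) (fun z hz i hi e => hz ?_) (Finset.finite_toSet _).infinite_compl
    rw [e]
    exact Finset.mem_coe.2 (Finset.mem_image_of_mem (fun i => (lam i : ℂ)) hi)

theorem IsSpectrum.sum_bimoment_mul_transferQ (h : IsSpectrum n x m lam b)
    (hp : PurePeakon n x m) (hkn : k ≤ n) (i : ℕ) (hi : i < k) :
    ∑ j ∈ Finset.range (k + 1), bimoment (spectralMeasure n lam b) i j *
      (transferQ n x m k).coeff j = 0 := by
  have := h.sum_bimoment_mul_coeff hp (h.isApproximant hp (by omega) hkn) i hi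
  simp only [coeff_map, Complex.coe_algebraMap] at this
  exact_mod_cast this

theorem transferQ_coeff_zero (n : ℕ) (x m : ℕ → ℝ) (k : ℕ) : (transferQ n x m k).coeff 0 = 2 := by
  rw [transferQ, coeff_C_mul, transferMatrix_coeff_zero]
  simp

theorem sum_mass_eq (n : ℕ) (x m : ℕ → ℝ) (hkn : k ≤ n) :
    ∑ i ∈ Finset.Icc (n - k + 1) n, m i = -(transferQ n x m k).coeff 1 / 2 := by
  rw [transferQ, coeff_C_mul, (coeff_one_transferMatrix n x m k hkn).1]
  ring

theorem sum_expMass_eq (n : ℕ) (x m : ℕ → ℝ) (hkn : k ≤ n) :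
    ∑ i ∈ Finset.Icc (n - k + 1) n, m i * Real.exp (x i) = -(transferP n x m k).coeff 0 / 2 := by
  rw [transferP, coeff_neg, coeff_divX, zero_add, (coeff_one_transferMatrix n x m k hkn).2]
  ring

theorem IsSpectrum.massFormula_eq (h : IsSpectrum n x m lam b) (hp : PurePeakon n x m)
    (hk : 1 ≤ k) (hkn : k ≤ n) :
    ∑ i ∈ Finset.Icc (n - k + 1) n, m i = massFormula (spectralMeasure n lam b) k := by
  rw [sum_mass_eq n x m hkn, DPPeakon.massFormula_eq hk (bimomentDet_ne_zero h.strictMono h.pos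
    (fun k hk hkn => h.residue_pos hp k hk hkn) hkn) (transferQ_coeff_zero n x m k)
    (h.sum_bimoment_mul_transferQ hp hkn)]

theorem IsSpectrum.expMassFormula_eq (h : IsSpectrum n x m lam b) (hp : PurePeakon n x m)
    (hk : 1 ≤ k) (hkn : k ≤ n) : ∑ i ∈ Finset.Icc (n - k + 1) n, m i * Real.exp (x i) =
      expMassFormula (spectralMeasure n lam b) k := by
  have hb := fun k hk hkn => h.residue_pos hp k hk hkn
  rw [sum_expMass_eq n x m hkn, DPPeakon.expMassFormula_eq (bimomentDet_ne_zero h.strictMono h.pos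
    hb hkn) (transferQ_coeff_zero n x m k) (h.sum_bimoment_mul_transferQ hp hkn)]
  congr 2
  -- At `z = 0`, which is no node, the integral formula for `p` gives `p(0) = ∑ γⱼ q[j+1]`.
  have h1 := h.eval_p hp (h.isApproximant hp hk hkn) 0 fun i hi => by
    have := h.pos i (Finset.mem_Icc.1 hi).1 (Finset.mem_Icc.1 hi).2
    exact_mod_cast this.ne
  rw [← coeff_zero_eq_eval_zero, coeff_map, ← coeff_zero_eq_eval_zero, coeff_map] at h1
  have h2 : (transferP n x m k).coeff 0 = ∑ i ∈ Finset.Icc 1 n,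
      b i * (((transferQ n x m k).coeff 0 - (transferQ n x m k).eval (lam i)) / (0 - lam i)) := by
    have h3 : ∀ i : ℕ, ((transferQ n x m k).map (algebraMap ℝ ℂ)).eval (lam i : ℂ) =
        (((transferQ n x m k).eval (lam i) : ℝ) : ℂ) := fun i => by
      rw [← Complex.coe_algebraMap, eval_map_apply]
    simp only [h3, Complex.coe_algebraMap] at h1
    exact_mod_cast h1
  rw [h2]
  simp only [moment_spectralMeasure hb, Finset.sum_mul]
  rw [Finset.sum_comm]
  refine Finset.sum_congr rfl fun i hi => ?_
  have hi0 := h.pos i (Finset.mem_Icc.1 hi).1 (Finset.mem_Icc.1 hi).2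
  rw [eval_eq_sum_range' (Nat.lt_succ_of_le (natDegree_le_of_degree_le (degree_transferQ hp hkn).le)),
    Finset.sum_range_succ', pow_zero, mul_one, sub_add_cancel_right, zero_sub, neg_div_neg_eq,
    Finset.sum_div, Finset.mul_sum]
  refine Finset.sum_congr rfl fun j _ => ?_
  rw [pow_succ]
  field_simp

/-! ### Biorthogonality -/

/-- One more vanishing moment would make `z^(k+1)` times the third remainder tend to zero. But that
remainder is an explicit quotient of exact order `z^(-k-1)`. -/
theorem IsSpectrum.bimoment_pairing_ne_zero (h : IsSpectrum n x m lam b)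
    (hp : PurePeakon n x m) (hkn : k < n) :
    ∑ j ∈ Finset.range (k + 1), bimoment (spectralMeasure n lam b) k j *
      (transferQ n x m k).coeff j ≠ 0 := by
  intro hzero
  have hb := fun k hk hkn => h.residue_pos hp k hk hkn
  set q := (transferQ n x m k).map (algebraMap ℝ ℂ)
  have hqdeg : q.natDegree ≤ k := by
    rw [natDegree_map]
    exact natDegree_le_of_degree_le (degree_transferQ hp hkn.le).le
  have hmom : ∀ i < k + 1, ∑ l ∈ Finset.Icc 1 n, residueThird n lam b q l * (-(lam l : ℂ)) ^ i = 0 := by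
    intro i hi
    rw [sum_residueThird hb hqdeg]
    refine mul_eq_zero_of_right _ ?_
    simp only [q, coeff_map, Complex.coe_algebraMap]
    rcases Nat.lt_succ_iff_lt_or_eq.1 hi with hi | rfl
    · exact_mod_cast h.sum_bimoment_mul_transferQ hp hkn.le i hi
    · exact_mod_cast hzero
  have hlim := tendsto_pow_mul_sum_poles (Finset.Icc 1 n) (fun l => -(lam l : ℂ))
    (residueThird n lam b q) k fun i hi => hmom i (by omega)
  rw [hmom k (by omega)] at hlim
  set P : ℝ[X] := (coeffC (n - k) x m).comp (-X) * X ^ k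
  set Q : ℝ[X] := (coeffA n x m).comp (-X)
  have hcomp : ∀ p : ℝ[X], (p.comp (-X)).natDegree = p.natDegree := fun p => by
    rw [natDegree_comp, natDegree_neg, natDegree_X, mul_one]
  -- This needs `k < n`: with no peakon left, `C` is zero.
  have hCdeg : (coeffC (n - k) x m).natDegree = n - k :=
    natDegree_eq_of_degree_eq_some
      (degree_transferMatrix_col (hp.of_le (Nat.sub_le n k)) (by omega) le_rfl 2)
  have hP0 : (coeffC (n - k) x m).comp (-X) ≠ 0 := fun h0 => by
    have := hcomp (coeffC (n - k) x m)
    rw [h0, hCdeg, natDegree_zero] at this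
    omega
  have hPdeg : P.natDegree = n := by
    simp only [P]
    rw [natDegree_mul_X_pow _ hP0, hcomp, hCdeg]
    omega
  have hPne : P ≠ 0 := mul_ne_zero hP0 (pow_ne_zero _ X_ne_zero)
  have hO := isBigO_div_of_natDegree_le (P := Q.map (algebraMap ℝ ℂ)) (Q := P.map (algebraMap ℝ ℂ))
    (N := 0) ((Polynomial.map_ne_zero_iff (algebraMap ℝ ℂ).injective).2 hPne)
    (by rw [natDegree_map, natDegree_map, hPdeg, hcomp, natDegree_coeffA hp, add_zero])
  simp only [pow_zero, div_one] at hO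
  have h1 : (fun _ : ℂ => (1 : ℂ)) =O[cobounded ℂ] fun z => z ^ (k + 1) *
      ∑ l ∈ Finset.Icc 1 n, residueThird n lam b q l / (z - -(lam l : ℂ)) := by
    refine ((hO.mul (isBigO_refl (fun z : ℂ => z ^ (k + 1) *
      ∑ l ∈ Finset.Icc 1 n, residueThird n lam b q l / (z - -(lam l : ℂ))) _)).const_mul_left
      (-1)).congr' ?_ (by simp only [one_mul]; exact Filter.EventuallyEq.rfl)
    have hPev : ∀ᶠ z in cobounded ℂ, (P.map (algebraMap ℝ ℂ)).eval z ≠ 0 :=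
      le_cofinite ℂ (eventually_cofinite_not_isRoot
        ((Polynomial.map_ne_zero_iff (algebraMap ℝ ℂ).injective).2 hPne))
    filter_upwards [eventually_ne_cobounded (0 : ℂ), hPev,
      eventually_ne_cobounded_finset (Finset.Icc 1 n) (fun k => (lam k : ℂ)),
      eventually_ne_cobounded_finset (Finset.Icc 1 n) (fun k => -(lam k : ℂ))] with z hz0 hPz hz hz'
    have hpz : ((transferP n x m k).map (algebraMap ℝ ℂ)).eval z = ∑ i ∈ Finset.Icc 1 n,
        (b i : ℂ) * ((q.eval z - q.eval (lam i : ℂ)) / (z - lam i)) := by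
      rcases Nat.eq_zero_or_pos k with rfl | hk
      · simp [q, transferP, transferQ, transferMatrix]
      · exact h.eval_p hp (h.isApproximant hp hk hkn.le) z hz
    have hphz : ((transferPhat n x m k).map (algebraMap ℝ ℂ)).eval z = ∑ i ∈ Finset.Icc 1 n,
        (residueZ n lam b i : ℂ) * ((q.eval z - q.eval (lam i : ℂ)) / (z - lam i)) := by
      rcases Nat.eq_zero_or_pos k with rfl | hk
      · simp [q, transferPhat, transferQ, transferMatrix]
      · exact h.eval_phat hp (h.isApproximant hp hk hkn.le) z hz
    have h3 := third_remainder_eq h.pos hb _ _ q z hz hz' hpz hphz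
    have h4 := h.third_remainder_transfer hp hkn.le hz0 hz'
    simp only [q, eval_map_algebraMap] at h3
    rw [h4] at h3
    have hA := aeval_coeffA_ne_zero hp h.strictMono h.eval_coeffA (-z) fun k h1 h2 e =>
      hz' k (Finset.mem_Icc.2 ⟨h1, h2⟩) (by rw [← e, neg_neg])
    rw [← h3]
    simp only [eval_map_algebraMap, P, Q, map_mul, aeval_comp, map_neg, aeval_X, map_pow] at hPz ⊢
    have hC := left_ne_zero_of_mul hPz
    field_simp
    ring
  exact one_ne_zero (tendsto_nhds_unique tendsto_const_nhds (h1.trans_tendsto hlim))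

/-- There are `i` equations in `i + 1` unknowns, so a nonzero solution exists. If its degree `d`
were below `i`, triangularity would reduce equation `d` to leading coefficient times `E d d`, which
is nonzero. -/
theorem exists_poly_orthogonal (E : ℕ → ℕ → ℝ) (n : ℕ) (h0 : ∀ a j, a < j → j ≤ n → E a j = 0)
    (h1 : ∀ j < n, E j j ≠ 0) (i : ℕ) (hi : i ≤ n) : ∃ φ : ℝ[X], φ.degree = i ∧
      ∀ j < i, ∑ a ∈ Finset.range (i + 1), φ.coeff a * E a j = 0 := by
  have hker := LinearMap.ker_ne_bot_of_finrank_lt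
    (f := (Matrix.of fun (j : Fin i) (a : Fin (i + 1)) => E a j).mulVecLin) (by simp)
  obtain ⟨v, hv, hv0⟩ := (Submodule.ne_bot_iff _).1 hker
  set φ : ℝ[X] := ∑ a : Fin (i + 1), C (v a) * X ^ (a : ℕ)
  have hcoeff : ∀ a : Fin (i + 1), φ.coeff a = v a := fun a => by
    simp only [φ, finsetSum_coeff, coeff_C_mul_X_pow]
    rw [Finset.sum_eq_single_of_mem a (Finset.mem_univ _) fun j _ hj =>
      if_neg fun e => hj (Fin.ext e.symm), if_pos rfl]
  have horth : ∀ j < i, ∑ a ∈ Finset.range (i + 1), φ.coeff a * E a j = 0 := fun j hj => by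
    have h2 := congrFun (LinearMap.mem_ker.1 hv) ⟨j, hj⟩
    simp only [Matrix.mulVecLin_apply, Matrix.mulVec, dotProduct, Matrix.of_apply,
      Pi.zero_apply] at h2
    rw [← Fin.sum_univ_eq_sum_range (fun a => φ.coeff a * E a j), ← h2]
    exact Finset.sum_congr rfl fun a _ => by rw [hcoeff, mul_comm]
  have hdeg : φ.natDegree ≤ i := by
    refine natDegree_sum_le_of_forall_le _ _ fun a _ => (natDegree_C_mul_X_pow_le _ _).trans ?_
    omega
  have hφ : φ ≠ 0 := fun h => hv0 (funext fun a => by rw [← hcoeff a, h]; simp)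
  refine ⟨φ, ?_, horth⟩
  rw [degree_eq_natDegree hφ]
  by_contra hne
  have hlt : φ.natDegree < i := lt_of_le_of_ne hdeg fun e => hne (by rw [e])
  have h2 := horth _ hlt
  rw [Finset.sum_eq_single_of_mem φ.natDegree (by simp; omega)] at h2
  · exact mul_ne_zero (leadingCoeff_ne_zero.2 hφ) (h1 _ (by omega)) h2
  · intro a _ ha
    rcases lt_or_gt_of_ne ha with ha | ha
    · rw [h0 a _ ha (by omega), mul_zero]
    · rw [coeff_eq_zero_of_natDegree_lt ha, zero_mul]

theorem cauchyPairing_eq_sum (hb : ∀ k, 1 ≤ k → k ≤ n → 0 < b k)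
    (hpos : ∀ k, 1 ≤ k → k ≤ n → 0 < lam k) {f g : ℝ[X]} {M N : ℕ} (hf : f.natDegree ≤ M)
    (hg : g.natDegree ≤ N) :
    cauchyPairing (xMeasure (spectralMeasure n lam b)) (spectralMeasure n lam b) f g =
      ∑ a ∈ Finset.range (M + 1), f.coeff a * ∑ j ∈ Finset.range (N + 1),
        bimoment (spectralMeasure n lam b) a j * g.coeff j := by
  rw [cauchyPairing, integral_spectralMeasure hb]
  simp only [integral_xMeasure hb hpos, smul_eq_mul, bimoment_spectralMeasure hb,
    eval_eq_sum_range' (Nat.lt_succ_of_le hf), eval_eq_sum_range' (Nat.lt_succ_of_le hg),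
    Finset.mul_sum, Finset.sum_mul, Finset.sum_div]
  simp only [Finset.sum_comm (s := Finset.Icc 1 n) (t := Finset.range _)]
  rw [Finset.sum_comm]
  refine Finset.sum_congr rfl fun a _ => Finset.sum_congr rfl fun j _ =>
    Finset.sum_congr rfl fun l _ => Finset.sum_congr rfl fun k _ => ?_
  ring

theorem IsSpectrum.exists_biorthogonal (h : IsSpectrum n x m lam b) (hp : PurePeakon n x m) :
    ∃ φ : ℕ → ℝ[X], IsCauchyBiorthogonal (xMeasure (spectralMeasure n lam b))
      (spectralMeasure n lam b) n φ (qPoly (spectralMeasure n lam b)) := by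
  have hb := fun k hk hkn => h.residue_pos hp k hk hkn
  set E : ℕ → ℕ → ℝ := fun a j => ∑ l ∈ Finset.range (j + 1),
    bimoment (spectralMeasure n lam b) a l * (transferQ n x m j).coeff l
  have hE0 : ∀ a j, a < j → j ≤ n → E a j = 0 := fun a j haj hj =>
    h.sum_bimoment_mul_transferQ hp hj a haj
  have hE1 : ∀ j < n, E j j ≠ 0 := fun j hj => h.bimoment_pairing_ne_zero hp hj
  have hex : ∀ i, ∃ φ : ℝ[X], i ≤ n → φ.degree = i ∧
      ∀ j < i, ∑ a ∈ Finset.range (i + 1), φ.coeff a * E a j = 0 := fun i => by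
    by_cases hi : i ≤ n
    · obtain ⟨φ, hφ⟩ := exists_poly_orthogonal E n hE0 hE1 i hi
      exact ⟨φ, fun _ => hφ⟩
    · exact ⟨0, fun h => absurd h hi⟩
  choose φ hφ using hex
  have hpair : ∀ i ≤ n, ∀ j ≤ n, cauchyPairing (xMeasure (spectralMeasure n lam b))
      (spectralMeasure n lam b) (φ i) (qPoly (spectralMeasure n lam b) j) =
      ∑ a ∈ Finset.range (i + 1), (φ i).coeff a * E a j := fun i hi j hj => by
    rw [h.qPoly_eq hp hj, cauchyPairing_eq_sum hb h.pos
      (natDegree_le_of_degree_le (hφ i hi).1.le)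
      (natDegree_le_of_degree_le (degree_transferQ hp hj).le)]
  refine ⟨φ, fun i hi => (hφ i hi).1, fun i hi => by rw [h.qPoly_eq hp hi, degree_transferQ hp hi],
    fun i hi j hj hij => ?_, fun i hi => ?_⟩
  · rw [hpair i hi j hj]
    rcases lt_or_gt_of_ne hij with hij | hij
    · exact Finset.sum_eq_zero fun a ha => by
        rw [Finset.mem_range] at ha
        rw [hE0 a j (by omega) hj, mul_zero]
    · exact (hφ i hi).2 j hij
  · rw [hpair i hi.le i hi.le, Finset.sum_range_succ, Finset.sum_eq_zero fun a ha => by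
      rw [hE0 a i (Finset.mem_range.1 ha) hi.le, mul_zero], zero_add]
    exact mul_ne_zero (coeff_ne_zero_of_eq_degree (hφ i hi.le).1) (hE1 i hi)

end Approximant

/-! ### The peakon flow -/

/-- A solution of a differential inequality `|f'| ≤ K |f|` cannot reach zero. -/
theorem pos_of_abs_deriv_le {J : Set ℝ} (hJ : J.OrdConnected) {f f' K : ℝ → ℝ}
    (hf : ∀ t ∈ J, HasDerivAt f (f' t) t) (hK : ContinuousOn K J)
    (hbound : ∀ t ∈ J, |f' t| ≤ K t * |f t|) {t₀ : ℝ} (ht₀ : t₀ ∈ J) (hpos : 0 < f t₀) :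
    ∀ t ∈ J, 0 < f t := by
  have forward : ∀ {g g' L : ℝ → ℝ} {a c : ℝ}, a ≤ c →
      (∀ t ∈ Set.Icc a c, HasDerivAt g (g' t) t) → ContinuousOn L (Set.Icc a c) →
      (∀ t ∈ Set.Icc a c, |g' t| ≤ L t * |g t|) → g a = 0 → g c = 0 := by
    intro g g' L a c hac hg hL hgb ha
    obtain ⟨M, hM⟩ := isCompact_Icc.exists_bound_of_continuousOn hL
    refine eq_zero_of_abs_deriv_le_mul_abs_self_of_eq_zero_right (f' := g') (K := M)
      (fun t ht => (hg t ht).continuousAt.continuousWithinAt)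
      (fun t ht => (hg t ⟨ht.1, ht.2.le⟩).hasDerivWithinAt) ha (fun t ht => ?_) c ⟨hac, le_rfl⟩
    have ht' : t ∈ Set.Icc a c := ⟨ht.1, ht.2.le⟩
    rw [Real.norm_eq_abs, Real.norm_eq_abs]
    refine (hgb t ht').trans (mul_le_mul_of_nonneg_right ?_ (abs_nonneg _))
    exact (le_abs_self _).trans (hM t ht')
  -- A zero at `t` would propagate to `t₀` by Grönwall, forwards directly and backwards after
  -- reversing time.
  have hne : ∀ t ∈ J, f t ≠ 0 := fun t ht h0 => by
    rcases le_total t t₀ with hle | hle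
    · have hsub : Set.Icc t t₀ ⊆ J := hJ.out ht ht₀
      exact hpos.ne' (forward hle (fun s hs => hf s (hsub hs)) (hK.mono hsub)
        (fun s hs => hbound s (hsub hs)) h0)
    · have hsub : ∀ s ∈ Set.Icc (-t) (-t₀), -s ∈ J := fun s hs =>
        hJ.out ht₀ ht ⟨by linarith [hs.2], by linarith [hs.1]⟩
      have := forward (g := fun s => f (-s)) (g' := fun s => -f' (-s)) (L := fun s => K (-s))
        (neg_le_neg hle)
        (fun s hs => by
          have h1 : HasDerivAt (fun s => f (-s)) _ s :=
            (hf _ (hsub s hs)).comp s (hasDerivAt_neg s)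
          rwa [mul_neg_one] at h1)
        (hK.comp continuous_neg.continuousOn hsub)
        (fun s hs => by rw [abs_neg]; exact hbound _ (hsub s hs)) (by simpa using h0)
      simp only [neg_neg] at this
      exact hpos.ne' this
  have hcont : ContinuousOn f J := fun t ht => (hf t ht).continuousAt.continuousWithinAt
  intro t ht
  by_contra hcon
  obtain ⟨s, hs, hs0⟩ := (hJ.isPreconnected.image f hcont).ordConnected.out
    (Set.mem_image_of_mem f ht) (Set.mem_image_of_mem f ht₀) ⟨not_lt.1 hcon, hpos.le⟩
  exact hne s hs hs0

theorem abs_exp_neg_abs_sub_le (a c : ℝ) :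
    |Real.exp (-|a|) - Real.exp (-|c|)| ≤ |a - c| := by
  wlog h : |a| ≤ |c| generalizing a c
  · rw [abs_sub_comm, abs_sub_comm a]
    exact this c a (not_le.1 h).le
  have h1 : Real.exp (-|c|) ≤ Real.exp (-|a|) := Real.exp_le_exp.2 (neg_le_neg h)
  rw [abs_of_nonneg (sub_nonneg.2 h1)]
  have h2 : Real.exp (-|c|) = Real.exp (-|a|) * Real.exp (-(|c| - |a|)) := by
    rw [← Real.exp_add]; congr 1; ring
  have h3 := Real.add_one_le_exp (-(|c| - |a|))
  have h4 : Real.exp (-|a|) ≤ 1 := Real.exp_le_one_iff.2 (neg_nonpos.2 (abs_nonneg a))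
  have h5 : |c| - |a| ≤ |a - c| := by
    rw [abs_sub_comm]; exact abs_sub_abs_le_abs_sub c a
  have h6 := Real.exp_pos (-|a|)
  rw [h2]
  nlinarith

variable {n : ℕ} {J : Set ℝ} {x m : ℕ → ℝ → ℝ}

theorem IsPeakonFlow.continuousOn_mass (h : IsPeakonFlow n J x m) :
    ContinuousOn (fun t => 2 * ∑ i ∈ Finset.Icc 1 n, |m i t|) J :=
  continuousOn_const.mul (continuousOn_finsetSum _ fun i hi => (ContinuousOn.abs fun t ht =>
    (h t ht i (Finset.mem_Icc.1 hi).1 (Finset.mem_Icc.1 hi).2).2.continuousAt.continuousWithinAt))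

/-- Take `K = 2 ∑ |mᵢ|`. For gaps the bound `|f'| ≤ K|f|` follows since `e^{-|·|}` is `1`-Lipschitz,
for masses since sign and exponential are bounded by `1`. -/
theorem IsPeakonFlow.purePeakon (h : IsPeakonFlow n J x m) (hJ : J.OrdConnected)
    (h0 : 0 ∈ J) (hp : PurePeakon n (fun i => x i 0) fun i => m i 0) :
    ∀ t ∈ J, PurePeakon n (fun i => x i t) fun i => m i t := by
  have hsign : ∀ r : ℝ, |Real.sign r| ≤ 1 := fun r => by
    rcases Real.sign_apply_eq r with h | h | h <;> simp [h]
  refine fun t ht => ⟨fun i j hi hij hj => ?_, fun i hi hin => ?_⟩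
  · have := pos_of_abs_deriv_le hJ (f := fun t => x j t - x i t)
      (fun t ht => (h t ht j (by omega) hj).1.sub (h t ht i hi (by omega)).1)
      h.continuousOn_mass (fun t ht => ?_) h0 (sub_pos.2 (hp.1 i j hi hij hj)) t ht
    · exact sub_pos.1 this
    · rw [← Finset.sum_sub_distrib]
      refine (Finset.abs_sum_le_sum_abs _ _).trans ?_
      rw [mul_assoc, Finset.sum_mul, Finset.mul_sum]
      refine Finset.sum_le_sum fun l _ => ?_
      rw [← mul_sub, abs_mul]
      have h1 := abs_exp_neg_abs_sub_le (x j t - x l t) (x i t - x l t)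
      rw [sub_sub_sub_cancel_right] at h1
      have h2 := mul_le_mul_of_nonneg_left h1 (abs_nonneg (m l t))
      have h3 : 0 ≤ |m l t| * |x j t - x i t| := by positivity
      linarith
  · refine pos_of_abs_deriv_le hJ (fun t ht => (h t ht i hi hin).2) h.continuousOn_mass
      (fun t ht => ?_) h0 (hp.2 i hi hin) t ht
    rw [abs_mul, abs_two, mul_assoc]
    refine mul_le_mul_of_nonneg_left ((Finset.abs_sum_le_sum_abs _ _).trans ?_) (by norm_num)
    rw [Finset.sum_mul]
    refine Finset.sum_le_sum fun l _ => ?_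
    rw [abs_mul, abs_mul, abs_mul, Real.abs_exp, mul_comm |m i t|]
    have h1 : Real.exp (-|x i t - x l t|) ≤ 1 :=
      Real.exp_le_one_iff.2 (neg_nonpos.2 (abs_nonneg _))
    have h2 := mul_le_one₀ (hsign (x i t - x l t)) (Real.exp_pos _).le h1
    rw [mul_assoc]
    exact mul_le_of_le_one_right (by positivity) h2

/-- `∑_{i ≤ k} mᵢ e^{xᵢ}`. -/
def leftMass (x m : ℕ → ℝ) (k : ℕ) : ℝ := ∑ i ∈ Finset.Icc 1 k, m i * Real.exp (x i)

/-- `∑_{i > k} mᵢ e^{-xᵢ}`. -/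
def rightMass (n : ℕ) (x m : ℕ → ℝ) (k : ℕ) : ℝ :=
  ∑ i ∈ Finset.Icc (k + 1) n, m i * Real.exp (-x i)

theorem sum_Icc_split {k : ℕ} (hk : k < n) (F : ℕ → ℝ) : ∑ i ∈ Finset.Icc 1 n, F i =
    ∑ i ∈ Finset.Icc 1 k, F i + F (k + 1) + ∑ i ∈ Finset.Icc (k + 2) n, F i := by
  induction n, hk using Nat.le_induction with
  | base => rw [Finset.sum_Icc_succ_top (by omega), Finset.Icc_eq_empty (by omega : ¬k + 2 ≤ k.succ)]
            simp
  | succ n hn ih =>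
    rw [Finset.sum_Icc_succ_top (by omega), ih, Finset.sum_Icc_succ_top (by omega : k + 2 ≤ n + 1),
      add_assoc]

theorem leftMass_succ (x m : ℕ → ℝ) (k : ℕ) :
    leftMass x m (k + 1) = leftMass x m k + m (k + 1) * Real.exp (x (k + 1)) :=
  Finset.sum_Icc_succ_top (by omega) _

theorem rightMass_eq {n : ℕ} (x m : ℕ → ℝ) {k : ℕ} (hk : k < n) :
    rightMass n x m k = rightMass n x m (k + 1) + m (k + 1) * Real.exp (-x (k + 1)) := by
  rw [rightMass, ← Finset.insert_Icc_succ_left_eq_Icc (by omega : k + 1 ≤ n), Finset.sum_insert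
    (by simp), add_comm]
  rfl

theorem velocity_eq {x m : ℕ → ℝ} (hp : PurePeakon n x m) {k : ℕ} (hk : k < n) :
    ∑ i ∈ Finset.Icc 1 n, m i * Real.exp (-|x (k + 1) - x i|) =
      leftMass x m k * Real.exp (-x (k + 1)) + m (k + 1) +
        rightMass n x m (k + 1) * Real.exp (x (k + 1)) := by
  rw [sum_Icc_split hk, leftMass, rightMass, Finset.sum_mul, Finset.sum_mul]
  congr 1
  · congr 1
    · refine Finset.sum_congr rfl fun i hi => ?_
      rw [Finset.mem_Icc] at hi
      have := hp.1 i (k + 1) hi.1 (by omega) (by omega)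
      rw [abs_of_pos (sub_pos.2 this), mul_assoc, ← Real.exp_add]
      ring_nf
    · simp
  · refine Finset.sum_congr rfl fun i hi => ?_
    rw [Finset.mem_Icc] at hi
    have := hp.1 (k + 1) i (by omega) (by omega) hi.2
    rw [abs_of_neg (sub_neg.2 this), mul_assoc, ← Real.exp_add]
    ring_nf

theorem massRate_eq {x m : ℕ → ℝ} (hp : PurePeakon n x m) {k : ℕ} (hk : k < n) :
    2 * ∑ i ∈ Finset.Icc 1 n, m (k + 1) * m i * Real.sign (x (k + 1) - x i) *
      Real.exp (-|x (k + 1) - x i|) = 2 * m (k + 1) * (leftMass x m k * Real.exp (-x (k + 1)) -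
        rightMass n x m (k + 1) * Real.exp (x (k + 1))) := by
  rw [sum_Icc_split hk, sub_self, Real.sign_zero, mul_zero, zero_mul, add_zero, mul_assoc]
  congr 1
  rw [leftMass, rightMass, mul_sub, Finset.sum_mul, Finset.sum_mul, Finset.mul_sum, Finset.mul_sum,
    sub_eq_add_neg, ← Finset.sum_neg_distrib]
  congr 1
  · refine Finset.sum_congr rfl fun i hi => ?_
    rw [Finset.mem_Icc] at hi
    have := sub_pos.2 (hp.1 i (k + 1) hi.1 (by omega) (by omega))
    rw [abs_of_pos this, Real.sign_of_pos this, mul_assoc (m i), ← Real.exp_add]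
    ring_nf
  · refine Finset.sum_congr rfl fun i hi => ?_
    rw [Finset.mem_Icc] at hi
    have := sub_neg.2 (hp.1 (k + 1) i (by omega) (by omega) hi.2)
    rw [abs_of_neg this, Real.sign_of_neg this, mul_assoc (m i), ← Real.exp_add]
    ring_nf

/-- The time evolution of the first column of `Sₖ ⋯ S₁` (the Lax equation). -/
theorem IsPeakonFlow.hasDerivAt_column (h : IsPeakonFlow n J x m)
    (hp : ∀ t ∈ J, PurePeakon n (fun i => x i t) fun i => m i t) {t : ℝ} (ht : t ∈ J) {z w : ℝ}
    (hzw : z * w = 1) {k : ℕ} (hk : k ≤ n) :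
    HasDerivAt (fun t => (coeffA k (fun i => x i t) fun i => m i t).eval z)
      (rightMass n (fun i => x i t) (fun i => m i t) k *
        (coeffB k (fun i => x i t) fun i => m i t).eval z) t ∧
    HasDerivAt (fun t => (coeffB k (fun i => x i t) fun i => m i t).eval z)
      (w * (coeffB k (fun i => x i t) fun i => m i t).eval z -
        2 * leftMass (fun i => x i t) (fun i => m i t) k *
          (coeffA k (fun i => x i t) fun i => m i t).eval z +
        2 * rightMass n (fun i => x i t) (fun i => m i t) k *
          (coeffC k (fun i => x i t) fun i => m i t).eval z) t ∧
    HasDerivAt (fun t => (coeffC k (fun i => x i t) fun i => m i t).eval z)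
      (-leftMass (fun i => x i t) (fun i => m i t) k *
        (coeffB k (fun i => x i t) fun i => m i t).eval z) t := by
  induction k with
  | zero => simp [coeffA, coeffB, coeffC, transferMatrix, leftMass, hasDerivAt_const]
  | succ k ih =>
    obtain ⟨hA, hB, hC⟩ := ih (by omega)
    obtain ⟨hx, hm⟩ := h t ht (k + 1) (by omega) hk
    have hx' := hx.congr_deriv (velocity_eq (hp t ht) hk)
    have hm' := hm.congr_deriv (massRate_eq (hp t ht) hk)
    have hE := hx'.exp
    have hF := hx'.neg.exp
    have hEF : Real.exp (x (k + 1) t) * Real.exp (-x (k + 1) t) = 1 := by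
      rw [← Real.exp_add]; simp
    have hf := ((hE.mul hA).add hB).add (hF.mul hC)
    have hcol : ∀ i t, (transferMatrix (k + 1) (fun i => x i t) (fun i => m i t) (k + 1) i 0).eval z =
        (transferMatrix k (fun i => x i t) (fun i => m i t) k i 0).eval z -
          z * (m (k + 1) t * jumpCol (x (k + 1) t) i * (Real.exp (x (k + 1) t) *
            (coeffA k (fun i => x i t) fun i => m i t).eval z +
            (coeffB k (fun i => x i t) fun i => m i t).eval z + Real.exp (-x (k + 1) t) *
            (coeffC k (fun i => x i t) fun i => m i t).eval z)) := fun i t => by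
      rw [transferMatrix_succ_apply]
      simp [coeffA, coeffB, coeffC]
    have hR := rightMass_eq (fun i => x i t) (fun i => m i t) (show k < n by omega)
    have hL := leftMass_succ (fun i => x i t) (fun i => m i t) k
    beta_reduce at hR hL
    have e0 := hcol 0
    have e1 := hcol 1
    have e2 := hcol 2
    simp only [jumpCol, Matrix.cons_val_zero, Matrix.cons_val_one, Matrix.cons_val] at e0 e1 e2
    change ∀ t, (coeffA (k + 1) _ _).eval z = (coeffA k _ _).eval z - _ at e0
    change ∀ t, (coeffB (k + 1) _ _).eval z = (coeffB k _ _).eval z - _ at e1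
    change ∀ t, (coeffC (k + 1) _ _).eval z = (coeffC k _ _).eval z - _ at e2
    have d0 := hA.sub (((hm'.mul hF).mul hf).const_mul z)
    have d1 := hB.sub (((hm'.mul_const (-2)).mul hf).const_mul z)
    have d2 := hC.sub (((hm'.mul hE).mul hf).const_mul z)
    simp only [e0, e1, e2, hL]
    rw [hR] at d0 d1 d2
    refine ⟨d0.congr_deriv ?_, d1.congr_deriv ?_, d2.congr_deriv ?_⟩ <;> clear d0 d1 d2 hf hE hF
    all_goals simp only [Pi.add_apply, Pi.mul_apply, Pi.neg_apply]
    -- The three derivative identities are now polynomial identities modulo `E F = 1` and `z w = 1`.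
    all_goals
      generalize Real.exp (x (k + 1) t) = E at hEF ⊢
      generalize Real.exp (-x (k + 1) t) = F at hEF ⊢
      generalize rightMass n (fun i => x i t) (fun i => m i t) (k + 1) = R
      generalize leftMass (fun i => x i t) (fun i => m i t) k = L
      generalize (coeffA k (fun i => x i t) fun i => m i t).eval z = a
      generalize (coeffB k (fun i => x i t) fun i => m i t).eval z = b
      generalize (coeffC k (fun i => x i t) fun i => m i t).eval z = c
      generalize m (k + 1) t = μ
      clear * - hEF hzw
      grobner

/-- For the full product no mass lies to the right, so the Lax equation gives zero derivative at
every `z ≠ 0`. -/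
theorem IsPeakonFlow.coeffA_eq (h : IsPeakonFlow n J x m)
    (hp : ∀ t ∈ J, PurePeakon n (fun i => x i t) fun i => m i t) (hJo : IsOpen J)
    (hJ : J.OrdConnected) {s t : ℝ} (hs : s ∈ J) (ht : t ∈ J) :
    coeffA n (fun i => x i t) (fun i => m i t) = coeffA n (fun i => x i s) fun i => m i s := by
  refine eq_of_infinite_eval_eq _ _ (Set.Infinite.mono (s := ({0}ᶜ : Set ℝ)) (fun z hz => ?_)
    (Set.finite_singleton 0).infinite_compl)
  have hd : ∀ t ∈ J,
      HasDerivAt (fun t => (coeffA n (fun i => x i t) fun i => m i t).eval z) 0 t := fun t ht => by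
    have := (h.hasDerivAt_column hp ht (mul_inv_cancel₀ hz) le_rfl).1
    rwa [rightMass, Finset.Icc_eq_empty (by omega), Finset.sum_empty, zero_mul] at this
  exact hJo.is_const_of_deriv_eq_zero hJ.isPreconnected
    (fun t ht => (hd t ht).differentiableAt.differentiableWithinAt)
    (fun t ht => (hd t ht).deriv) ht hs

/-- At a zero of the conserved `A`, with no mass to the right, the Lax equation reduces to `B' =
B/z`. -/
theorem IsPeakonFlow.eval_coeffB_eq (h : IsPeakonFlow n J x m)
    (hp : ∀ t ∈ J, PurePeakon n (fun i => x i t) fun i => m i t) (hJo : IsOpen J)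
    (hJ : J.OrdConnected) (h0 : 0 ∈ J) {z : ℝ} (hz : z ≠ 0)
    (hroot : (coeffA n (fun i => x i 0) fun i => m i 0).eval z = 0) {t : ℝ} (ht : t ∈ J) :
    (coeffB n (fun i => x i t) fun i => m i t).eval z =
      (coeffB n (fun i => x i 0) fun i => m i 0).eval z * Real.exp (t / z) := by
  have hd : ∀ t ∈ J, HasDerivAt (fun t => (coeffB n (fun i => x i t) fun i => m i t).eval z *
      Real.exp (-(t / z))) 0 t := fun t ht => by
    have h1 := (h.hasDerivAt_column hp ht (mul_inv_cancel₀ hz) le_rfl).2.1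
    rw [rightMass, Finset.Icc_eq_empty (by omega), Finset.sum_empty, mul_zero, zero_mul, add_zero,
      h.coeffA_eq hp hJo hJ h0 ht, hroot, mul_zero, sub_zero] at h1
    refine (h1.mul ((hasDerivAt_id t).div_const z).neg.exp).congr_deriv ?_
    simp only [id_eq, one_div]
    ring
  have hc := hJo.is_const_of_deriv_eq_zero hJ.isPreconnected
    (fun t ht => (hd t ht).differentiableAt.differentiableWithinAt)
    (fun t ht => (hd t ht).deriv) ht h0
  simp only [zero_div, neg_zero, Real.exp_zero, mul_one] at hc
  rw [← hc, mul_assoc, ← Real.exp_add, neg_add_cancel, Real.exp_zero, mul_one]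

theorem IsPeakonFlow.isSpectrum (h : IsPeakonFlow n J x m)
    (hp : ∀ t ∈ J, PurePeakon n (fun i => x i t) fun i => m i t) (hJo : IsOpen J)
    (hJ : J.OrdConnected) (h0 : 0 ∈ J) {lam b : ℕ → ℝ}
    (hs : IsSpectrum n (fun i => x i 0) (fun i => m i 0) lam b) {t : ℝ} (ht : t ∈ J) :
    IsSpectrum n (fun i => x i t) (fun i => m i t) lam fun k => b k * Real.exp (t / lam k) := by
  have hA := h.coeffA_eq hp hJo hJ h0 ht
  refine ⟨hs.strictMono, hs.pos, fun k hk hkn => by rw [hA, hs.eval_coeffA k hk hkn],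
    fun k hk hkn => ?_⟩
  rw [h.eval_coeffB_eq hp hJo hJ h0 (hs.pos k hk hkn).ne' (hs.eval_coeffA k hk hkn) ht,
    hs.eval_coeffB k hk hkn, hA]
  ring

end DPPeakon

end

/-! ### The inverse problem and its time dependence -/

theorem mainTheorem1 (n : ℕ) (hn : 1 ≤ n) :
    -- the inverse problem for a pure peakon configuration
    (∀ x m : ℕ → ℝ, PurePeakon n x m →
      (∃ lam b : ℕ → ℝ, IsSpectralData n x m lam b) ∧
      ∀ lam b : ℕ → ℝ, IsSpectralData n x m lam b →
        (∀ k, 1 ≤ k → k ≤ n → 0 < lam k ∧ 0 < b k) ∧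
        -- the `q`s are Cauchy biorthogonal polynomials for `dα = x dμ`, `dβ = dμ`
        (∃ φ : ℕ → ℝ[X], IsCauchyBiorthogonal (xMeasure (spectralMeasure n lam b))
          (spectralMeasure n lam b) n φ (qPoly (spectralMeasure n lam b))) ∧
        (∀ k, 1 ≤ k → k ≤ n →
          bimomentDet (spectralMeasure n lam b) 0 1 k ≠ 0 ∧
          -- the approximation problem has exactly one solution, described below
          (∃ p phat q : ℂ[X], IsApproximant (spectralMeasure n lam b) k p phat q) ∧
          (∀ p phat q : ℂ[X], IsApproximant (spectralMeasure n lam b) k p phat q →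
            q = (qPoly (spectralMeasure n lam b) k).map (algebraMap ℝ ℂ) ∧
            (∀ z : ℂ, (∀ i, 1 ≤ i → i ≤ n → z ≠ (lam i : ℂ)) →
              p.eval z = ∫ y : ℝ, (q.eval z - q.eval (y : ℂ)) / (z - (y : ℂ))
                ∂(spectralMeasure n lam b) ∧
              (moment (spectralMeasure n lam b) 0 : ℂ) * p.eval z - phat.eval z =
                ∫ y : ℝ, ∫ x : ℝ, (q.eval z - q.eval (y : ℂ)) * (x : ℂ) /
                  ((z - (y : ℂ)) * ((x : ℂ) + (y : ℂ)))
                  ∂(spectralMeasure n lam b) ∂(spectralMeasure n lam b)) ∧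
            -- identification with the entries of `S_[n,k]`
            2 * (transferMatrix n x m k 0 0).map (algebraMap ℝ ℂ) = q ∧
            (transferMatrix n x m k 1 0).map (algebraMap ℝ ℂ) = -X * p ∧
            ((∑ i ∈ Finset.Icc (n - k + 1) n, m i : ℝ) : ℂ) = -q.coeff 1 / 2 ∧
            ((∑ i ∈ Finset.Icc (n - k + 1) n, m i * Real.exp (x i) : ℝ) : ℂ) =
              -p.coeff 0 / 2) ∧
          -- the determinant formulas
          ∑ i ∈ Finset.Icc (n - k + 1) n, m i = massFormula (spectralMeasure n lam b) k ∧
          ∑ i ∈ Finset.Icc (n - k + 1) n, m i * Real.exp (x i) =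
            expMassFormula (spectralMeasure n lam b) k ∧
          -- recursive recovery of the peakon with number `n - k + 1` from those to its right
          m (n - k + 1) = massFormula (spectralMeasure n lam b) k
            - ∑ i ∈ Finset.Icc (n - k + 2) n, m i ∧
          x (n - k + 1) = Real.log ((expMassFormula (spectralMeasure n lam b) k
            - ∑ i ∈ Finset.Icc (n - k + 2) n, m i * Real.exp (x i)) / m (n - k + 1))) ∧
        x n = Real.log (moment (spectralMeasure n lam b) 0) ∧
        m n = bimoment (spectralMeasure n lam b) 0 0 / bimoment (spectralMeasure n lam b) 0 1) ∧
    -- the time dependence: the above applies at every time with explicitly known spectral data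
    (∀ (J : Set ℝ) (x m : ℕ → ℝ → ℝ), IsOpen J → J.OrdConnected → 0 ∈ J →
      IsPeakonFlow n J x m → PurePeakon n (fun i => x i 0) (fun i => m i 0) →
      ∀ lam b : ℕ → ℝ, IsSpectralData n (fun i => x i 0) (fun i => m i 0) lam b →
        ∀ t ∈ J, PurePeakon n (fun i => x i t) (fun i => m i t) ∧
          IsSpectralData n (fun i => x i t) (fun i => m i t) lam
            (fun k => b k * Real.exp (t / lam k))) := by
  refine ⟨fun x m hp => ⟨?_, fun lam b hsd => ?_⟩, fun J x m hJo hJ h0 hflow hp lam b hsd t ht => ?_⟩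
  · obtain ⟨lam, b, h, -⟩ := exists_isSpectrum n x m hp
    exact ⟨lam, b, h.isSpectralData hp⟩
  · have h := hsd.isSpectrum hp
    have hb := fun k hk hkn => h.residue_pos hp k hk hkn
    have hrec : ∀ k, 1 ≤ k → k ≤ n → ∀ F : ℕ → ℝ, F (n - k + 1) =
        ∑ i ∈ Finset.Icc (n - k + 1) n, F i - ∑ i ∈ Finset.Icc (n - k + 2) n, F i :=
      fun k hk hkn F => by
        rw [← Finset.insert_Icc_succ_left_eq_Icc (by omega : n - k + 1 ≤ n),
          Finset.sum_insert (by simp)]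
        exact (add_sub_cancel_right _ _).symm
    have hmass : m n = bimoment (spectralMeasure n lam b) 0 0 /
        bimoment (spectralMeasure n lam b) 0 1 := by
      have h1 := h.massFormula_eq hp le_rfl hn
      rw [Nat.sub_add_cancel hn, Finset.Icc_self, Finset.sum_singleton] at h1
      rw [h1]
      simp [massFormula, bimomentDet, div_eq_inv_mul]
    refine ⟨fun k hk hkn => ⟨h.pos k hk hkn, hb k hk hkn⟩, h.exists_biorthogonal hp,
      fun k hk hkn => ⟨bimomentDet_ne_zero h.strictMono h.pos hb hkn,
        ⟨_, _, _, h.isApproximant hp hk hkn⟩, fun p phat q ha => ?_, h.massFormula_eq hp hk hkn,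
        h.expMassFormula_eq hp hk hkn, ?_, ?_⟩, ?_, hmass⟩
    · have hq := h.q_eq hp hkn ha
      have hq' : q = (transferQ n x m k).map (algebraMap ℝ ℂ) := by rw [hq, h.qPoly_eq hp hkn]
      have hpp := h.p_eq hp hk hkn ha
      refine ⟨hq, fun z hz => ?_, ?_, ?_, ?_, ?_⟩
      · have hz' : ∀ i ∈ Finset.Icc 1 n, z ≠ (lam i : ℂ) := fun i hi =>
          hz i (Finset.mem_Icc.1 hi).1 (Finset.mem_Icc.1 hi).2
        have h1 := h.eval_p hp ha z hz'
        refine ⟨?_, ?_⟩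
        · rw [h1, integral_spectralMeasure hb]
          simp only [Complex.real_smul]
        -- The combination `γ₀ p - p̂` turns the weight `λₖ/(λₖ+λⱼ)` of `Z` into its complement
        -- `λⱼ/(λₖ+λⱼ)`.
        · rw [h1, h.eval_phat hp ha z hz', moment_spectralMeasure hb, integral_spectralMeasure hb]
          simp only [integral_spectralMeasure hb, Complex.real_smul, residueZ, pow_zero, mul_one]
          push_cast
          rw [Finset.mul_sum, ← Finset.sum_sub_distrib]
          refine Finset.sum_congr rfl fun k hk => ?_
          rw [Finset.sum_mul, Finset.mul_sum, Finset.sum_mul, ← Finset.sum_sub_distrib,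
            Finset.mul_sum]
          refine Finset.sum_congr rfl fun j hj => ?_
          have h2 := h.pos k (Finset.mem_Icc.1 hk).1 (Finset.mem_Icc.1 hk).2
          have h3 := h.pos j (Finset.mem_Icc.1 hj).1 (Finset.mem_Icc.1 hj).2
          have h4 : (lam j : ℂ) + lam k ≠ 0 := by exact_mod_cast (add_pos h3 h2).ne'
          have h5 := sub_ne_zero.2 (hz' k hk)
          rw [add_comm (lam k : ℂ)]
          field_simp
          ring
      · rw [hq', transferQ, Polynomial.map_mul, map_C]
        rfl
      · rw [hpp, transferMatrix_one_zero]
        simp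
      · rw [hq', coeff_map, sum_mass_eq n x m hkn, Complex.coe_algebraMap]
        push_cast
        rfl
      · rw [hpp, coeff_map, sum_expMass_eq n x m hkn, Complex.coe_algebraMap]
        push_cast
        rfl
    · rw [← h.massFormula_eq hp hk hkn]
      exact hrec k hk hkn m
    · rw [← h.expMassFormula_eq hp hk hkn, ← hrec k hk hkn fun i => m i * Real.exp (x i),
        mul_div_cancel_left₀ _ (hp.2 _ (by omega) (by omega)).ne', Real.log_exp]
    · simp only [moment_spectralMeasure hb, pow_zero, mul_one, h.sum_eq hp hn, Real.log_exp]
  · have hpure := hflow.purePeakon hJ h0 hp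
    exact ⟨hpure t ht, (hflow.isSpectrum hpure hJo hJ h0 (hsd.isSpectrum hp) ht).isSpectralData
      (hpure t ht)⟩
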